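/- **Setting.** Let $(M,\mathcal A,\mathbf m)$ be a measure space (for instance a complete metric space with its Borel $\sigma$-algebra and a Radon measure) and let $p\in[1,\infty]$. An *$L^p(\mathbf m)$-normed module* is a real Banach space $(\mathcal M,\|\cdot\|)$ with a bilinear map $L^\infty(\mathbf m)\times\mathcal M\to\mathcal M$, $(f,v)\mapsto f\cdot v$, and a pointwise norm $|\cdot|:\mathcal M\to L^p(\mathbf m)$ with nonnegative values such that $(fg)\cdot v=f\cdot(g\cdot v)$, $\mathbf 1\cdot v=v$, $\|v\|=\||v|\|_{L^p(\mathbf m)}$ and $|f\cdot v|=|f||v|$ $\mathbf m$-a.e., and such that, for all sequences $(A_n)_n$ of measurable sets: * (locality) if $\chi_{A_n}\cdot v=0$ for all $n$, then $\chi_{\bigcup_n A_n}\cdot v=0$; * (glueing) if $v_n\in\mathcal M$ satisfy $\chi_{A_i\cap A_j}\cdot v_i=\chi_{A_i\cap A_j}\cdot v_j$ for all $i,j$ and $\limsup_n\|\sum_{i\le n}\chi_{A_i}\cdot v_i\|<\infty$, then there is $v\in\mathcal M$ with $\chi_{A_i}\cdot v=\chi_{A_i}\cdot v_i$ for all $i$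 and $\|v\|\le\liminf_n\|\sum_{i\le n}\chi_{A_i}\cdot v_i\|$. A set $V\subset\mathcal M$ is *independent on* a measurable set $A$ if, whenever $v_1,\dots,v_k\in V$ are distinct, $f_1,\dots,f_k\in L^\infty(\mathbf m)$ and $|\sum_i f_i\cdot v_i|=0$ $\mathbf m$-a.e. on $A$, then $f_i=0$ $\mathbf m$-a.e. on $A$ for every $i$. The module is *locally finite dimensional* if there are pairwise disjoint measurable sets $E_0,E_1,E_2,\dots$ with $\mathbf m(M\setminus\bigcup_nE_n)=0$ such that, for every $n$ and every measurable $A\subset E_n$ with $\mathbf m(A)>0$, every set that is maximal among the sets that are independent on $A$ and consist of elements $v$ with $|v|=0$ a.e. outside $A$ has exactly $n$ elements. Its local dimension is *bounded by $N$* if $\mathbf m(E_n)=0$ for all $n>N$. A *measurable field of norms* on $\mathbb R^n$ is a family $(|\cdot|_x)_{x\in M}$ of norms on $\mathbb R^n$ such that $x\mapsto|a|_x$ is measurable for every $a\in\mathbb R^n$. For such a field, $L^p(E,\mathbb R^n,|\cdot|_x)$ is the space of a.e.-classes of measurable $a:E\to\mathbb R^n$ with $x\mapsto|a(x)|_x$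 in $L^p(\mathbf m|_E)$, normed by the $L^p$-norm of that function. The *$L^p$-product* of countably many such spaces is their $\ell^p$-sum. A Banach space is *super-reflexive* if every Banach space finitely representable in it is reflexive. **Theorem (Representation Theorem).** Let $\mathcal M$ be a locally finite dimensional $L^p(\mathbf m)$-normed module, with sets $E_n$ as above. 1. There are measurable fields of norms $|\cdot|_{n,x}$ on $\mathbb R^n$, $n\ge0$, and a surjective linear isometry $$T=(T_n)_n:\ \mathcal M\ \to\ \bigoplus_{n=0}^\infty L^p(E_n,\mathbb R^n,|\cdot|_{n,x})$$ onto the $L^p$-product which is $L^\infty(\mathbf m)$-linear and preserves the pointwise norm: $T_n(f\cdot v)=f\,T_nv$ and $|v|(x)=|T_nv(x)|_{n,x}$ for a.e. $x\in E_n$, for all $f\in L^\infty(\mathbf m)$, $v\in\mathcal M$ and $n\ge 0$. 2. With such $|\cdot|_{n,x}$ and $T$, suppose that the local dimension is bounded by $N$. Then $\mathcal M$ has a uniformly equivalent pointwise norm induced by scalar products. That is, there are measurable fields of norms $|\cdot|'_{n,x}$ on $\mathbb R^n$, each norm induced by a scalar product, with $|a|'_{n,x}\le|a|_{n,x}\le\sqrt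 n\,|a|'_{n,x}$ for all $n,x,a$ (the bounds of John's ellipsoid theorem), and there is a pointwise norm $|\cdot|'$ on $\mathcal M$, given by $|v|'(x)=|T_nv(x)|'_{n,x}$ for a.e. $x\in E_n$, for which $\mathcal M$ with the same $L^\infty(\mathbf m)$-action and the norm $\||v|'\|_{L^p(\mathbf m)}$ is again an $L^p(\mathbf m)$-normed module, and $$|v|'\le|v|\le\sqrt N\,|v|'\quad\mathbf m\text{-a.e. for all }v\in\mathcal M.$$ 3. If $p\in(1,\infty)$, then $\mathcal M$ is reflexive, and if moreover the local dimension is bounded by some $N$, then $\mathcal M$ is super-reflexive. -/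

import Mathlib

open MeasureTheory Filter
open scoped ENNReal

universe u w

noncomputable section

/-! ### The algebra of essentially bounded functions -/

section Linf

variable {X : Type u} [MeasurableSpace X] {m : Measure X}

/-- The characteristic function `χ_A` of a measurable set, as an element of `L^∞(m)`. -/
def linfIndicator (m : Measure X) (A : Set X) (hA : MeasurableSet A) : Lp ℝ ∞ m :=
  ((memLp_top_const (1 : ℝ)).indicator hA : MemLp (A.indicator fun _ => (1 : ℝ)) ∞ m).toLp _

/-- The pointwise product in `L^∞(m)`. -/
def linfMul (f g : Lp ℝ ∞ m) : Lp ℝ ∞ m :=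
  ((Lp.memLp g).mul (Lp.memLp f) : MemLp ((f : X → ℝ) * (g : X → ℝ)) ∞ m).toLp _

end Linf

/-! ### Normed modules -/

/-- The structure of an `L^p(m)`-normed module on a Banach space `𝓜`: a bilinear action of
`L^∞(m)` and a pointwise norm `|·| : 𝓜 → L^p(m)`, satisfying the premodule axioms, locality and
glueing. -/
structure LpNormedModule {X : Type u} [MeasurableSpace X] (p : ℝ≥0∞) [Fact (1 ≤ p)]
    (m : Measure X) (𝓜 : Type w) [NormedAddCommGroup 𝓜] [NormedSpace ℝ 𝓜] [CompleteSpace 𝓜] where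
  /-- the action of `L^∞(m)` -/
  smul : Lp ℝ ∞ m →ₗ[ℝ] 𝓜 →ₗ[ℝ] 𝓜
  /-- the pointwise norm -/
  pnorm : 𝓜 → Lp ℝ p m
  mul_smul : ∀ (f g : Lp ℝ ∞ m) (v : 𝓜), smul (linfMul f g) v = smul f (smul g v)
  one_smul : ∀ v : 𝓜, smul (linfIndicator m Set.univ MeasurableSet.univ) v = v
  pnorm_nonneg : ∀ v : 𝓜, ∀ᵐ x ∂m, 0 ≤ pnorm v x
  norm_eq : ∀ v : 𝓜, ‖v‖ = ‖pnorm v‖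
  pnorm_smul : ∀ (f : Lp ℝ ∞ m) (v : 𝓜), ∀ᵐ x ∂m, pnorm (smul f v) x = |f x| * pnorm v x
  locality : ∀ (v : 𝓜) (A : ℕ → Set X) (hA : ∀ n, MeasurableSet (A n)),
    (∀ n, smul (linfIndicator m (A n) (hA n)) v = 0) →
      smul (linfIndicator m (⋃ n, A n) (MeasurableSet.iUnion hA)) v = 0
  glueing : ∀ (v : ℕ → 𝓜) (A : ℕ → Set X) (hA : ∀ n, MeasurableSet (A n)),
    (∀ i j, smul (linfIndicator m (A i ∩ A j) ((hA i).inter (hA j))) (v i) =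
      smul (linfIndicator m (A i ∩ A j) ((hA i).inter (hA j))) (v j)) →
    limsup (fun n => ‖∑ i ∈ Finset.range n, smul (linfIndicator m (A i) (hA i)) (v i)‖ₑ) atTop
      < ∞ →
    ∃ z : 𝓜,
      (∀ i, smul (linfIndicator m (A i) (hA i)) z = smul (linfIndicator m (A i) (hA i)) (v i)) ∧
      ‖z‖ₑ ≤
        liminf (fun n => ‖∑ i ∈ Finset.range n, smul (linfIndicator m (A i) (hA i)) (v i)‖ₑ) atTop

namespace LpNormedModule

variable {X : Type u} [MeasurableSpace X] {p : ℝ≥0∞} [Fact (1 ≤ p)] {m : Measure X}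
  {𝓜 : Type w} [NormedAddCommGroup 𝓜] [NormedSpace ℝ 𝓜] [CompleteSpace 𝓜]

/-- `v` vanishes outside `A`, i.e. `m({v ≠ 0} \ A) = 0`. -/
def ConcentratedOn (S : LpNormedModule p m 𝓜) (v : 𝓜) (A : Set X) : Prop :=
  ∀ᵐ x ∂m, x ∉ A → S.pnorm v x = 0

/-- A set `V` of elements is (locally) independent on `A`: whenever a finite `L^∞`-linear
combination of elements of `V` vanishes almost everywhere on `A`, all its coefficients vanish
almost everywhere on `A`. -/
def IndependentOn (S : LpNormedModule p m 𝓜) (V : Set 𝓜) (A : Set X) : Prop :=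
  ∀ (t : Finset 𝓜) (f : 𝓜 → Lp ℝ ∞ m), (t : Set 𝓜) ⊆ V →
    (∀ᵐ x ∂m, x ∈ A → S.pnorm (∑ v ∈ t, S.smul (f v) v) x = 0) →
      ∀ v ∈ t, ∀ᵐ x ∂m, x ∈ A → f v x = 0

/-- `V` is a maximal independent set on `A` among the sets of elements concentrated on `A`. -/
def IsMaximalIndependentOn (S : LpNormedModule p m 𝓜) (V : Set 𝓜) (A : Set X) : Prop :=
  Maximal (fun W : Set 𝓜 => (∀ v ∈ W, S.ConcentratedOn v A) ∧ S.IndependentOn W A) V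

/-- The sets `E 0, E 1, …` together with the null set `E_∞ = (⋃ n, E n)ᶜ` witness that the module
is locally finite dimensional: they partition the space, and on every non-null measurable subset
`A` of `E n` each maximal independent set has exactly `n` elements. Thus the local dimension
is `n` on `E n`. -/
structure IsDimensionalDecomposition (S : LpNormedModule p m 𝓜) (E : ℕ → Set X) : Prop where
  measurableSet : ∀ n, MeasurableSet (E n)
  disjoint : Pairwise fun i j => Disjoint (E i) (E j)
  null_compl : m (⋃ n, E n)ᶜ = 0
  encard_eq : ∀ (n : ℕ) (A : Set X), MeasurableSet A → A ⊆ E n → m A ≠ 0 →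
    ∀ V : Set 𝓜, S.IsMaximalIndependentOn V A → V.encard = n

end LpNormedModule

/-! ### Vector-valued spaces -/

/-- A measurable field `x ↦ |·|_x` of norms on `ℝⁿ`. The Borel sets of the (separable, metrizable)
space of norms with the topology of locally uniform convergence are generated by the evaluations,
so measurability is measurability of `x ↦ |a|_x` for every vector `a`. -/
structure NormField (X : Type u) [MeasurableSpace X] (n : ℕ) where
  /-- the norm at a point -/
  normAt : X → Seminorm ℝ (Fin n → ℝ)
  eq_zero : ∀ x a, normAt x a = 0 → a = 0
  measurable : ∀ a, Measurable fun x => normAt x a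

/-- The norm `N` on `ℝⁿ` is induced by a scalar product: `N a = √⟨a, G a⟩` for a (symmetric)
positive definite matrix `G`. -/
def IsInducedByScalarProduct {n : ℕ} (N : Seminorm ℝ (Fin n → ℝ)) : Prop :=
  ∃ G : Matrix (Fin n) (Fin n) ℝ, G.PosDef ∧ ∀ a, N a = √(a ⬝ᵥ G.mulVec a)

theorem Seminorm.continuous_pi_fin {n : ℕ} (N : Seminorm ℝ (Fin n → ℝ)) : Continuous N := by
  have h : ConvexOn ℝ Set.univ N := N.convexOn
  exact continuousOn_univ.1 (h.continuousOn isOpen_univ)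

section VecLp

variable {X : Type u} [MeasurableSpace X] {n : ℕ}

theorem NormField.aestronglyMeasurable (F : NormField X n) {μ : Measure X}
    (a : X →ₘ[μ] (Fin n → ℝ)) : AEStronglyMeasurable (fun x => F.normAt x (a x)) μ := by
  have h : Measurable (Function.uncurry fun (b : Fin n → ℝ) (x : X) => F.normAt x b) :=
    measurable_uncurry_of_continuous_of_measurable (fun x => (F.normAt x).continuous_pi_fin)
      F.measurable
  have h2 : AEMeasurable (fun x => ((a x : Fin n → ℝ), x)) μ :=
    a.aestronglyMeasurable.aemeasurable.prodMk aemeasurable_id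
  exact (h.comp_aemeasurable h2).aestronglyMeasurable

/-- The elements of `L^p(X, μ, ℝⁿ, |·|)`: the classes of measurable `a : X → ℝⁿ` modulo equality
almost everywhere such that `x ↦ |a(x)|_x` is in `L^p(μ)`. -/
def vecLpSubmodule (p : ℝ≥0∞) (μ : Measure X) (F : NormField X n) :
    Submodule ℝ (X →ₘ[μ] (Fin n → ℝ)) where
  carrier := {a | MemLp (fun x => F.normAt x (a x)) p μ}
  add_mem' := by
    intro a b ha hb
    refine (ha.add hb).of_le (F.aestronglyMeasurable _) ?_
    filter_upwards [AEEqFun.coeFn_add a b] with x hx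
    rw [hx]
    simp only [Pi.add_apply]
    rw [Real.norm_of_nonneg (apply_nonneg _ _), Real.norm_of_nonneg (by positivity)]
    exact map_add_le_add _ _ _
  zero_mem' := by
    have h : (fun x => F.normAt x ((0 : X →ₘ[μ] (Fin n → ℝ)) x)) =ᵐ[μ] fun _ => (0 : ℝ) := by
      filter_upwards [AEEqFun.coeFn_zero (β := Fin n → ℝ) (μ := μ)] with x hx
      rw [hx]
      exact map_zero _
    exact (memLp_congr_ae h).2 MemLp.zero
  smul_mem' := by
    intro c a ha
    refine (ha.const_smul c).congr_norm (F.aestronglyMeasurable _) ?_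
    filter_upwards [AEEqFun.coeFn_smul c a] with x hx
    rw [hx]
    simp [map_smul_eq_mul, abs_of_nonneg (apply_nonneg (F.normAt x) _)]

/-- The vector-valued space `L^p(X, μ, ℝⁿ, |·|)`. -/
def VecLp (p : ℝ≥0∞) (μ : Measure X) (F : NormField X n) : Type u :=
  ↥(vecLpSubmodule p μ F)

namespace VecLp

variable {p : ℝ≥0∞} {μ : Measure X} {F : NormField X n}

instance : AddCommGroup (VecLp p μ F) := inferInstanceAs (AddCommGroup ↥(vecLpSubmodule p μ F))

instance : Module ℝ (VecLp p μ F) := inferInstanceAs (Module ℝ ↥(vecLpSubmodule p μ F))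

/-- The underlying class of functions. -/
def toAEEqFun : VecLp p μ F →ₗ[ℝ] (X →ₘ[μ] (Fin n → ℝ)) := (vecLpSubmodule p μ F).subtype

instance : CoeFun (VecLp p μ F) fun _ => X → (Fin n → ℝ) := ⟨fun a => toAEEqFun a⟩

/-- The pointwise norm `x ↦ |a(x)|_x`. -/
def pnorm (a : VecLp p μ F) : X → ℝ := fun x => F.normAt x (a x)

theorem pnorm_nonneg (a : VecLp p μ F) (x : X) : 0 ≤ a.pnorm x :=
  apply_nonneg (F.normAt x) _

theorem memLp_pnorm (a : VecLp p μ F) : MemLp a.pnorm p μ := a.2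

theorem pnorm_add_le (a b : VecLp p μ F) : ∀ᵐ x ∂μ, (a + b).pnorm x ≤ a.pnorm x + b.pnorm x := by
  have h : ⇑(toAEEqFun (a + b)) =ᵐ[μ] ⇑(toAEEqFun a) + ⇑(toAEEqFun b) := by
    rw [map_add]
    exact AEEqFun.coeFn_add _ _
  filter_upwards [h] with x hx
  simp only [pnorm]
  rw [hx]
  exact map_add_le_add _ _ _

theorem pnorm_smul (c : ℝ) (a : VecLp p μ F) : (c • a).pnorm =ᵐ[μ] |c| • a.pnorm := by
  have h : ⇑(toAEEqFun (c • a)) =ᵐ[μ] c • ⇑(toAEEqFun a) := by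
    rw [map_smul]
    exact AEEqFun.coeFn_smul _ _
  filter_upwards [h] with x hx
  simp only [pnorm, Pi.smul_apply]
  rw [hx]
  simp [map_smul_eq_mul]

theorem eLpNorm_pnorm_smul (c : ℝ) (a : VecLp p μ F) :
    (eLpNorm (c • a).pnorm p μ).toReal = |c| * (eLpNorm a.pnorm p μ).toReal := by
  rw [eLpNorm_congr_ae (pnorm_smul c a), eLpNorm_const_smul, ENNReal.toReal_mul]
  simp

theorem eLpNorm_pnorm_add_le [hp : Fact (1 ≤ p)] (a b : VecLp p μ F) :
    (eLpNorm (a + b).pnorm p μ).toReal ≤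
      (eLpNorm a.pnorm p μ).toReal + (eLpNorm b.pnorm p μ).toReal := by
  have ha := a.memLp_pnorm
  have hb := b.memLp_pnorm
  rw [← ENNReal.toReal_add ha.eLpNorm_ne_top hb.eLpNorm_ne_top]
  refine ENNReal.toReal_mono (ENNReal.add_ne_top.2 ⟨ha.eLpNorm_ne_top, hb.eLpNorm_ne_top⟩) ?_
  have h : eLpNorm (a + b).pnorm p μ ≤ eLpNorm (a.pnorm + b.pnorm) p μ := by
    refine eLpNorm_mono_ae ?_
    filter_upwards [pnorm_add_le a b] with x hx
    have h0 : 0 ≤ (a + b).pnorm x := pnorm_nonneg _ x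
    rw [Real.norm_of_nonneg h0]
    exact hx.trans (le_abs_self (a.pnorm x + b.pnorm x))
  exact h.trans (eLpNorm_add_le ha.1 hb.1 hp.out)

theorem eq_zero_of_eLpNorm_pnorm [hp : Fact (1 ≤ p)] (a : VecLp p μ F)
    (ha : (eLpNorm a.pnorm p μ).toReal = 0) : a = 0 := by
  have h1 : eLpNorm a.pnorm p μ = 0 :=
    ((ENNReal.toReal_eq_zero_iff _).1 ha).resolve_right a.memLp_pnorm.eLpNorm_ne_top
  have hp0 : p ≠ 0 := (zero_lt_one.trans_le hp.out).ne'
  have h2 := (eLpNorm_eq_zero_iff a.memLp_pnorm.1 hp0).1 h1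
  have h3 : toAEEqFun a = 0 := by
    apply AEEqFun.ext
    filter_upwards [h2, AEEqFun.coeFn_zero (β := Fin n → ℝ) (μ := μ)] with x hx hz
    exact (F.eq_zero x _ hx).trans hz.symm
  exact Subtype.ext h3

/-- The norm of `L^p(X, μ, ℝⁿ, |·|)` is the `L^p`-norm of the pointwise norm. -/
instance [Fact (1 ≤ p)] : NormedAddCommGroup (VecLp p μ F) :=
  AddGroupNorm.toNormedAddCommGroup
    { toFun := fun a => (eLpNorm a.pnorm p μ).toReal
      map_zero' := by
        have h := eLpNorm_pnorm_smul 0 (0 : VecLp p μ F)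
        rwa [smul_zero, abs_zero, zero_mul] at h
      add_le' := eLpNorm_pnorm_add_le
      neg' := fun a => by
        have h := eLpNorm_pnorm_smul (-1) a
        rwa [neg_one_smul, abs_neg, abs_one, one_mul] at h
      eq_zero_of_map_eq_zero' := eq_zero_of_eLpNorm_pnorm }

theorem norm_def [Fact (1 ≤ p)] (a : VecLp p μ F) : ‖a‖ = (eLpNorm a.pnorm p μ).toReal := rfl

instance [Fact (1 ≤ p)] : NormedSpace ℝ (VecLp p μ F) where
  norm_smul_le c a := by
    rw [norm_def, norm_def, eLpNorm_pnorm_smul, Real.norm_eq_abs]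

end VecLp

end VecLp

/-- The (countable) `L^p`-product of the vector-valued spaces `L^p(E n, ℝⁿ, |·|)`. As the factors
carry `L^p`-norms, `∫ ∑ |vₙ|^p = ∑ ‖vₙ‖^p` (and the essential supremum of `sup |vₙ|` is
`sup ‖vₙ‖` if `p = ∞`), so that this is the `ℓ^p`-sum of the factors. -/
abbrev VecLpProduct {X : Type u} [MeasurableSpace X] (p : ℝ≥0∞) [Fact (1 ≤ p)] (m : Measure X)
    (E : ℕ → Set X) (F : ∀ n, NormField X n) : Type u :=
  ↥(lp (fun n : ℕ => VecLp p (m.restrict (E n)) (F n)) p)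

/-! ### Reflexivity and super-reflexivity -/

/-- A Banach space is reflexive if the canonical map into its bidual is onto. -/
def IsReflexiveSpace (V : Type w) [NormedAddCommGroup V] [NormedSpace ℝ V] : Prop :=
  Function.Surjective (NormedSpace.inclusionInDoubleDual ℝ V)

/-- `Y` is finitely representable in `V`: each finite dimensional subspace of `Y` is, for every
`ε > 0`, `(1 + ε)`-isomorphic to a subspace of `V`. -/
def IsFinitelyRepresentable (Y V : Type w) [NormedAddCommGroup Y] [NormedSpace ℝ Y]
    [NormedAddCommGroup V] [NormedSpace ℝ V] : Prop :=
  ∀ (U : Submodule ℝ Y), FiniteDimensional ℝ U → ∀ ε : ℝ, 0 < ε →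
    ∃ L : U →ₗ[ℝ] V, ∀ y : U, ‖y‖ ≤ ‖L y‖ ∧ ‖L y‖ ≤ (1 + ε) * ‖y‖

/-- A Banach space `V` is super-reflexive if every Banach space that is finitely representable
in `V` is reflexive. -/
def IsSuperReflexive (V : Type w) [NormedAddCommGroup V] [NormedSpace ℝ V] : Prop :=
  ∀ (Y : Type w) [NormedAddCommGroup Y] [NormedSpace ℝ Y] [CompleteSpace Y],
    IsFinitelyRepresentable Y V → IsReflexiveSpace Y

end

/-!
# The representation theorem for locally finite dimensional normed modules

*Representation.* The pointwise norm satisfies the triangle inequality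
(`LpNormedModule.pnorm_add_le`), so finitely many elements `v₁, …, vₙ` define a measurable field of
seminorms on `ℝⁿ`, namely `|∑ aᵢ vᵢ|(x)` (`LpNormedModule.exists_seminormField`). On a set where
the `vᵢ` are independent these are norms almost everywhere: where a seminorm degenerates, its
minimum on the unit sphere is attained by a measurable unit vector field
(`exists_measurable_argmin`), which is a nontrivial relation. Where the dimension is `n`, a further
element `z` cannot be independent of `v₁, …, vₙ` on any non-null set, and the same selection gives
a relation whose coefficient of `z` does not vanish. Hence `z` has coordinates in `ℝⁿ`
(`LpNormedModule.IsCoordinate`). The coordinates are additive and compatible with the action of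
`L^∞`, and turn the pointwise norm into the field of norms. Every field of vectors of finite norm
arises in this way: it is bounded on countably many disjoint pieces, and these are glued. This is
`LpNormedModule.IsDimensionalDecomposition.exists_representation`.

*Scalar products.* The ellipsoid of minimal volume containing the unit ball of a norm on `ℝⁿ` is
found by maximizing a continuous function of a matrix over a compact set. So it can be chosen
measurably in `x` (`NormField.exists_john`), and its extremality gives John's constant `√n`. Exchanging the
fields of norms in the representation gives the equivalent pointwise norm
(`LpNormedModule.IsCoordinateSystem.exists_isPointwiseSeminorm`); its glueing axiom follows from
that of the module and Fatou's lemma (`LpNormedModule.IsPointwiseSeminorm.glueing`).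

*Reflexivity.* For `1 < r < ∞` the Euclidean norm satisfies
`|a - b|^r ≤ ε (|a|^r + |b|^r) + K_ε ((|a|^r + |b|^r)/2 - |(a + b)/2|^r)`. For `r = p` and bounded
dimension this can be integrated, so that the norm `‖|v|'‖_p` satisfies the same inequality
(`HasUniformlyConvexRenorming`). It passes to ultralimits, hence to finitely representable spaces,
and implies reflexivity by the argument of Milman and Pettis. This shows super-reflexivity if the
dimension is bounded. In general, the truncations to the sets where the dimension is less than `k`
are reflexive, the dual truncations converge strongly since `p > 1`
(`tendsto_comp_projection`), and vectors representing a functional on the truncations can be glued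
(`isReflexiveSpace_of_projections`).
-/


open scoped Topology

/-! ### Measurable selection of minimizers -/

section Selection

variable {X : Type*} [MeasurableSpace X]

/-- The minimum over a compact space of a Carathéodory function is measurable, being an infimum
over a countable dense set. -/
theorem measurable_iInf_of_continuous {K : Type*} [TopologicalSpace K] [CompactSpace K]
    [TopologicalSpace.SeparableSpace K] [Nonempty K] {h : X → K → ℝ} (hc : ∀ x, Continuous (h x))
    (hm : ∀ k, Measurable fun x => h x k) : Measurable fun x => ⨅ k, h x k := by
  have hbdd : ∀ x, BddBelow (Set.range (h x)) := fun x => (isCompact_range (hc x)).bddBelow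
  have key : ∀ x, ⨅ k, h x k = ⨅ n, h x (TopologicalSpace.denseSeq K n) := by
    intro x
    have hb : BddBelow (Set.range fun n => h x (TopologicalSpace.denseSeq K n)) :=
      (hbdd x).mono (by rintro _ ⟨n, rfl⟩; exact ⟨_, rfl⟩)
    refine le_antisymm (le_ciInf fun n => ciInf_le (hbdd x) _) (le_ciInf fun k => ?_)
    have hcl : IsClosed {k | ⨅ n, h x (TopologicalSpace.denseSeq K n) ≤ h x k} :=
      isClosed_le continuous_const (hc x)
    have : Set.range (TopologicalSpace.denseSeq K) ⊆
        {k | ⨅ n, h x (TopologicalSpace.denseSeq K n) ≤ h x k} := by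
      rintro _ ⟨n, rfl⟩
      exact ciInf_le hb n
    exact hcl.closure_subset_iff.2 this (TopologicalSpace.denseRange_denseSeq K k)
  simp_rw [key]
  exact Measurable.iInf fun n => hm _

theorem exists_iInf_eq_of_continuous {K : Type*} [TopologicalSpace K] [CompactSpace K]
    [Nonempty K] {h : K → ℝ} (hc : Continuous h) : ∃ k, h k = ⨅ k, h k := by
  obtain ⟨k, -, hk⟩ := isCompact_univ.exists_isMinOn Set.univ_nonempty hc.continuousOn
  exact ⟨k, le_antisymm (le_ciInf fun j => hk (Set.mem_univ j))
    (ciInf_le (isCompact_range hc).bddBelow k)⟩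

theorem exists_measurable_argmin_real {C : Set ℝ} (hC : IsCompact C) (hne : C.Nonempty)
    {h : X → C → ℝ} (hc : ∀ x, Continuous (h x)) (hm : ∀ k, Measurable fun x => h x k) :
    ∃ s : X → C, Measurable s ∧ ∀ x k, h x (s x) ≤ h x k := by
  have : CompactSpace C := isCompact_iff_compactSpace.1 hC
  have : Nonempty C := hne.to_subtype
  -- the smallest minimizer
  let Z : X → Set ℝ := fun x => {c | ∃ hcC : c ∈ C, h x ⟨c, hcC⟩ = ⨅ k, h x k}
  have hZne : ∀ x, (Z x).Nonempty := fun x => by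
    obtain ⟨k, hk⟩ := exists_iInf_eq_of_continuous (hc x)
    exact ⟨k, k.2, hk⟩
  have hZcl : ∀ x, IsClosed (Z x) := fun x => by
    have h1 : IsClosed {k : C | h x k = ⨅ k, h x k} := isClosed_eq (hc x) continuous_const
    have h2 := hC.isClosed.isClosedMap_subtype_val _ h1
    convert h2 using 1
    ext c
    simp [Z]
  have hZb : ∀ x, BddBelow (Z x) := fun x =>
    hC.bddBelow.mono fun c hc => hc.1
  have hmem : ∀ x, sInf (Z x) ∈ Z x := fun x => (hZcl x).csInf_mem (hZne x) (hZb x)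
  refine ⟨fun x => ⟨sInf (Z x), (hmem x).1⟩, ?_, fun x k => ?_⟩
  · refine Measurable.subtype_mk (measurable_of_Iic fun c => ?_)
    by_cases hcne : (C ∩ Set.Iic c).Nonempty
    · -- `sInf (Z x) ≤ c` means that the minimum is attained on `C ∩ (-∞, c]`
      have hD : IsCompact (C ∩ Set.Iic c) := hC.inter_right isClosed_Iic
      have : CompactSpace ↥(C ∩ Set.Iic c) := isCompact_iff_compactSpace.1 hD
      have : Nonempty ↥(C ∩ Set.Iic c) := hcne.to_subtype
      let ι : ↥(C ∩ Set.Iic c) → C := fun k => ⟨k.1, k.2.1⟩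
      have hι : Continuous ι := by fun_prop
      have hset : (fun x => sInf (Z x)) ⁻¹' Set.Iic c =
          {x | ⨅ k, h x (ι k) = ⨅ k, h x k} := by
        ext x
        simp only [Set.mem_preimage, Set.mem_Iic, Set.mem_ofPred_eq]
        constructor
        · intro hx
          refine le_antisymm ?_ (le_ciInf fun k => ciInf_le (isCompact_range (hc x)).bddBelow _)
          obtain ⟨h1, h2⟩ := hmem x
          rw [← h2]
          exact ciInf_le (isCompact_range ((hc x).comp hι)).bddBelow
            (⟨sInf (Z x), h1, hx⟩ : ↥(C ∩ Set.Iic c))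
        · intro hx
          obtain ⟨k, hk⟩ := exists_iInf_eq_of_continuous ((hc x).comp hι)
          exact (csInf_le (hZb x) ⟨k.2.1, hk.trans hx⟩).trans k.2.2
      rw [hset]
      exact measurableSet_eq_fun
        (measurable_iInf_of_continuous (fun x => (hc x).comp hι) fun k => hm _)
        (measurable_iInf_of_continuous hc hm)
    · have hset : (fun x => sInf (Z x)) ⁻¹' Set.Iic c = ∅ := by
        ext x
        simp only [Set.mem_preimage, Set.mem_Iic, Set.mem_empty_iff_false, iff_false]
        exact fun hx => hcne ⟨sInf (Z x), (hmem x).1, hx⟩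
      rw [hset]
      exact MeasurableSet.empty
  · rw [(hmem x).2]
    exact ciInf_le (isCompact_range (hc x)).bddBelow k

/-- **Measurable selection of minimizers**: a Carathéodory function on a compact metric space has
a measurable choice of minimizers. The Cantor set maps onto the compact space, and among the
parameters of minimizers in the Cantor set the smallest one is measurable. -/
theorem exists_measurable_argmin {K : Type*} [MetricSpace K] [CompactSpace K] [Nonempty K]
    [MeasurableSpace K] [BorelSpace K] {h : X → K → ℝ} (hc : ∀ x, Continuous (h x))
    (hm : ∀ k, Measurable fun x => h x k) :
    ∃ s : X → K, Measurable s ∧ ∀ x k, h x (s x) ≤ h x k := by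
  obtain ⟨f, hf, hsurj⟩ := exists_nat_bool_continuous_surjective_of_compact K
  have hψ : Continuous (f ∘ cantorSetHomeomorphNatToBool) :=
    hf.comp cantorSetHomeomorphNatToBool.continuous
  obtain ⟨s, hs, hmin⟩ := exists_measurable_argmin_real (X := X) isCompact_cantorSet
    ⟨0, zero_mem_cantorSet⟩ (h := fun x c => h x (f (cantorSetHomeomorphNatToBool c)))
    (fun x => (hc x).comp hψ) (fun k => hm _)
  refine ⟨_, hψ.measurable.comp hs, fun x k => ?_⟩
  obtain ⟨b, rfl⟩ := hsurj k
  simpa using hmin x (cantorSetHomeomorphNatToBool.symm b)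

end Selection

/-! ### John's ellipsoid theorem for measurable fields of norms -/

section John

/-- The seminorm `a ↦ |A a|₂` on `ℝⁿ`, for a square matrix `A` and the Euclidean norm `|·|₂`. -/
noncomputable def ellipsoidNorm {n : ℕ} (A : Matrix (Fin n) (Fin n) ℝ) :
    Seminorm ℝ (Fin n → ℝ) :=
  (normSeminorm ℝ (EuclideanSpace ℝ (Fin n))).comp
    ((WithLp.linearEquiv 2 ℝ (Fin n → ℝ)).symm.toLinearMap ∘ₗ A.mulVecLin)

variable {n : ℕ}

theorem ellipsoidNorm_eq_norm (A : Matrix (Fin n) (Fin n) ℝ) (a : Fin n → ℝ) :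
    ellipsoidNorm A a = ‖(WithLp.toLp 2 (A.mulVec a) : EuclideanSpace ℝ (Fin n))‖ := rfl

theorem ellipsoidNorm_apply (A : Matrix (Fin n) (Fin n) ℝ) (a : Fin n → ℝ) :
    ellipsoidNorm A a = √(A.mulVec a ⬝ᵥ A.mulVec a) := by
  rw [ellipsoidNorm_eq_norm, EuclideanSpace.norm_eq]
  simp [dotProduct, ← sq]

theorem ellipsoidNorm_sq (A : Matrix (Fin n) (Fin n) ℝ) (a : Fin n → ℝ) :
    ellipsoidNorm A a ^ 2 = A.mulVec a ⬝ᵥ A.mulVec a := by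
  rw [ellipsoidNorm_apply, Real.sq_sqrt]
  exact Finset.sum_nonneg fun i _ => mul_self_nonneg _

theorem ellipsoidNorm_smul (c : ℝ) (A : Matrix (Fin n) (Fin n) ℝ) (a : Fin n → ℝ) :
    ellipsoidNorm (c • A) a = |c| * ellipsoidNorm A a := by
  rw [ellipsoidNorm_eq_norm, ellipsoidNorm_eq_norm, Matrix.smul_mulVec, WithLp.toLp_smul,
    norm_smul, Real.norm_eq_abs]

theorem isInducedByScalarProduct_ellipsoidNorm {A : Matrix (Fin n) (Fin n) ℝ} (hA : A.det ≠ 0) :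
    IsInducedByScalarProduct (ellipsoidNorm A) := by
  refine ⟨A.transpose * A, ?_, fun a => ?_⟩
  · have h := Matrix.PosDef.conjTranspose_mul_self A
      (Matrix.mulVec_injective_iff_isUnit.2 ((Matrix.isUnit_iff_isUnit_det A).2 hA.isUnit))
    rwa [Matrix.conjTranspose_eq_transpose_of_trivial] at h
  · rw [ellipsoidNorm_apply, ← Matrix.mulVec_mulVec, Matrix.dotProduct_mulVec a,
      Matrix.vecMul_transpose]

theorem Seminorm.exists_linear_eq_and_abs_le (N : Seminorm ℝ (Fin n → ℝ)) {a : Fin n → ℝ}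
    (ha : a ≠ 0) : ∃ g : (Fin n → ℝ) →ₗ[ℝ] ℝ, g a = N a ∧ ∀ b, |g b| ≤ N b := by
  obtain ⟨g, hg1, hg2⟩ := exists_extension_of_le_sublinear
    (LinearPMap.mkSpanSingleton a (N a) ha) N
    (fun c hc x => by rw [map_smul_eq_mul, Real.norm_of_nonneg hc.le]) (fun x y => map_add_le_add N x y)
    (by
      rintro ⟨x, hx⟩
      obtain ⟨c, rfl⟩ := Submodule.mem_span_singleton.1 hx
      rw [LinearPMap.mkSpanSingleton'_apply]
      change c • N a ≤ N (c • a)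
      rw [map_smul_eq_mul, smul_eq_mul]
      exact mul_le_mul_of_nonneg_right (le_abs_self c) (apply_nonneg N a))
  refine ⟨g, ?_, fun b => abs_le.2 ⟨?_, hg2 b⟩⟩
  · have h := hg1 ⟨a, Submodule.mem_span_singleton_self a⟩
    rw [LinearPMap.mkSpanSingleton_apply] at h
    exact h
  · have h := hg2 (-b)
    rw [map_neg, map_neg_eq_map] at h
    linarith

theorem exists_pos_one_add_pow_lt (n : ℕ) {c : ℝ} (hc : (n : ℝ) < c) :
    ∃ s : ℝ, 0 < s ∧ (1 + s) ^ n < 1 + s * c := by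
  have hn : (0 : ℝ) ≤ n := n.cast_nonneg
  have hc0 : 0 < c := hn.trans_lt hc
  set s := (c - n) / (2 * (n + 1) * c) with hs
  have hs0 : 0 < s := div_pos (by linarith) (by positivity)
  have hsc : s * (2 * (n + 1) * c) = c - n := div_mul_cancel₀ _ (by positivity)
  have hns : (n : ℝ) * s ≤ 1 / 2 := by
    have h1 : 2 * (n * s) * c ≤ 1 * c := by nlinarith [mul_pos hs0 hc0]
    have := le_of_mul_le_mul_right h1 hc0
    linarith
  have hs1 : s ≤ 1 := by
    have h1 : s * c ≤ 1 * c := by nlinarith [mul_nonneg hn (mul_pos hs0 hc0).le]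
    exact le_of_mul_le_mul_right h1 hc0
  refine ⟨s, hs0, ?_⟩
  -- Bernoulli's inequality for `1 - s`
  have hb : 1 - (n : ℝ) * s ≤ (1 - s) ^ n := by
    have := one_add_mul_le_pow (a := -s) (by linarith) n
    simpa [sub_eq_add_neg] using this
  have h1 : (1 + s) ^ n * (1 - n * s) ≤ 1 := by
    calc (1 + s) ^ n * (1 - n * s) ≤ (1 + s) ^ n * (1 - s) ^ n := by gcongr
      _ = (1 - s ^ 2) ^ n := by rw [← mul_pow]; ring
      _ ≤ 1 := pow_le_one₀ (by nlinarith) (by nlinarith)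
  have h2 : 1 < (1 + s * c) * (1 - n * s) := by
    have h3 : 0 < c - n - n * c * s := by
      have : n * c * s * 2 ≤ c - n := by nlinarith [mul_pos hs0 hc0]
      nlinarith
    nlinarith [mul_pos hs0 h3]
  exact lt_of_mul_lt_mul_right (h1.trans_lt h2) (by linarith)

/-- If `{a | |A a|₂ ≤ 1}` is an ellipsoid of minimal volume (maximal determinant) among those
containing the unit ball of `N`, then `N ≤ √n |A ·|₂`. Otherwise a functional `g ≤ N` is too large
at some point, `g b = u ⬝ A b` with `|u|² > n`, and for small `s` the quadratic form
`(1 + s)⁻¹ (|A b|² + s (g b)²)` gives a smaller ellipsoid. -/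
theorem seminorm_le_sqrt_mul_ellipsoidNorm (N : Seminorm ℝ (Fin n → ℝ))
    {A : Matrix (Fin n) (Fin n) ℝ} (hA : ∀ a, ellipsoidNorm A a ≤ N a) (hdet : A.det ≠ 0)
    (hext : ∀ B : Matrix (Fin n) (Fin n) ℝ, (∀ a, ellipsoidNorm B a ≤ N a) → |B.det| ≤ |A.det|)
    (a : Fin n → ℝ) : N a ≤ √(n : ℝ) * ellipsoidNorm A a := by
  by_contra! hlt
  have ha : a ≠ 0 := by
    rintro rfl
    simp at hlt
  obtain ⟨g, hga, hgN⟩ := N.exists_linear_eq_and_abs_le ha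
  have hu' : IsUnit A.det := hdet.isUnit
  obtain ⟨u, hu⟩ : ∃ u : Fin n → ℝ, ∀ b, g b = u ⬝ᵥ A.mulVec b := by
    refine ⟨fun i => g (A⁻¹.mulVec (Pi.single i 1)), fun b => ?_⟩
    have h := LinearMap.pi_apply_eq_sum_univ (g ∘ₗ A⁻¹.mulVecLin) (A.mulVec b)
    have h1 : (g ∘ₗ A⁻¹.mulVecLin) (A.mulVec b) = g b := by
      simp [Matrix.mulVec_mulVec, Matrix.nonsing_inv_mul A hu']
    rw [← h1, h]
    simp only [dotProduct, smul_eq_mul]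
    refine Finset.sum_congr rfl fun i _ => ?_
    rw [mul_comm]
    congr 1
    simp only [LinearMap.comp_apply, Matrix.mulVecLin_apply]
    congr 2
    ext j
    simp [Pi.single_apply, eq_comm]
  set c := u ⬝ᵥ u with hc
  have hnc : (n : ℝ) < c := by
    by_contra! hcn
    have h1 : N a ^ 2 ≤ c * ellipsoidNorm A a ^ 2 := by
      rw [← hga, hu, ellipsoidNorm_sq, hc]
      have := Finset.sum_mul_sq_le_sq_mul_sq Finset.univ u (A.mulVec a)
      simpa only [dotProduct, ← sq] using this
    have h2 : N a ^ 2 ≤ (√(n : ℝ) * ellipsoidNorm A a) ^ 2 := by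
      rw [mul_pow, Real.sq_sqrt n.cast_nonneg]
      exact h1.trans (mul_le_mul_of_nonneg_right hcn (sq_nonneg _))
    exact absurd (abs_le_of_sq_le_sq' h2 (mul_nonneg (Real.sqrt_nonneg _) (apply_nonneg _ _))).2
      (not_le.2 hlt)
  have hc0 : 0 < c := n.cast_nonneg.trans_lt hnc
  obtain ⟨s, hs0, hs⟩ := exists_pos_one_add_pow_lt n hnc
  -- `C = (1 + s)^(-1/2) (1 + β u uᵀ)` is a square root of `(1 + s)⁻¹ (1 + s u uᵀ)`
  set β := (√(1 + s * c) - 1) / c with hβ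
  have hβ1 : 1 + β * c = √(1 + s * c) := by rw [hβ, div_mul_cancel₀ _ hc0.ne']; ring
  have hβ2 : (1 + β * c) ^ 2 = 1 + s * c := by rw [hβ1, Real.sq_sqrt (by positivity)]
  have hβ3 : 2 * β + β ^ 2 * c = s := by
    have : c * (2 * β + β ^ 2 * c) = c * s := by nlinarith
    exact mul_left_cancel₀ hc0.ne' this
  set α := (√(1 + s))⁻¹ with hα
  have hα2 : α ^ 2 * (1 + s) = 1 := by
    rw [hα, inv_pow, Real.sq_sqrt (by linarith)]
    exact inv_mul_cancel₀ (by linarith)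
  set C : Matrix (Fin n) (Fin n) ℝ :=
    α • (1 + Matrix.replicateCol Unit (β • u) * Matrix.replicateRow Unit u) with hC
  have hCdet : C.det = α ^ n * (1 + β * c) := by
    rw [hC, Matrix.det_smul, Matrix.det_one_add_replicateCol_mul_replicateRow, Fintype.card_fin,
      dotProduct_smul, smul_eq_mul]
  have hCmul : ∀ y, C.mulVec y = α • (y + (β * (u ⬝ᵥ y)) • u) := by
    intro y
    rw [hC, Matrix.smul_mulVec, Matrix.add_mulVec, Matrix.one_mulVec]
    congr 2
    ext i
    simp only [Matrix.mulVec, dotProduct, Matrix.mul_apply, Matrix.replicateCol_apply,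
      Matrix.replicateRow_apply, Finset.univ_unique, Finset.sum_singleton, Pi.smul_apply,
      smul_eq_mul, Finset.mul_sum, Finset.sum_mul]
    exact Finset.sum_congr rfl fun j _ => by ring
  have hB : ∀ b, ellipsoidNorm (C * A) b ≤ N b := by
    intro b
    refine (abs_le_of_sq_le_sq' ?_ (apply_nonneg N b)).2
    have h1 : ellipsoidNorm (C * A) b ^ 2
        = α ^ 2 * (ellipsoidNorm A b ^ 2 + s * g b ^ 2) := by
      rw [ellipsoidNorm_sq, ellipsoidNorm_sq, ← Matrix.mulVec_mulVec, hCmul, hu]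
      set y := A.mulVec b
      simp only [smul_dotProduct, dotProduct_smul, add_dotProduct, dotProduct_add, smul_eq_mul]
      rw [dotProduct_comm y u, ← hc, ← hβ3]
      ring
    have h2 : ellipsoidNorm A b ^ 2 ≤ N b ^ 2 := by
      have := hA b
      gcongr
    have h3 : g b ^ 2 ≤ N b ^ 2 := sq_le_sq' (abs_le.1 (hgN b)).1 (abs_le.1 (hgN b)).2
    calc ellipsoidNorm (C * A) b ^ 2 = α ^ 2 * (ellipsoidNorm A b ^ 2 + s * g b ^ 2) := h1
      _ ≤ α ^ 2 * (N b ^ 2 + s * N b ^ 2) := by gcongr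
      _ = (α ^ 2 * (1 + s)) * N b ^ 2 := by ring
      _ = N b ^ 2 := by rw [hα2, one_mul]
  have h4 := hext _ hB
  rw [Matrix.det_mul, abs_mul] at h4
  have h5 : |C.det| ≤ 1 := by
    by_contra! h
    exact absurd h4 (not_le.2 (lt_mul_of_one_lt_left (abs_pos.2 hdet) h))
  have h6 : C.det ^ 2 ≤ 1 := by
    rw [← sq_abs]
    exact pow_le_one₀ (abs_nonneg _) h5
  have h7 : C.det ^ 2 * (1 + s) ^ n = 1 + s * c := by
    rw [hCdet, mul_pow, hβ2, ← pow_mul, mul_comm n 2, pow_mul]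
    calc (α ^ 2) ^ n * (1 + s * c) * (1 + s) ^ n
        = (α ^ 2 * (1 + s)) ^ n * (1 + s * c) := by rw [mul_pow]; ring
      _ = 1 + s * c := by rw [hα2, one_pow, one_mul]
  have h8 : C.det ^ 2 * (1 + s) ^ n ≤ 1 * (1 + s) ^ n := by gcongr
  linarith

end John

section JohnField

variable {n : ℕ}

theorem continuous_ellipsoidNorm_uncurry :
    Continuous fun z : (Fin n → Fin n → ℝ) × (Fin n → ℝ) =>
      ellipsoidNorm (Matrix.of z.1) z.2 := by
  simp_rw [ellipsoidNorm_apply]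
  simp only [Matrix.mulVec, dotProduct, Matrix.of_apply]
  fun_prop

/-- The largest ratio `|A a|₂ / N a` over the unit vectors `a` of the supremum norm. -/
noncomputable def ellipsoidRatio (N : Seminorm ℝ (Fin n → ℝ)) (A : Fin n → Fin n → ℝ) : ℝ :=
  sSup ((fun a : Metric.sphere (0 : Fin n → ℝ) 1 => ellipsoidNorm (Matrix.of A) a.1 / N a.1) ''
    Set.univ)

section Ratio

variable {N : Seminorm ℝ (Fin n → ℝ)} (hN : ∀ a, N a = 0 → a = 0)

include hN

theorem Seminorm.pos_of_mem_sphere (a : Metric.sphere (0 : Fin n → ℝ) 1) : 0 < N a.1 := by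
  refine (apply_nonneg N a.1).lt_of_ne' fun h => ?_
  have h1 := a.2
  rw [hN _ h] at h1
  simp at h1

theorem continuous_ellipsoidNorm_div :
    Continuous fun z : (Fin n → Fin n → ℝ) × Metric.sphere (0 : Fin n → ℝ) 1 =>
      ellipsoidNorm (Matrix.of z.1) z.2.1 / N z.2.1 := by
  refine Continuous.div ?_ (N.continuous_pi_fin.comp (by fun_prop))
    fun z => (N.pos_of_mem_sphere hN z.2).ne'
  exact continuous_ellipsoidNorm_uncurry.comp
    (f := fun z : (Fin n → Fin n → ℝ) × Metric.sphere (0 : Fin n → ℝ) 1 => (z.1, z.2.1))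
    (by fun_prop)

theorem continuous_ellipsoidRatio : Continuous (ellipsoidRatio N) :=
  isCompact_univ.continuous_sSup (f := fun (A : Fin n → Fin n → ℝ)
    (a : Metric.sphere (0 : Fin n → ℝ) 1) => ellipsoidNorm (Matrix.of A) a.1 / N a.1)
    (continuous_ellipsoidNorm_div hN)

theorem ellipsoidNorm_div_le_ellipsoidRatio (A : Fin n → Fin n → ℝ)
    (a : Metric.sphere (0 : Fin n → ℝ) 1) :
    ellipsoidNorm (Matrix.of A) a.1 / N a.1 ≤ ellipsoidRatio N A := by
  refine le_csSup ?_ ⟨a, Set.mem_univ _, rfl⟩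
  exact isCompact_univ.bddAbove_image
    ((continuous_ellipsoidNorm_div hN).comp (Continuous.prodMk_right A)).continuousOn

theorem ellipsoidNorm_le_ellipsoidRatio_mul (A : Fin n → Fin n → ℝ) (a : Fin n → ℝ) :
    ellipsoidNorm (Matrix.of A) a ≤ ellipsoidRatio N A * N a := by
  by_cases ha : a = 0
  · simp [ha]
  have ha' : ‖a‖ ≠ 0 := norm_ne_zero_iff.2 ha
  have hs : ‖a‖⁻¹ • a ∈ Metric.sphere (0 : Fin n → ℝ) 1 := by
    simp [norm_smul, inv_mul_cancel₀ ha']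
  have h := ellipsoidNorm_div_le_ellipsoidRatio hN A ⟨_, hs⟩
  rw [div_le_iff₀ (N.pos_of_mem_sphere hN ⟨_, hs⟩)] at h
  simp only [map_smul_eq_mul] at h
  have hp : 0 < ‖‖a‖⁻¹‖ := norm_pos_iff.2 (inv_ne_zero ha')
  refine le_of_mul_le_mul_left ?_ hp
  linarith

omit hN in
theorem ellipsoidRatio_le [Nonempty (Metric.sphere (0 : Fin n → ℝ) 1)]
    (hN : ∀ a, N a = 0 → a = 0) {A : Fin n → Fin n → ℝ} {c : ℝ}
    (h : ∀ a, ellipsoidNorm (Matrix.of A) a ≤ c * N a) : ellipsoidRatio N A ≤ c := by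
  refine csSup_le (Set.univ_nonempty.image _) ?_
  rintro _ ⟨a, -, rfl⟩
  exact (div_le_iff₀ (N.pos_of_mem_sphere hN a)).2 (h _)

theorem ellipsoidRatio_pos [Nonempty (Metric.sphere (0 : Fin n → ℝ) 1)] {A : Fin n → Fin n → ℝ}
    (hA : A ≠ 0) : 0 < ellipsoidRatio N A := by
  have h0 : 0 ≤ ellipsoidRatio N A :=
    (div_nonneg (apply_nonneg _ _) (apply_nonneg _ _)).trans
      (ellipsoidNorm_div_le_ellipsoidRatio hN A (Classical.arbitrary _))
  refine h0.lt_of_ne' fun h => hA ?_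
  have h1 : ∀ a, (Matrix.of A).mulVec a = 0 := fun a => by
    have h2 := ellipsoidNorm_le_ellipsoidRatio_mul hN A a
    rw [h, zero_mul] at h2
    have h3 : ellipsoidNorm (Matrix.of A) a = 0 := le_antisymm h2 (apply_nonneg _ _)
    rw [ellipsoidNorm_eq_norm, norm_eq_zero] at h3
    exact (WithLp.toLp_eq_zero 2).1 h3
  ext i j
  simpa using congrFun (h1 (Pi.single j 1)) i

/-- A matrix maximizing the scale-invariant quantity `|det A| / ratio(A) ^ n` satisfies, after
normalization, the bounds of John's theorem. -/
theorem john_bounds_of_maximizer [Nonempty (Metric.sphere (0 : Fin n → ℝ) 1)]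
    {A : Fin n → Fin n → ℝ}
    (hmax : ∀ B : Metric.sphere (0 : Fin n → Fin n → ℝ) 1,
      |(Matrix.of B.1).det| / ellipsoidRatio N B.1 ^ n ≤
        |(Matrix.of A).det| / ellipsoidRatio N A ^ n) (hA0 : A ≠ 0) :
    ((ellipsoidRatio N A)⁻¹ • Matrix.of A).det ≠ 0 ∧
    ∀ a, ellipsoidNorm ((ellipsoidRatio N A)⁻¹ • Matrix.of A) a ≤ N a ∧
      N a ≤ √(n : ℝ) * ellipsoidNorm ((ellipsoidRatio N A)⁻¹ • Matrix.of A) a := by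
  have hr := ellipsoidRatio_pos hN hA0
  have h1 : ∀ a, ellipsoidNorm ((ellipsoidRatio N A)⁻¹ • Matrix.of A) a ≤ N a := fun a => by
    rw [ellipsoidNorm_smul, abs_of_pos (inv_pos.2 hr), inv_mul_le_iff₀ hr]
    exact ellipsoidNorm_le_ellipsoidRatio_mul hN A a
  have hdet : |((ellipsoidRatio N A)⁻¹ • Matrix.of A).det| =
      |(Matrix.of A).det| / ellipsoidRatio N A ^ n := by
    rw [Matrix.det_smul, abs_mul, Fintype.card_fin, abs_pow, abs_of_pos (inv_pos.2 hr), inv_pow,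
      div_eq_inv_mul]
  have hext : ∀ B : Fin n → Fin n → ℝ, B ≠ 0 →
      |(Matrix.of B).det| / ellipsoidRatio N B ^ n ≤
        |((ellipsoidRatio N A)⁻¹ • Matrix.of A).det| := by
    intro B hB
    have hB0 : ‖B‖ ≠ 0 := norm_ne_zero_iff.2 hB
    have hBp : 0 < ‖B‖ := norm_pos_iff.2 hB
    have hs : ‖B‖⁻¹ • B ∈ Metric.sphere (0 : Fin n → Fin n → ℝ) 1 := by
      simp [norm_smul, inv_mul_cancel₀ hB0]
    have hof : Matrix.of (‖B‖⁻¹ • B) = ‖B‖⁻¹ • Matrix.of B := rfl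
    have h2 := hmax ⟨_, hs⟩
    rw [hdet]
    refine le_trans ?_ h2
    have h3 : ellipsoidRatio N (‖B‖⁻¹ • B) ≤ ‖B‖⁻¹ * ellipsoidRatio N B := by
      refine ellipsoidRatio_le hN fun a => ?_
      rw [hof, ellipsoidNorm_smul, abs_of_pos (inv_pos.2 hBp), mul_assoc]
      exact mul_le_mul_of_nonneg_left (ellipsoidNorm_le_ellipsoidRatio_mul hN B a)
        (inv_nonneg.2 hBp.le)
    have h4 : ‖B‖⁻¹ • B ≠ 0 := smul_ne_zero (inv_ne_zero hB0) hB
    have h5 := ellipsoidRatio_pos hN h4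
    simp only [hof, Matrix.det_smul, Fintype.card_fin, abs_mul, abs_pow,
      abs_of_pos (inv_pos.2 hBp)]
    calc |(Matrix.of B).det| / ellipsoidRatio N B ^ n
        = (‖B‖⁻¹ ^ n * |(Matrix.of B).det|) / (‖B‖⁻¹ * ellipsoidRatio N B) ^ n := by
          rw [mul_pow, mul_div_mul_left _ _ (pow_ne_zero _ (inv_ne_zero hB0))]
      _ ≤ _ := by gcongr
  have hI : (1 : Matrix (Fin n) (Fin n) ℝ) ≠ 0 := by
    obtain ⟨s⟩ := ‹Nonempty (Metric.sphere (0 : Fin n → ℝ) 1)›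
    intro h
    have h2 : s.1 = 0 := by
      rw [← Matrix.one_mulVec s.1, h, Matrix.zero_mulVec]
    have h3 := s.2
    rw [h2] at h3
    simp at h3
  have hdet0 : ((ellipsoidRatio N A)⁻¹ • Matrix.of A).det ≠ 0 := by
    rw [← abs_pos]
    refine lt_of_lt_of_le ?_ (hext (Matrix.of.symm 1) hI)
    have h5 := ellipsoidRatio_pos hN (A := Matrix.of.symm (1 : Matrix (Fin n) (Fin n) ℝ)) hI
    have h6 : (Matrix.of (Matrix.of.symm (1 : Matrix (Fin n) (Fin n) ℝ))).det = 1 :=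
      Matrix.det_one
    rw [h6, abs_one]
    positivity
  refine ⟨hdet0, fun a => ⟨h1 a, ?_⟩⟩
  refine seminorm_le_sqrt_mul_ellipsoidNorm N h1 hdet0 (fun B hB => ?_) a
  by_cases hB0 : B = 0
  · obtain ⟨s⟩ := ‹Nonempty (Metric.sphere (0 : Fin n → ℝ) 1)›
    have : Nonempty (Fin n) := by
      by_contra hne
      rw [not_nonempty_iff] at hne
      exact hI (Subsingleton.elim _ _)
    rw [hB0, Matrix.det_zero, abs_zero]
    exact abs_nonneg _
  · refine le_trans ?_ (hext (Matrix.of.symm B) hB0)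
    have hr1 : ellipsoidRatio N (Matrix.of.symm B) ≤ 1 :=
      ellipsoidRatio_le hN fun a => by simpa using hB a
    have hr0 := ellipsoidRatio_pos hN (A := Matrix.of.symm B) hB0
    rw [Equiv.apply_symm_apply, le_div_iff₀ (by positivity)]
    exact mul_le_of_le_one_right (abs_nonneg _) (pow_le_one₀ hr0.le hr1)

end Ratio

variable {X : Type u} [MeasurableSpace X]

theorem NormField.measurable_ellipsoidRatio [Nonempty (Metric.sphere (0 : Fin n → ℝ) 1)]
    (F : NormField X n) (A : Fin n → Fin n → ℝ) :
    Measurable fun x => ellipsoidRatio (F.normAt x) A := by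
  have h := measurable_iInf_of_continuous (X := X) (K := Metric.sphere (0 : Fin n → ℝ) 1)
    (h := fun x a => -(ellipsoidNorm (Matrix.of A) a.1 / F.normAt x a.1))
    (fun x => ((continuous_ellipsoidNorm_div (F.eq_zero x)).comp
      (Continuous.prodMk_right A)).neg)
    (fun a => ((F.measurable a.1).const_div _).neg)
  convert h.neg using 2 with x
  simp only [ellipsoidRatio, Pi.neg_apply]
  rw [Set.image_univ, iInf, ← Real.sSup_neg]
  congr 1
  ext y
  simp [eq_comm, neg_eq_iff_eq_neg]

theorem measurable_ellipsoidNorm {A : X → Fin n → Fin n → ℝ} (hA : Measurable A)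
    (a : Fin n → ℝ) : Measurable fun x => ellipsoidNorm (Matrix.of (A x)) a := by
  have hij : ∀ i j, Measurable fun x => A x i j := fun i j =>
    (measurable_pi_apply j).comp ((measurable_pi_apply i).comp hA)
  have hi : ∀ i, Measurable fun x => (Matrix.of (A x)).mulVec a i := fun i =>
    Finset.measurable_sum Finset.univ fun j _ => (hij i j).mul_const (a j)
  simp_rw [ellipsoidNorm_apply]
  exact (Finset.measurable_sum _ fun i _ => (hi i).mul (hi i)).sqrt

/-- **John's ellipsoid theorem, measurably in a parameter**: a measurable field of norms on `ℝⁿ`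
is `√n`-equivalent to a measurable field of norms induced by scalar products. -/
theorem NormField.exists_john (F : NormField X n) :
    ∃ A : X → Matrix (Fin n) (Fin n) ℝ, ∃ F' : NormField X n,
      (∀ x, F'.normAt x = ellipsoidNorm (A x)) ∧
      (∀ x, IsInducedByScalarProduct (F'.normAt x)) ∧
      ∀ x a, F'.normAt x a ≤ F.normAt x a ∧ F.normAt x a ≤ √(n : ℝ) * F'.normAt x a := by
  suffices h : ∃ A : X → Fin n → Fin n → ℝ, Measurable A ∧ ∀ x, (Matrix.of (A x)).det ≠ 0 ∧
      ∀ a, ellipsoidNorm (Matrix.of (A x)) a ≤ F.normAt x a ∧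
        F.normAt x a ≤ √(n : ℝ) * ellipsoidNorm (Matrix.of (A x)) a by
    obtain ⟨A, hA, hb⟩ := h
    refine ⟨fun x => Matrix.of (A x),
      { normAt := fun x => ellipsoidNorm (Matrix.of (A x))
        eq_zero := fun x a ha => F.eq_zero x a (le_antisymm ?_ (apply_nonneg _ _))
        measurable := fun a => ?_ }, fun x => rfl,
      fun x => isInducedByScalarProduct_ellipsoidNorm (hb x).1, fun x a => (hb x).2 a⟩
    · have h := ((hb x).2 a).2
      rwa [ha, mul_zero] at h
    · exact measurable_ellipsoidNorm hA a
  rcases isEmpty_or_nonempty (Fin n) with hn | hn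
  · refine ⟨fun _ => Matrix.of.symm 1, measurable_const, fun x => ⟨?_, fun a => ?_⟩⟩
    · simp
    · rw [Subsingleton.elim a 0]
      simp
  have : Nonempty (Metric.sphere (0 : Fin n → ℝ) 1) :=
    (NormedSpace.sphere_nonempty.2 zero_le_one).to_subtype
  have : Nonempty (Metric.sphere (0 : Fin n → Fin n → ℝ) 1) :=
    (NormedSpace.sphere_nonempty.2 zero_le_one).to_subtype
  have hne : ∀ A : Metric.sphere (0 : Fin n → Fin n → ℝ) 1, A.1 ≠ 0 := fun A h => by
    have h1 := A.2
    rw [h] at h1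
    simp at h1
  have hratio : ∀ x, Continuous fun A : Metric.sphere (0 : Fin n → Fin n → ℝ) 1 =>
      ellipsoidRatio (F.normAt x) A.1 := fun x =>
    (continuous_ellipsoidRatio (F.eq_zero x)).comp continuous_subtype_val
  obtain ⟨s, hs, hmin⟩ := exists_measurable_argmin (X := X)
    (K := Metric.sphere (0 : Fin n → Fin n → ℝ) 1)
    (h := fun x A => -(|(Matrix.of A.1).det| / ellipsoidRatio (F.normAt x) A.1 ^ n))
    (fun x => by
      refine Continuous.neg (Continuous.div ?_ ((hratio x).pow n) fun A =>
        (pow_pos (ellipsoidRatio_pos (F.eq_zero x) (hne A)) n).ne')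
      refine continuous_abs.comp (Continuous.matrix_det ?_)
      exact continuous_subtype_val)
    (fun A => (((F.measurable_ellipsoidRatio A.1).pow_const n).const_div _).neg)
  refine ⟨fun x => (ellipsoidRatio (F.normAt x) (s x).1)⁻¹ • (s x).1, ?_, fun x => ?_⟩
  · have hs' : Measurable fun x => (s x).1 := measurable_subtype_coe.comp hs
    have h := measurable_uncurry_of_continuous_of_measurable
      (u := fun (A : Metric.sphere (0 : Fin n → Fin n → ℝ) 1) (x : X) =>
        ellipsoidRatio (F.normAt x) A.1) hratio (fun A => F.measurable_ellipsoidRatio A.1)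
    have h' : Measurable fun x => (ellipsoidRatio (F.normAt x) (s x).1)⁻¹ :=
      (h.comp (hs.prodMk measurable_id)).inv
    exact measurable_pi_lambda _ fun i => measurable_pi_lambda _ fun j =>
      h'.mul ((measurable_pi_apply j).comp ((measurable_pi_apply i).comp hs'))
  · exact john_bounds_of_maximizer (F.eq_zero x) (fun B => neg_le_neg_iff.1 (hmin x B))
      (hne _)

end JohnField

/-! ### Calculus of the pointwise norm -/

section Module

variable {X : Type u} [MeasurableSpace X] {p : ℝ≥0∞} [Fact (1 ≤ p)] {m : Measure X}
  {𝓜 : Type w} [NormedAddCommGroup 𝓜] [NormedSpace ℝ 𝓜] [CompleteSpace 𝓜]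

theorem coeFn_linfIndicator {A : Set X} (hA : MeasurableSet A) :
    linfIndicator m A hA =ᵐ[m] A.indicator fun _ => (1 : ℝ) :=
  MemLp.coeFn_toLp _

theorem coeFn_linfMul (f g : Lp ℝ ∞ m) : linfMul f g =ᵐ[m] fun x => f x * g x :=
  MemLp.coeFn_toLp _

theorem linfMul_comm (f g : Lp ℝ ∞ m) : linfMul f g = linfMul g f := by
  apply Lp.ext
  filter_upwards [coeFn_linfMul f g, coeFn_linfMul g f] with x h1 h2
  rw [h1, h2, mul_comm]

namespace LpNormedModule

variable (S : LpNormedModule p m 𝓜)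

theorem enorm_eq_eLpNorm (v : 𝓜) : ‖v‖ₑ = eLpNorm (S.pnorm v) p m := by
  rw [← Lp.enorm_def, ← ofReal_norm, ← ofReal_norm, S.norm_eq]

theorem eq_zero_of_pnorm {v : 𝓜} (h : ∀ᵐ x ∂m, S.pnorm v x = 0) : v = 0 := by
  rw [← norm_eq_zero, S.norm_eq, norm_eq_zero]
  apply Lp.ext
  filter_upwards [h, Lp.coeFn_zero ℝ p m] with x h1 h2
  rw [h1, h2]
  rfl

theorem pnorm_zero : ∀ᵐ x ∂m, S.pnorm 0 x = 0 := by
  have h : S.pnorm 0 = 0 := by rw [← norm_eq_zero, ← S.norm_eq, norm_zero]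
  rw [h]
  exact Lp.coeFn_zero ℝ p m

theorem pnorm_indicator {A : Set X} (hA : MeasurableSet A) (v : 𝓜) :
    ∀ᵐ x ∂m, S.pnorm (S.smul (linfIndicator m A hA) v) x = A.indicator (S.pnorm v) x := by
  filter_upwards [S.pnorm_smul (linfIndicator m A hA) v, coeFn_linfIndicator (m := m) hA]
    with x h1 h2
  rw [h1, h2]
  by_cases hx : x ∈ A <;> simp [hx]

theorem smul_const (c : ℝ) (v : 𝓜) :
    S.smul (c • linfIndicator m Set.univ MeasurableSet.univ) v = c • v := by
  rw [map_smul, LinearMap.smul_apply, S.one_smul]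

theorem pnorm_const_smul (c : ℝ) (v : 𝓜) : ∀ᵐ x ∂m, S.pnorm (c • v) x = |c| * S.pnorm v x := by
  rw [← S.smul_const]
  filter_upwards [S.pnorm_smul (c • linfIndicator m Set.univ MeasurableSet.univ) v,
    coeFn_linfIndicator (m := m) MeasurableSet.univ,
    Lp.coeFn_smul c (linfIndicator m Set.univ MeasurableSet.univ)] with x h1 h2 h3
  rw [h1, h3, Pi.smul_apply, h2]
  simp

theorem eLpNorm_indicator_pnorm {A : Set X} (hA : MeasurableSet A) (v : 𝓜) :
    eLpNorm (A.indicator (S.pnorm v)) p m = ‖S.smul (linfIndicator m A hA) v‖ₑ := by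
  rw [S.enorm_eq_eLpNorm]
  exact eLpNorm_congr_ae (EventuallyEq.symm (S.pnorm_indicator hA v))

/-- The pointwise triangle inequality. It is not an axiom: it follows from the triangle inequality
of the norm, applied to the restrictions to the sets `{α ≤ |v + w|, |v| ≤ β, |w| ≤ γ}` for
rational numbers `α > β + γ`. -/
theorem pnorm_add_le (v w : 𝓜) : ∀ᵐ x ∂m, S.pnorm (v + w) x ≤ S.pnorm v x + S.pnorm w x := by
  have key : ∀ α β γ : ℚ, 0 ≤ β → 0 ≤ γ → β + γ < α → ∀ᵐ x ∂m,
      ¬ ((α : ℝ) ≤ S.pnorm (v + w) x ∧ S.pnorm v x ≤ β ∧ S.pnorm w x ≤ γ) := by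
    intro α β γ hβ hγ hα
    have hβ' : (0 : ℝ) ≤ β := by exact_mod_cast hβ
    have hγ' : (0 : ℝ) ≤ γ := by exact_mod_cast hγ
    have hα' : (β : ℝ) + γ < α := by exact_mod_cast hα
    set A : Set X := {x | (α : ℝ) ≤ S.pnorm (v + w) x} ∩
      ({x | S.pnorm v x ≤ β} ∩ {x | S.pnorm w x ≤ γ}) with hAdef
    have hA : MeasurableSet A :=
      (measurableSet_le measurable_const (Lp.stronglyMeasurable _).measurable).inter
        ((measurableSet_le (Lp.stronglyMeasurable _).measurable measurable_const).inter
          (measurableSet_le (Lp.stronglyMeasurable _).measurable measurable_const))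
    have hp0 : p ≠ 0 := (zero_lt_one.trans_le (Fact.out : 1 ≤ p)).ne'
    set K := eLpNorm (A.indicator fun _ => (1 : ℝ)) p m with hK
    have hconst : ∀ c : ℝ, 0 ≤ c →
        eLpNorm (A.indicator fun _ => c) p m = ENNReal.ofReal c * K := by
      intro c hc
      have : (A.indicator fun _ => c) = c • A.indicator fun _ => (1 : ℝ) := by
        ext x
        by_cases hx : x ∈ A <;> simp [hx]
      rw [this, eLpNorm_const_smul, Real.enorm_of_nonneg hc]
    have h1 : ENNReal.ofReal α * K ≤ ‖S.smul (linfIndicator m A hA) (v + w)‖ₑ := by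
      rw [← hconst α (by linarith), ← S.eLpNorm_indicator_pnorm]
      refine eLpNorm_mono_ae (ae_of_all _ fun x => ?_)
      by_cases hx : x ∈ A
      · simp only [Set.indicator_of_mem hx]
        rw [Real.norm_of_nonneg (by linarith)]
        exact hx.1.trans (Real.le_norm_self _)
      · simp [hx]
    have h2 : ∀ (u : 𝓜) (c : ℝ), 0 ≤ c → (∀ x ∈ A, S.pnorm u x ≤ c) →
        ‖S.smul (linfIndicator m A hA) u‖ₑ ≤ ENNReal.ofReal c * K := by
      intro u c hc hu
      rw [← hconst c hc, ← S.eLpNorm_indicator_pnorm]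
      refine eLpNorm_mono_ae ?_
      filter_upwards [S.pnorm_nonneg u] with x hx0
      by_cases hx : x ∈ A
      · simp only [Set.indicator_of_mem hx]
        rw [Real.norm_of_nonneg hx0, Real.norm_of_nonneg hc]
        exact hu x hx
      · simp [hx]
    have h3 : ENNReal.ofReal α * K ≤ ENNReal.ofReal (β + γ) * K := by
      refine h1.trans ?_
      rw [map_add, ENNReal.ofReal_add hβ' hγ', add_mul]
      exact (enorm_add_le _ _).trans
        (add_le_add (h2 v β hβ' fun x hx => hx.2.1) (h2 w γ hγ' fun x hx => hx.2.2))
    have hαpos : 0 < ENNReal.ofReal (α : ℝ) := ENNReal.ofReal_pos.2 (by linarith)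
    have hKtop : K ≠ ∞ := by
      intro h
      rw [h, ENNReal.mul_top hαpos.ne'] at h1
      exact absurd h1 (not_le.2 enorm_lt_top)
    have hK0 : K = 0 := by
      by_contra h
      have h4 := (ENNReal.mul_le_mul_iff_left h hKtop).1 h3
      rw [ENNReal.ofReal_le_ofReal_iff (by linarith)] at h4
      linarith
    rw [hK, eLpNorm_eq_zero_iff (aestronglyMeasurable_const.indicator hA) hp0] at hK0
    filter_upwards [hK0] with x hx hxA
    have hxA' : x ∈ A := hxA
    simp [hxA'] at hx
  have hall : ∀ᵐ x ∂m, ∀ α β γ : ℚ, 0 ≤ β → 0 ≤ γ → β + γ < α →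
      ¬ ((α : ℝ) ≤ S.pnorm (v + w) x ∧ S.pnorm v x ≤ β ∧ S.pnorm w x ≤ γ) := by
    simp only [ae_all_iff]
    exact key
  filter_upwards [hall, S.pnorm_nonneg v, S.pnorm_nonneg w] with x hx hv hw
  by_contra! hlt
  set d := (S.pnorm (v + w) x - (S.pnorm v x + S.pnorm w x)) / 3 with hd
  have hd0 : 0 < d := by rw [hd]; linarith
  obtain ⟨β, hβ1, hβ2⟩ := exists_rat_btwn (show S.pnorm v x < S.pnorm v x + d by linarith)
  obtain ⟨γ, hγ1, hγ2⟩ := exists_rat_btwn (show S.pnorm w x < S.pnorm w x + d by linarith)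
  obtain ⟨α, hα1, hα2⟩ := exists_rat_btwn
    (show S.pnorm (v + w) x - d < S.pnorm (v + w) x by linarith)
  refine hx α β γ ?_ ?_ ?_ ⟨hα2.le, hβ1.le, hγ1.le⟩
  · exact_mod_cast hv.trans hβ1.le
  · exact_mod_cast hw.trans hγ1.le
  · have : (β : ℝ) + γ < α := by linarith
    exact_mod_cast this

theorem pnorm_neg (v : 𝓜) : ∀ᵐ x ∂m, S.pnorm (-v) x = S.pnorm v x := by
  filter_upwards [S.pnorm_const_smul (-1) v] with x h
  rw [neg_one_smul] at h
  simpa using h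

theorem pnorm_sum_le {ι : Type*} (t : Finset ι) (v : ι → 𝓜) :
    ∀ᵐ x ∂m, S.pnorm (∑ i ∈ t, v i) x ≤ ∑ i ∈ t, S.pnorm (v i) x := by
  classical
  induction t using Finset.induction_on with
  | empty =>
    filter_upwards [S.pnorm_zero] with x h
    simp [h]
  | insert i t hi ih =>
    rw [Finset.sum_insert hi]
    filter_upwards [ih, S.pnorm_add_le (v i) (∑ i ∈ t, v i)] with x h1 h2
    rw [Finset.sum_insert hi]
    linarith

theorem abs_pnorm_sub_le (v w : 𝓜) :
    ∀ᵐ x ∂m, |S.pnorm v x - S.pnorm w x| ≤ S.pnorm (v - w) x := by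
  filter_upwards [S.pnorm_add_le (v - w) w, S.pnorm_add_le (-(v - w)) v, S.pnorm_neg (v - w)]
    with x h1 h2 h3
  have e : -(v - w) + v = w := by abel
  rw [sub_add_cancel] at h1
  rw [e, h3] at h2
  exact abs_le.2 ⟨by linarith, by linarith⟩

end LpNormedModule

end Module

/-! ### The field of seminorms of a finite family of elements -/

section RationalSeminorm

variable {n : ℕ}

theorem denseRange_ratCast_pi : DenseRange fun (q : Fin n → ℚ) (i : Fin n) => (q i : ℝ) :=
  DenseRange.piMap fun _ => Rat.denseRange_cast

/-- A `ℚ`-seminorm `r` on `ℚⁿ` with `|r q - r q'| ≤ ∑ |qᵢ - q'ᵢ| eᵢ`. -/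
structure IsRationalSeminorm (r : (Fin n → ℚ) → ℝ) (e : Fin n → ℝ) : Prop where
  nonneg : ∀ q, 0 ≤ r q
  weight_nonneg : ∀ i, 0 ≤ e i
  add_le : ∀ q q', r (q + q') ≤ r q + r q'
  smul : ∀ (c : ℚ) q, r (c • q) = |(c : ℝ)| * r q
  le_add : ∀ q q', r q ≤ r q' + ∑ i, |(q i : ℝ) - q' i| * e i

/-- The Lipschitz extension of a `ℚ`-seminorm on `ℚⁿ` to `ℝⁿ`. -/
noncomputable def ratExtend (r : (Fin n → ℚ) → ℝ) (e : Fin n → ℝ) (a : Fin n → ℝ) : ℝ :=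
  ⨅ q : Fin n → ℚ, (r q + ∑ i, |a i - q i| * e i)

namespace IsRationalSeminorm

variable {r : (Fin n → ℚ) → ℝ} {e : Fin n → ℝ} (h : IsRationalSeminorm r e)

include h

theorem sum_nonneg (b : Fin n → ℝ) : 0 ≤ ∑ i, |b i| * e i :=
  Finset.sum_nonneg fun i _ => mul_nonneg (abs_nonneg _) (h.weight_nonneg i)

theorem bddBelow (a : Fin n → ℝ) :
    BddBelow (Set.range fun q : Fin n → ℚ => r q + ∑ i, |a i - q i| * e i) := by
  refine ⟨0, ?_⟩
  rintro _ ⟨q, rfl⟩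
  exact add_nonneg (h.nonneg q) (h.sum_nonneg fun i => a i - q i)

theorem ratExtend_le (a : Fin n → ℝ) (q : Fin n → ℚ) :
    ratExtend r e a ≤ r q + ∑ i, |a i - q i| * e i := ciInf_le (h.bddBelow a) q

theorem ratExtend_le_add (a b : Fin n → ℝ) :
    ratExtend r e a ≤ ratExtend r e b + ∑ i, |a i - b i| * e i := by
  rw [← sub_le_iff_le_add]
  refine le_ciInf fun q => ?_
  rw [sub_le_iff_le_add]
  refine (h.ratExtend_le a q).trans ?_
  rw [add_assoc, ← Finset.sum_add_distrib]
  refine add_le_add le_rfl (Finset.sum_le_sum fun i _ => ?_)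
  rw [← add_mul]
  refine mul_le_mul_of_nonneg_right ?_ (h.weight_nonneg i)
  rw [add_comm]
  exact abs_sub_le _ _ _

theorem continuous_ratExtend : Continuous (ratExtend r e) := by
  have hK : LipschitzWith (Real.toNNReal (∑ i, e i)) (ratExtend r e) := by
    refine LipschitzWith.of_le_add_mul _ fun a b => (h.ratExtend_le_add a b).trans ?_
    rw [Real.coe_toNNReal _ (Finset.sum_nonneg fun i _ => h.weight_nonneg i), Finset.sum_mul]
    refine add_le_add le_rfl (Finset.sum_le_sum fun i _ => ?_)
    rw [mul_comm]
    exact mul_le_mul_of_nonneg_left (dist_le_pi_dist a b i) (h.weight_nonneg i)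
  exact hK.continuous

theorem ratExtend_ratCast (q : Fin n → ℚ) : ratExtend r e (fun i => (q i : ℝ)) = r q := by
  refine le_antisymm ?_ (le_ciInf fun q' => h.le_add q q')
  simpa using h.ratExtend_le (fun i => (q i : ℝ)) q

theorem ratExtend_smul (c : ℝ) (a : Fin n → ℝ) :
    ratExtend r e (c • a) = |c| * ratExtend r e a := by
  have hd : DenseRange (Prod.map (fun c : ℚ => (c : ℝ))
      fun (q : Fin n → ℚ) (i : Fin n) => (q i : ℝ)) :=
    Rat.denseRange_cast.prodMap denseRange_ratCast_pi
  have hcont := h.continuous_ratExtend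
  have key : (fun z : ℝ × (Fin n → ℝ) => ratExtend r e (z.1 • z.2)) =
      fun z => |z.1| * ratExtend r e z.2 := by
    refine hd.equalizer (by fun_prop) (by fun_prop) ?_
    ext ⟨c, q⟩
    simp only [Function.comp_apply, Prod.map_apply]
    rw [h.ratExtend_ratCast, ← h.smul, ← h.ratExtend_ratCast]
    congr 1
    ext i
    simp
  exact congrFun key (c, a)

theorem ratExtend_add_le (a b : Fin n → ℝ) :
    ratExtend r e (a + b) ≤ ratExtend r e a + ratExtend r e b := by
  have hd : DenseRange (Prod.map (fun (q : Fin n → ℚ) (i : Fin n) => (q i : ℝ))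
      fun (q : Fin n → ℚ) (i : Fin n) => (q i : ℝ)) :=
    denseRange_ratCast_pi.prodMap denseRange_ratCast_pi
  have hcont := h.continuous_ratExtend
  have hcl : IsClosed {z : (Fin n → ℝ) × (Fin n → ℝ) |
      ratExtend r e (z.1 + z.2) ≤ ratExtend r e z.1 + ratExtend r e z.2} :=
    isClosed_le (by fun_prop) (by fun_prop)
  refine hd.induction_on (p := fun z : (Fin n → ℝ) × (Fin n → ℝ) =>
    ratExtend r e (z.1 + z.2) ≤ ratExtend r e z.1 + ratExtend r e z.2) (a, b) hcl ?_
  rintro ⟨q, q'⟩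
  simp only [Prod.map_apply]
  rw [h.ratExtend_ratCast, h.ratExtend_ratCast]
  convert h.add_le q q' using 1
  rw [← h.ratExtend_ratCast]
  congr 1
  ext i
  simp

theorem eq_ratExtend {a : Fin n → ℝ} {P : ℝ}
    (hP : ∀ q : Fin n → ℚ, |P - r q| ≤ ∑ i, |a i - q i| * e i) : P = ratExtend r e a := by
  refine le_antisymm (le_ciInf fun q => ?_) ?_
  · linarith [(abs_le.1 (hP q)).2]
  have hcl : IsClosed {b : Fin n → ℝ | ratExtend r e a ≤ P + 2 * ∑ i, |a i - b i| * e i} :=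
    isClosed_le continuous_const (by fun_prop)
  have h1 := denseRange_ratCast_pi.induction_on
    (p := fun b : Fin n → ℝ => ratExtend r e a ≤ P + 2 * ∑ i, |a i - b i| * e i) a hcl
    (fun q => by linarith [h.ratExtend_le a q, (abs_le.1 (hP q)).1])
  simpa using h1

end IsRationalSeminorm

end RationalSeminorm

section Module

variable {X : Type u} [MeasurableSpace X] {p : ℝ≥0∞} [Fact (1 ≤ p)] {m : Measure X}
  {𝓜 : Type w} [NormedAddCommGroup 𝓜] [NormedSpace ℝ 𝓜] [CompleteSpace 𝓜]

namespace LpNormedModule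

variable (S : LpNormedModule p m 𝓜) {n : ℕ}

theorem sum_smul_const (c : Fin n → ℝ) (v : Fin n → 𝓜) :
    ∑ i, S.smul (c i • linfIndicator m Set.univ MeasurableSet.univ) (v i) = ∑ i, c i • v i :=
  Finset.sum_congr rfl fun _ _ => S.smul_const _ _

theorem abs_pnorm_sum_sub_le (f : Fin n → Lp ℝ ∞ m) (c : Fin n → ℝ) (v : Fin n → 𝓜) :
    ∀ᵐ x ∂m, |S.pnorm (∑ i, S.smul (f i) (v i)) x - S.pnorm (∑ i, c i • v i) x| ≤
      ∑ i, |f i x - c i| * S.pnorm (v i) x := by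
  set g : Fin n → Lp ℝ ∞ m := fun i =>
    f i - c i • linfIndicator m Set.univ MeasurableSet.univ with hg
  have hsub : ∑ i, S.smul (f i) (v i) - ∑ i, c i • v i = ∑ i, S.smul (g i) (v i) := by
    rw [← S.sum_smul_const, ← Finset.sum_sub_distrib]
    refine Finset.sum_congr rfl fun i _ => ?_
    rw [hg, map_sub, LinearMap.sub_apply]
  have hgx : ∀ i, ∀ᵐ x ∂m, g i x = f i x - c i := fun i => by
    filter_upwards [Lp.coeFn_sub (f i) (c i • linfIndicator m Set.univ MeasurableSet.univ),
      Lp.coeFn_smul (c i) (linfIndicator m Set.univ MeasurableSet.univ),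
      coeFn_linfIndicator (m := m) MeasurableSet.univ] with x h1 h2 h3
    rw [hg, h1, Pi.sub_apply, h2, Pi.smul_apply, h3]
    simp
  filter_upwards [S.abs_pnorm_sub_le (∑ i, S.smul (f i) (v i)) (∑ i, c i • v i),
    S.pnorm_sum_le Finset.univ fun i => S.smul (g i) (v i), ae_all_iff.2 hgx,
    ae_all_iff.2 fun i => S.pnorm_smul (g i) (v i)] with x h1 h2 h3 h4
  rw [hsub] at h1
  refine h1.trans (h2.trans (le_of_eq (Finset.sum_congr rfl fun i _ => ?_)))
  rw [h4, h3]

/-- For every finite family `v` in the module there is a measurable field of seminorms `N_x` on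
`ℝⁿ` with `|∑ fᵢ vᵢ|(x) = N_x(f(x))` almost everywhere, for all bounded coefficients `f`. -/
theorem exists_seminormField (v : Fin n → 𝓜) :
    ∃ N : X → Seminorm ℝ (Fin n → ℝ), (∀ a, Measurable fun x => N x a) ∧
      ∀ f : Fin n → Lp ℝ ∞ m,
        ∀ᵐ x ∂m, S.pnorm (∑ i, S.smul (f i) (v i)) x = N x fun i => f i x := by
  classical
  set r : X → (Fin n → ℚ) → ℝ := fun x q => S.pnorm (∑ i, (q i : ℝ) • v i) x with hr
  set e : X → Fin n → ℝ := fun x i => S.pnorm (v i) x with he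
  have hgood : ∀ᵐ x ∂m, IsRationalSeminorm (r x) (e x) := by
    have h1 : ∀ᵐ x ∂m, ∀ q, 0 ≤ r x q := ae_all_iff.2 fun q => S.pnorm_nonneg _
    have h2 : ∀ᵐ x ∂m, ∀ i, 0 ≤ e x i := ae_all_iff.2 fun i => S.pnorm_nonneg _
    have h3 : ∀ᵐ x ∂m, ∀ q q', r x (q + q') ≤ r x q + r x q' := by
      refine ae_all_iff.2 fun q => ae_all_iff.2 fun q' => ?_
      filter_upwards [S.pnorm_add_le (∑ i, (q i : ℝ) • v i) (∑ i, (q' i : ℝ) • v i)] with x h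
      rw [← Finset.sum_add_distrib] at h
      simpa only [hr, Pi.add_apply, Rat.cast_add, add_smul] using h
    have h4 : ∀ᵐ x ∂m, ∀ (c : ℚ) q, r x (c • q) = |(c : ℝ)| * r x q := by
      refine ae_all_iff.2 fun c => ae_all_iff.2 fun q => ?_
      filter_upwards [S.pnorm_const_smul (c : ℝ) (∑ i, (q i : ℝ) • v i)] with x h
      rw [Finset.smul_sum] at h
      simpa only [hr, Pi.smul_apply, smul_eq_mul, Rat.cast_mul, smul_smul] using h
    have h5 : ∀ᵐ x ∂m, ∀ q q', r x q ≤ r x q' + ∑ i, |(q i : ℝ) - q' i| * e x i := by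
      refine ae_all_iff.2 fun q => ae_all_iff.2 fun q' => ?_
      filter_upwards [S.abs_pnorm_sum_sub_le
        (fun i => (q i : ℝ) • linfIndicator m Set.univ MeasurableSet.univ)
        (fun i => (q' i : ℝ)) v,
        ae_all_iff.2 fun i => Lp.coeFn_smul (q i : ℝ) (linfIndicator m Set.univ MeasurableSet.univ),
        coeFn_linfIndicator (m := m) MeasurableSet.univ] with x h h' h''
      rw [S.sum_smul_const fun i => (q i : ℝ)] at h
      simp only [h', Pi.smul_apply, h'', Set.indicator_univ, smul_eq_mul, mul_one] at h
      linarith [(abs_le.1 h).2]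
    filter_upwards [h1, h2, h3, h4, h5] with x h1 h2 h3 h4 h5
    exact ⟨h1, h2, h3, h4, h5⟩
  obtain ⟨G, hGm, hG, hGP⟩ := hgood.exists_measurable_mem
  let N : X → Seminorm ℝ (Fin n → ℝ) := fun x =>
    if hx : x ∈ G then Seminorm.of (ratExtend (r x) (e x)) (hGP x hx).ratExtend_add_le
      (fun c a => by rw [Real.norm_eq_abs]; exact (hGP x hx).ratExtend_smul c a) else 0
  have hN : ∀ x a, N x a = G.indicator (fun x => ratExtend (r x) (e x) a) x := by
    intro x a
    by_cases hx : x ∈ G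
    · simp only [N, dif_pos hx, Set.indicator_of_mem hx]
      rfl
    · simp only [N, dif_neg hx, Set.indicator_of_notMem hx]
      rfl
  refine ⟨N, fun a => ?_, fun f => ?_⟩
  · simp_rw [hN]
    refine Measurable.indicator (Measurable.iInf fun q => ?_) hG
    refine (Lp.stronglyMeasurable _).measurable.add (Finset.measurable_sum Finset.univ fun i _ => ?_)
    exact (Lp.stronglyMeasurable (S.pnorm (v i))).measurable.const_mul _
  · filter_upwards [hGm, ae_all_iff.2 fun q : Fin n → ℚ =>
      S.abs_pnorm_sum_sub_le f (fun i => (q i : ℝ)) v] with x hx h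
    rw [hN, Set.indicator_of_mem hx]
    exact (hGP x hx).eq_ratExtend h

end LpNormedModule

end Module

/-! ### Local bases and coordinates -/

section Kernel

variable {X : Type u} [MeasurableSpace X] {n : ℕ}

theorem measurable_seminormField_apply {N : X → Seminorm ℝ (Fin n → ℝ)}
    (hN : ∀ a, Measurable fun x => N x a) {a : X → Fin n → ℝ} (ha : Measurable a) :
    Measurable fun x => N x (a x) := by
  have h := measurable_uncurry_of_continuous_of_measurable (u := fun (b : Fin n → ℝ) x => N x b)
    (fun x => (N x).continuous_pi_fin) hN
  exact h.comp (ha.prodMk measurable_id)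

/-- A measurable choice of a unit vector at which the seminorms are smallest: it lies in the
kernel of `N x` unless `N x` is a norm. -/
theorem exists_measurable_unit_argmin [Nonempty (Fin n)] {N : X → Seminorm ℝ (Fin n → ℝ)}
    (hN : ∀ a, Measurable fun x => N x a) :
    ∃ s : X → Fin n → ℝ, Measurable s ∧ (∀ x, ‖s x‖ = 1) ∧
      ∀ x, N x (s x) ≠ 0 → ∀ a, N x a = 0 → a = 0 := by
  have : Nonempty (Metric.sphere (0 : Fin n → ℝ) 1) :=
    (NormedSpace.sphere_nonempty.2 zero_le_one).to_subtype
  obtain ⟨s, hs, hmin⟩ := exists_measurable_argmin (X := X)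
    (K := Metric.sphere (0 : Fin n → ℝ) 1) (h := fun x a => N x a.1)
    (fun x => (N x).continuous_pi_fin.comp continuous_subtype_val) (fun a => hN _)
  refine ⟨fun x => (s x).1, measurable_subtype_coe.comp hs, fun x => by simp, fun x hx a ha => ?_⟩
  by_contra ha0
  have ha' : ‖a‖ ≠ 0 := norm_ne_zero_iff.2 ha0
  have h := hmin x ⟨‖a‖⁻¹ • a, by simp [norm_smul, inv_mul_cancel₀ ha']⟩
  simp only [map_smul_eq_mul, ha, mul_zero] at h
  exact hx (le_antisymm h (apply_nonneg _ _))

theorem exists_linf_ae_eq (m : Measure X) {f : X → ℝ} (hf : Measurable f) {C : ℝ}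
    (hC : ∀ x, |f x| ≤ C) : ∃ g : Lp ℝ ∞ m, g =ᵐ[m] f :=
  ⟨(memLp_top_of_bound hf.aestronglyMeasurable C (ae_of_all _ hC)).toLp f, MemLp.coeFn_toLp _⟩

end Kernel

section Module

variable {X : Type u} [MeasurableSpace X] {p : ℝ≥0∞} [Fact (1 ≤ p)] {m : Measure X}
  {𝓜 : Type w} [NormedAddCommGroup 𝓜] [NormedSpace ℝ 𝓜] [CompleteSpace 𝓜]

namespace LpNormedModule

variable (S : LpNormedModule p m 𝓜) {n : ℕ}

/-- Independence on `A` of a finite family. -/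
def FamilyIndependentOn (v : Fin n → 𝓜) (A : Set X) : Prop :=
  ∀ f : Fin n → Lp ℝ ∞ m, (∀ᵐ x ∂m, x ∈ A → S.pnorm (∑ i, S.smul (f i) (v i)) x = 0) →
    ∀ i, ∀ᵐ x ∂m, x ∈ A → f i x = 0

variable {S}

theorem IndependentOn.familyIndependentOn {v : Fin n → 𝓜} {A : Set X} (hinj : v.Injective)
    (h : S.IndependentOn (Set.range v) A) : S.FamilyIndependentOn v A := by
  classical
  intro f hf i
  have h1 := h (Finset.univ.image v) (Function.extend v f 0) (by simp) ?_ (v i) (by simp)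
  · simpa only [hinj.extend_apply] using h1
  · rw [Finset.sum_image fun i _ j _ hij => hinj hij]
    simpa only [hinj.extend_apply] using hf

theorem FamilyIndependentOn.injective {v : Fin n → 𝓜} {A : Set X} (hA : m A ≠ 0)
    (h : S.FamilyIndependentOn v A) : v.Injective := by
  intro i j hij
  by_contra hne
  set one := linfIndicator m Set.univ MeasurableSet.univ
  have h1 := h (Pi.single i one - Pi.single j one) ?_ i
  · refine hA (measure_mono_null (t := {x | ¬ (x ∉ A)}) (fun x hx => not_not.2 hx) ?_)
    filter_upwards [h1, coeFn_linfIndicator (m := m) MeasurableSet.univ] with x h2 h3 hxA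
    have h4 := h2 hxA
    simp only [Pi.sub_apply, Pi.single_eq_same, Pi.single_eq_of_ne hne, sub_zero] at h4
    rw [h3] at h4
    simp at h4
  · have hs : ∑ k, S.smul ((Pi.single i one - Pi.single j one : Fin n → Lp ℝ ∞ m) k) (v k) = 0 := by
      have h5 : ∀ k : Fin n, S.smul ((Pi.single i one - Pi.single j one : Fin n → Lp ℝ ∞ m) k) (v k)
          = (if k = i then S.smul one (v i) else 0) - if k = j then S.smul one (v j) else 0 := by
        intro k
        rw [Pi.sub_apply, map_sub, LinearMap.sub_apply]
        congr 1
        · by_cases hk : k = i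
          · subst hk; simp
          · simp [hk]
        · by_cases hk : k = j
          · subst hk; simp
          · simp [hk]
      simp_rw [h5]
      simp [hij]
    rw [hs]
    filter_upwards [S.pnorm_zero] with x hx _ using hx

theorem FamilyIndependentOn.independentOn {v : Fin n → 𝓜} {A : Set X} (hinj : v.Injective)
    (h : S.FamilyIndependentOn v A) : S.IndependentOn (Set.range v) A := by
  classical
  intro t f ht hf u hu
  obtain ⟨i, rfl⟩ := ht hu
  have h1 := h (fun i => if v i ∈ t then f (v i) else 0) ?_ i
  · simpa only [if_pos (show v i ∈ t from hu)] using h1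
  · have hs : ∑ i, S.smul (if v i ∈ t then f (v i) else 0) (v i) = ∑ u ∈ t, S.smul (f u) u := by
      have himg : (Finset.univ.filter fun i => v i ∈ t).image v = t := by
        ext u
        simp only [Finset.mem_image, Finset.mem_filter, Finset.mem_univ, true_and]
        constructor
        · rintro ⟨i, hi, rfl⟩
          exact hi
        · intro hu
          obtain ⟨i, rfl⟩ := ht hu
          exact ⟨i, hu, rfl⟩
      have h2 : ∑ u ∈ t, S.smul (f u) u =
          ∑ u ∈ (Finset.univ.filter fun i => v i ∈ t).image v, S.smul (f u) u := by rw [himg]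
      rw [h2, Finset.sum_image fun i _ j _ hij => hinj hij, Finset.sum_filter]
      refine Finset.sum_congr rfl fun i _ => ?_
      split_ifs <;> simp
    rw [hs]
    exact hf

/-- Independence has finite character, so that independent sets extend to maximal ones. -/
theorem IndependentOn.exists_isMaximalIndependentOn {W : Set 𝓜} {A : Set X}
    (hW : ∀ v ∈ W, S.ConcentratedOn v A) (h : S.IndependentOn W A) :
    ∃ V, W ⊆ V ∧ S.IsMaximalIndependentOn V A := by
  refine zorn_subset_nonempty
    {W : Set 𝓜 | (∀ v ∈ W, S.ConcentratedOn v A) ∧ S.IndependentOn W A} ?_ W ⟨hW, h⟩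
  intro c hc hchain hne
  refine ⟨⋃₀ c, ⟨?_, ?_⟩, fun s hs => Set.subset_sUnion_of_mem hs⟩
  · rintro v ⟨s, hs, hv⟩
    exact (hc hs).1 v hv
  · intro t f ht
    obtain ⟨s, hs, hts⟩ := hchain.directedOn.exists_mem_subset_of_finset_subset_biUnion hne
      (f := id) (s := t) (by simpa [Set.sUnion_eq_biUnion] using ht)
    exact (hc hs).2 t f hts

/-- The seminorms of an independent family are norms. -/
theorem FamilyIndependentOn.ae_norm {v : Fin n → 𝓜} {A : Set X}
    (hv : S.FamilyIndependentOn v A) {N : X → Seminorm ℝ (Fin n → ℝ)}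
    (hN : ∀ a, Measurable fun x => N x a)
    (hNv : ∀ f : Fin n → Lp ℝ ∞ m,
      ∀ᵐ x ∂m, S.pnorm (∑ i, S.smul (f i) (v i)) x = N x fun i => f i x) :
    ∀ᵐ x ∂m, x ∈ A → ∀ a, N x a = 0 → a = 0 := by
  rcases isEmpty_or_nonempty (Fin n) with hn | hn
  · exact ae_of_all _ fun x _ a _ => Subsingleton.elim _ _
  obtain ⟨s, hs, hs1, hsN⟩ := exists_measurable_unit_argmin hN
  set B : Set X := {x | N x (s x) = 0} with hB
  have hBm : MeasurableSet B :=
    measurableSet_eq_fun (measurable_seminormField_apply hN hs) measurable_const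
  have hsi : ∀ i, Measurable fun x => s x i := fun i => (measurable_pi_apply i).comp hs
  have hbound : ∀ i x, |B.indicator (fun x => s x i) x| ≤ 1 := fun i x => by
    by_cases hx : x ∈ B
    · rw [Set.indicator_of_mem hx, ← hs1 x]
      exact norm_le_pi_norm (s x) i
    · simp [hx]
  choose f hf using fun i => exists_linf_ae_eq m ((hsi i).indicator hBm) (hbound i)
  have h1 := hv f (by
    filter_upwards [hNv f, ae_all_iff.2 hf] with x h1 h2 _
    rw [h1]
    simp only [h2]
    by_cases hx : x ∈ B
    · simp only [Set.indicator_of_mem hx]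
      exact hx
    · simp only [Set.indicator_of_notMem hx]
      exact map_zero (N x))
  filter_upwards [ae_all_iff.2 h1, ae_all_iff.2 hf] with x h1 h2 hxA
  refine hsN x fun hx => ?_
  have hx' : x ∈ B := hx
  have h3 : s x = 0 := by
    ext i
    have := h1 i hxA
    rwa [h2, Set.indicator_of_mem hx'] at this
  have h4 := hs1 x
  rw [h3] at h4
  simp at h4

variable (S)

/-- `a` is the coordinate function of `z` on `E` with respect to the family `v`, that is,
`z = ∑ aᵢ vᵢ` on `E`. Since `a` need not be bounded, the equation is multiplied by a bounded
function `g` without zeros on `E`. -/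
def IsCoordinate (v : Fin n → 𝓜) (E : Set X) (z : 𝓜) (a : X → Fin n → ℝ) : Prop :=
  ∃ (g : Lp ℝ ∞ m) (c : Fin n → Lp ℝ ∞ m), (∀ᵐ x ∂m, x ∈ E → g x ≠ 0) ∧
    (∀ i, ∀ᵐ x ∂m, x ∈ E → c i x = g x * a x i) ∧
    ∀ᵐ x ∂m, x ∈ E → S.pnorm (S.smul g z - ∑ i, S.smul (c i) (v i)) x = 0

variable {S} {v : Fin n → 𝓜} {E : Set X}

theorem smul_smul_comm (f g : Lp ℝ ∞ m) (z : 𝓜) :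
    S.smul f (S.smul g z) = S.smul g (S.smul f z) := by
  rw [← S.mul_smul, ← S.mul_smul, linfMul_comm]

theorem pnorm_smul_eq_zero (f : Lp ℝ ∞ m) {z : 𝓜} (h : ∀ᵐ x ∂m, x ∈ E → S.pnorm z x = 0) :
    ∀ᵐ x ∂m, x ∈ E → S.pnorm (S.smul f z) x = 0 := by
  filter_upwards [h, S.pnorm_smul f z] with x h1 h2 hx
  rw [h2, h1 hx, mul_zero]

theorem pnorm_add_eq_zero {z z' : 𝓜} (h : ∀ᵐ x ∂m, x ∈ E → S.pnorm z x = 0)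
    (h' : ∀ᵐ x ∂m, x ∈ E → S.pnorm z' x = 0) :
    ∀ᵐ x ∂m, x ∈ E → S.pnorm (z + z') x = 0 := by
  filter_upwards [h, h', S.pnorm_add_le z z', S.pnorm_nonneg (z + z')] with x h1 h2 h3 h4 hx
  rw [h1 hx, h2 hx, add_zero] at h3
  exact le_antisymm h3 h4

theorem pnorm_neg_eq_zero {z : 𝓜} (h : ∀ᵐ x ∂m, x ∈ E → S.pnorm z x = 0) :
    ∀ᵐ x ∂m, x ∈ E → S.pnorm (-z) x = 0 := by
  filter_upwards [h, S.pnorm_neg z] with x h1 h2 hx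
  rw [h2, h1 hx]

theorem pnorm_eq_of_sub {z z' : 𝓜} (h : ∀ᵐ x ∂m, x ∈ E → S.pnorm (z - z') x = 0) :
    ∀ᵐ x ∂m, x ∈ E → S.pnorm z x = S.pnorm z' x := by
  filter_upwards [h, S.abs_pnorm_sub_le z z'] with x h1 h2 hx
  rw [h1 hx] at h2
  exact sub_eq_zero.1 (abs_nonpos_iff.1 h2)

theorem smul_sum_smul (f : Lp ℝ ∞ m) (c : Fin n → Lp ℝ ∞ m) (v : Fin n → 𝓜) :
    S.smul f (∑ i, S.smul (c i) (v i)) = ∑ i, S.smul (linfMul f (c i)) (v i) := by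
  rw [map_sum]
  exact Finset.sum_congr rfl fun i _ => (S.mul_smul _ _ _).symm

theorem IsCoordinate.ae_eq (hv : S.FamilyIndependentOn v E) {z : 𝓜} {a a' : X → Fin n → ℝ}
    (h : S.IsCoordinate v E z a) (h' : S.IsCoordinate v E z a') :
    ∀ᵐ x ∂m, x ∈ E → a x = a' x := by
  obtain ⟨g, c, hg, hc, hz⟩ := h
  obtain ⟨g', c', hg', hc', hz'⟩ := h'
  have key := hv (fun i => linfMul g' (c i) - linfMul g (c' i)) (by
    have e : ∑ i, S.smul (linfMul g' (c i) - linfMul g (c' i)) (v i) =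
        -S.smul g' (S.smul g z - ∑ i, S.smul (c i) (v i)) +
          S.smul g (S.smul g' z - ∑ i, S.smul (c' i) (v i)) := by
      simp only [map_sub, LinearMap.sub_apply, Finset.sum_sub_distrib]
      rw [← smul_sum_smul, ← smul_sum_smul, smul_smul_comm g' g z]
      abel
    rw [e]
    exact pnorm_add_eq_zero (pnorm_neg_eq_zero (pnorm_smul_eq_zero _ hz))
      (pnorm_smul_eq_zero _ hz'))
  filter_upwards [ae_all_iff.2 key, hg, hg', ae_all_iff.2 hc, ae_all_iff.2 hc',
    ae_all_iff.2 fun i => coeFn_linfMul g' (c i), ae_all_iff.2 fun i => coeFn_linfMul g (c' i),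
    ae_all_iff.2 fun i => Lp.coeFn_sub (linfMul g' (c i)) (linfMul g (c' i))]
    with x h1 h2 h3 h4 h5 h6 h7 h8 hx
  ext i
  have h9 := h1 i hx
  rw [h8, Pi.sub_apply, h6, h7, h4 i hx, h5 i hx] at h9
  have h10 : g x * g' x * (a x i - a' x i) = 0 := by linear_combination h9
  rcases mul_eq_zero.1 h10 with h11 | h11
  · exact absurd h11 (mul_ne_zero (h2 hx) (h3 hx))
  · linarith

theorem IsCoordinate.add {z z' : 𝓜} {a a' : X → Fin n → ℝ}
    (h : S.IsCoordinate v E z a) (h' : S.IsCoordinate v E z' a') :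
    S.IsCoordinate v E (z + z') (fun x => a x + a' x) := by
  obtain ⟨g, c, hg, hc, hz⟩ := h
  obtain ⟨g', c', hg', hc', hz'⟩ := h'
  refine ⟨linfMul g g', fun i => linfMul g' (c i) + linfMul g (c' i), ?_, fun i => ?_, ?_⟩
  · filter_upwards [hg, hg', coeFn_linfMul g g'] with x h1 h2 h3 hx
    rw [h3]
    exact mul_ne_zero (h1 hx) (h2 hx)
  · filter_upwards [hc i, hc' i, coeFn_linfMul g g', coeFn_linfMul g' (c i),
      coeFn_linfMul g (c' i), Lp.coeFn_add (linfMul g' (c i)) (linfMul g (c' i))]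
      with x h1 h2 h3 h4 h5 h6 hx
    rw [h6, Pi.add_apply, h4, h5, h3, h1 hx, h2 hx, Pi.add_apply]
    ring
  · have e : S.smul (linfMul g g') (z + z') -
        ∑ i, S.smul (linfMul g' (c i) + linfMul g (c' i)) (v i) =
        S.smul g' (S.smul g z - ∑ i, S.smul (c i) (v i)) +
          S.smul g (S.smul g' z' - ∑ i, S.smul (c' i) (v i)) := by
      simp only [map_sub, map_add, LinearMap.add_apply, Finset.sum_add_distrib]
      rw [← smul_sum_smul, ← smul_sum_smul, smul_smul_comm g' g z, S.mul_smul, S.mul_smul]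
      abel
    rw [e]
    exact pnorm_add_eq_zero (pnorm_smul_eq_zero _ hz) (pnorm_smul_eq_zero _ hz')

theorem IsCoordinate.smul (f : Lp ℝ ∞ m) {z : 𝓜} {a : X → Fin n → ℝ}
    (h : S.IsCoordinate v E z a) : S.IsCoordinate v E (S.smul f z) (fun x => f x • a x) := by
  obtain ⟨g, c, hg, hc, hz⟩ := h
  refine ⟨g, fun i => linfMul f (c i), hg, fun i => ?_, ?_⟩
  · filter_upwards [hc i, coeFn_linfMul f (c i)] with x h1 h2 hx
    rw [h2, h1 hx, Pi.smul_apply, smul_eq_mul]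
    ring
  · rw [← smul_sum_smul, smul_smul_comm g f z, ← map_sub]
    exact pnorm_smul_eq_zero _ hz

theorem IsCoordinate.congr {z : 𝓜} {a a' : X → Fin n → ℝ} (h : S.IsCoordinate v E z a)
    (haa' : ∀ᵐ x ∂m, x ∈ E → a x = a' x) : S.IsCoordinate v E z a' := by
  obtain ⟨g, c, hg, hc, hz⟩ := h
  refine ⟨g, c, hg, fun i => ?_, hz⟩
  filter_upwards [hc i, haa'] with x h1 h2 hx
  rw [h1 hx, h2 hx]

theorem IsCoordinate.const_smul (r : ℝ) {z : 𝓜} {a : X → Fin n → ℝ}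
    (h : S.IsCoordinate v E z a) : S.IsCoordinate v E (r • z) (fun x => r • a x) := by
  have h1 := h.smul (r • linfIndicator m Set.univ MeasurableSet.univ)
  rw [S.smul_const] at h1
  refine h1.congr ?_
  filter_upwards [Lp.coeFn_smul r (linfIndicator m Set.univ MeasurableSet.univ),
    coeFn_linfIndicator (m := m) MeasurableSet.univ] with x h2 h3 _
  rw [h2, Pi.smul_apply, h3]
  simp

theorem isCoordinate_sum (v : Fin n → 𝓜) (E : Set X) (c : Fin n → Lp ℝ ∞ m) :
    S.IsCoordinate v E (∑ i, S.smul (c i) (v i)) (fun x i => c i x) := by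
  refine ⟨linfIndicator m Set.univ MeasurableSet.univ, c, ?_, fun i => ?_, ?_⟩
  · filter_upwards [coeFn_linfIndicator (m := m) MeasurableSet.univ] with x h _
    rw [h]
    simp
  · filter_upwards [coeFn_linfIndicator (m := m) MeasurableSet.univ] with x h _
    rw [h]
    simp
  · rw [S.one_smul, sub_self]
    filter_upwards [S.pnorm_zero] with x h _ using h

theorem IsCoordinate.pnorm_eq {z : 𝓜} {a : X → Fin n → ℝ} (h : S.IsCoordinate v E z a)
    {N : X → Seminorm ℝ (Fin n → ℝ)}
    (hNv : ∀ f : Fin n → Lp ℝ ∞ m,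
      ∀ᵐ x ∂m, S.pnorm (∑ i, S.smul (f i) (v i)) x = N x fun i => f i x) :
    ∀ᵐ x ∂m, x ∈ E → S.pnorm z x = N x (a x) := by
  obtain ⟨g, c, hg, hc, hz⟩ := h
  filter_upwards [hg, ae_all_iff.2 hc, pnorm_eq_of_sub hz, hNv c, S.pnorm_smul g z]
    with x h1 h2 h3 h4 h5 hx
  have h6 : (fun i => c i x) = g x • a x := by
    ext i
    rw [h2 i hx, Pi.smul_apply, smul_eq_mul]
  have h7 := h3 hx
  rw [h5, h4, h6, map_smul_eq_mul, Real.norm_eq_abs] at h7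
  exact mul_left_cancel₀ (abs_ne_zero.2 (h1 hx)) h7

/-- If independent sets on subsets of `E` have at most `n` elements, then every element has
coordinates on `E` with respect to an independent family of length `n`: the seminorms of the
family `z, v₁, …, vₙ` have a nontrivial kernel almost everywhere on `E`, and a measurable choice
of a vector in this kernel gives the coordinates of `z`. -/
theorem FamilyIndependentOn.exists_isCoordinate (hE : MeasurableSet E)
    (hv : S.FamilyIndependentOn v E)
    (hmax : ∀ A, MeasurableSet A → A ⊆ E → m A ≠ 0 →
      ∀ V : Set 𝓜, S.IsMaximalIndependentOn V A → V.encard = n) (z : 𝓜) :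
    ∃ a : X → Fin n → ℝ, Measurable a ∧ S.IsCoordinate v E z a := by
  obtain ⟨N, hN, hNu⟩ := S.exists_seminormField (Fin.cons z v : Fin (n + 1) → 𝓜)
  obtain ⟨s, hs, hs1, hsN⟩ := exists_measurable_unit_argmin hN
  have hsi : ∀ i, Measurable fun x => s x i := fun i => (measurable_pi_apply i).comp hs
  have hsb : ∀ i x, |s x i| ≤ 1 := fun i x => by
    rw [← hs1 x]
    exact norm_le_pi_norm (s x) i
  have hNs : Measurable fun x => N x (s x) := measurable_seminormField_apply hN hs
  -- the seminorms are nowhere norms on `E`, since otherwise the `n + 1` elements are independent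
  have hker : ∀ᵐ x ∂m, x ∈ E → N x (s x) = 0 := by
    set A : Set X := E ∩ {x | N x (s x) = 0}ᶜ with hA
    have hAm : MeasurableSet A :=
      hE.inter (measurableSet_eq_fun hNs measurable_const).compl
    by_contra hnot
    have hA0 : m A ≠ 0 := by
      intro h0
      refine hnot ?_
      filter_upwards [measure_eq_zero_iff_ae_notMem.1 h0] with x hx hxE
      by_contra hne
      exact hx ⟨hxE, hne⟩
    set χ := linfIndicator m A hAm with hχ
    have hu : S.FamilyIndependentOn
        (fun j => S.smul χ ((Fin.cons z v : Fin (n + 1) → 𝓜) j)) A := by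
      intro f hf i
      have e : ∑ j, S.smul (f j) (S.smul χ ((Fin.cons z v : Fin (n + 1) → 𝓜) j)) =
          ∑ j, S.smul (linfMul (f j) χ) ((Fin.cons z v : Fin (n + 1) → 𝓜) j) :=
        Finset.sum_congr rfl fun j _ => (S.mul_smul _ _ _).symm
      rw [e] at hf
      filter_upwards [hf, hNu fun j => linfMul (f j) χ,
        ae_all_iff.2 fun j => coeFn_linfMul (f j) χ, coeFn_linfIndicator (m := m) hAm]
        with x h1 h2 h3 h4 hx
      rw [h1 hx] at h2
      have h5 : (fun j => linfMul (f j) χ x) = fun j => f j x := by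
        ext j
        rw [h3, hχ, h4]
        simp [hx]
      rw [h5] at h2
      exact congrFun (hsN x hx.2 _ h2.symm) i
    have hinj := hu.injective hA0
    obtain ⟨V, hWV, hV⟩ := (hu.independentOn hinj).exists_isMaximalIndependentOn (by
      rintro _ ⟨j, rfl⟩
      filter_upwards [S.pnorm_indicator hAm ((Fin.cons z v : Fin (n + 1) → 𝓜) j)] with x h hx
      rw [h, Set.indicator_of_notMem hx])
    have h1 := Set.encard_le_encard hWV
    rw [hmax A hAm Set.inter_subset_left hA0 V hV, ← Set.image_univ, hinj.encard_image,
      Set.encard_univ, ENat.card_eq_coe_fintype_card, Fintype.card_fin] at h1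
    have h2 : n + 1 ≤ n := by exact_mod_cast h1
    omega
  -- the coefficient of `z` in the kernel vector does not vanish, since `v` is independent
  have hne : ∀ᵐ x ∂m, x ∈ E → s x 0 ≠ 0 := by
    set B : Set X := {x | s x 0 = 0} with hB
    have hBm : MeasurableSet B := measurableSet_eq_fun (hsi 0) measurable_const
    choose f hf using fun j => exists_linf_ae_eq m ((hsi j).indicator hBm) (C := 1) (fun x => by
      by_cases hx : x ∈ B
      · rw [Set.indicator_of_mem hx]
        exact hsb j x
      · simp [hx])
    have hf0 : f 0 = 0 := by
      apply Lp.ext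
      filter_upwards [hf 0, Lp.coeFn_zero ℝ ∞ m] with x h1 h2
      rw [h1, h2]
      by_cases hx : x ∈ B
      · rw [Set.indicator_of_mem hx]
        exact hx
      · rw [Set.indicator_of_notMem hx]
        rfl
    have h1 := hv (fun i => f i.succ) (by
      filter_upwards [hNu f, ae_all_iff.2 hf, hker] with x h1 h2 h3 hx
      rw [Fin.sum_univ_succ, hf0, map_zero, LinearMap.zero_apply, zero_add] at h1
      simp only [Fin.cons_succ] at h1
      rw [h1]
      simp only [h2]
      by_cases hxB : x ∈ B
      · simp only [Set.indicator_of_mem hxB]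
        exact h3 hx
      · simp only [Set.indicator_of_notMem hxB]
        exact map_zero (N x))
    filter_upwards [ae_all_iff.2 h1, ae_all_iff.2 hf] with x h1 h2 hx h0
    have hxB : x ∈ B := h0
    have h3 : s x = 0 := by
      ext j
      refine Fin.cases h0 (fun i => ?_) j
      have := h1 i hx
      rwa [h2, Set.indicator_of_mem hxB] at this
    have h4 := hs1 x
    rw [h3] at h4
    simp at h4
  choose f hf using fun j => exists_linf_ae_eq m (hsi j) (hsb j)
  refine ⟨fun x i => -s x i.succ / s x 0,
    measurable_pi_lambda _ fun i => (hsi i.succ).neg.div (hsi 0),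
    f 0, fun i => -f i.succ, ?_, fun i => ?_, ?_⟩
  · filter_upwards [hf 0, hne] with x h1 h2 hx
    rw [h1]
    exact h2 hx
  · filter_upwards [hf 0, hf i.succ, hne, Lp.coeFn_neg (f i.succ)] with x h1 h2 h3 h4 hx
    rw [h4, Pi.neg_apply, h2, h1, mul_div_cancel₀ _ (h3 hx)]
  · filter_upwards [hNu f, ae_all_iff.2 hf, hker] with x h1 h2 h3 hx
    rw [Fin.sum_univ_succ] at h1
    simp only [Fin.cons_zero, Fin.cons_succ] at h1
    simp only [map_neg, LinearMap.neg_apply, Finset.sum_neg_distrib, sub_neg_eq_add]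
    rw [h1]
    simp only [h2]
    exact h3 hx

/-- On `E n` there is a local basis of `n` elements. -/
theorem IsDimensionalDecomposition.exists_basis {E : ℕ → Set X}
    (hE : S.IsDimensionalDecomposition E) (n : ℕ) :
    ∃ v : Fin n → 𝓜, S.FamilyIndependentOn v (E n) ∧
      ∀ z, ∃ a : X → Fin n → ℝ, Measurable a ∧ S.IsCoordinate v (E n) z a := by
  by_cases h0 : m (E n) = 0
  · have hae : ∀ᵐ x ∂m, x ∉ E n := measure_eq_zero_iff_ae_notMem.1 h0
    refine ⟨0, fun f _ i => ?_, fun z => ⟨0, measurable_const, 0, 0, ?_, fun i => ?_, ?_⟩⟩ <;>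
    filter_upwards [hae] with x hx hx' using absurd hx' hx
  · obtain ⟨V, -, hV⟩ := IndependentOn.exists_isMaximalIndependentOn (S := S) (W := ∅) (A := E n)
      (by simp) (fun t f ht _ v hv => absurd (ht hv) (Set.notMem_empty v))
    have hcard := hE.encard_eq n (E n) (hE.measurableSet n) subset_rfl h0 V hV
    have hfin : V.Finite := Set.finite_of_encard_eq_coe hcard
    have hfin' : Finite V := hfin
    have hcard' : Nat.card V = n := by
      have h1 := hcard
      rw [Set.encard, ENat.card_eq_coe_natCard] at h1
      exact_mod_cast h1
    obtain ⟨e⟩ : Nonempty (Fin n ≃ V) :=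
      ⟨(Finite.equivFinOfCardEq hcard').symm⟩
    have hinj : Function.Injective fun i => (e i : 𝓜) :=
      Subtype.val_injective.comp e.injective
    have hrange : Set.range (fun i => (e i : 𝓜)) = V := by
      ext u
      constructor
      · rintro ⟨i, rfl⟩
        exact (e i).2
      · intro hu
        exact ⟨e.symm ⟨u, hu⟩, by simp⟩
    have hind : S.FamilyIndependentOn (fun i => (e i : 𝓜)) (E n) :=
      IndependentOn.familyIndependentOn hinj (by rw [hrange]; exact hV.prop.2)
    exact ⟨_, hind, fun z => hind.exists_isCoordinate (hE.measurableSet n)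
      (fun A hA hAE hA0 V hV => hE.encard_eq n A hA hAE hA0 V hV) z⟩

end LpNormedModule

end Module

/-! ### `L^p`-norms on a countable partition -/

section Partition

variable {X : Type u} [MeasurableSpace X] {p : ℝ≥0∞} [Fact (1 ≤ p)] {m : Measure X}
  {E : ℕ → Set X}

theorem ae_exists_mem_of_null_compl (hE0 : m (⋃ n, E n)ᶜ = 0) : ∀ᵐ x ∂m, ∃ n, x ∈ E n := by
  filter_upwards [measure_eq_zero_iff_ae_notMem.1 hE0] with x hx
  simpa using hx

theorem ae_of_forall_ae_mem (hE0 : m (⋃ n, E n)ᶜ = 0) {P : X → Prop}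
    (h : ∀ n, ∀ᵐ x ∂m, x ∈ E n → P x) : ∀ᵐ x ∂m, P x := by
  filter_upwards [ae_exists_mem_of_null_compl hE0, ae_all_iff.2 h] with x ⟨n, hn⟩ h1 using h1 n hn

theorem fact_ne_zero : p ≠ 0 := (zero_lt_one.trans_le (Fact.out : 1 ≤ p)).ne'

theorem eLpNorm_rpow_eq_lintegral (hp : p ≠ ∞) (h : X → ℝ) (μ : Measure X) :
    eLpNorm h p μ ^ p.toReal = ∫⁻ x, ‖h x‖ₑ ^ p.toReal ∂μ := by
  rw [eLpNorm_eq_lintegral_rpow_enorm_toReal fact_ne_zero hp, ← ENNReal.rpow_mul,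
    one_div_mul_cancel (ENNReal.toReal_pos fact_ne_zero hp).ne', ENNReal.rpow_one]

theorem eLpNorm_rpow_eq_tsum (hEm : ∀ n, MeasurableSet (E n))
    (hEd : Pairwise fun i j => Disjoint (E i) (E j)) (hE0 : m (⋃ n, E n)ᶜ = 0) (hp : p ≠ ∞)
    (h : X → ℝ) :
    eLpNorm h p m ^ p.toReal = ∑' n, eLpNorm h p (m.restrict (E n)) ^ p.toReal := by
  simp_rw [eLpNorm_rpow_eq_lintegral hp]
  rw [← lintegral_iUnion hEm hEd, Measure.restrict_eq_self_of_ae_mem]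
  filter_upwards [ae_exists_mem_of_null_compl hE0] with x hx using Set.mem_iUnion.2 hx

theorem eLpNorm_top_eq_iSup (hEm : ∀ n, MeasurableSet (E n)) (hE0 : m (⋃ n, E n)ᶜ = 0)
    (h : X → ℝ) : eLpNorm h ∞ m = ⨆ n, eLpNorm h ∞ (m.restrict (E n)) := by
  refine le_antisymm ?_ (iSup_le fun n => eLpNorm_mono_measure h Measure.restrict_le_self)
  rw [eLpNorm_exponent_top]
  refine essSup_le_of_ae_le _ (ae_of_forall_ae_mem hE0 fun n => ?_)
  rw [← ae_restrict_iff' (hEm n)]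
  filter_upwards [ae_le_eLpNormEssSup (f := h) (μ := m.restrict (E n))] with x hx
  refine hx.trans ?_
  rw [← eLpNorm_exponent_top]
  exact le_iSup (fun n => eLpNorm h ∞ (m.restrict (E n))) n

variable {G : ℕ → Type*} [∀ n, NormedAddCommGroup (G n)]

theorem memℓp_iff_eLpNorm_lt_top (hEm : ∀ n, MeasurableSet (E n))
    (hEd : Pairwise fun i j => Disjoint (E i) (E j)) (hE0 : m (⋃ n, E n)ᶜ = 0) {h : X → ℝ}
    {b : ∀ n, G n} (hb : ∀ n, ‖b n‖ₑ = eLpNorm h p (m.restrict (E n))) :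
    Memℓp b p ↔ eLpNorm h p m < ∞ := by
  by_cases hp : p = ∞
  · subst hp
    rw [memℓp_infty_iff, eLpNorm_top_eq_iSup hEm hE0]
    simp_rw [← hb]
    constructor
    · rintro ⟨C, hC⟩
      refine (iSup_le fun n => ?_).trans_lt (ENNReal.ofReal_lt_top (r := C))
      rw [← ofReal_norm]
      exact ENNReal.ofReal_le_ofReal (hC ⟨n, rfl⟩)
    · intro hlt
      refine ⟨(⨆ n, ‖b n‖ₑ).toReal, ?_⟩
      rintro _ ⟨n, rfl⟩
      change ‖b n‖ ≤ _
      rw [← toReal_enorm]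
      exact ENNReal.toReal_mono hlt.ne (le_iSup (fun n => ‖b n‖ₑ) n)
  · have hp0 : 0 < p.toReal := ENNReal.toReal_pos fact_ne_zero hp
    have h1 : eLpNorm h p m < ∞ ↔ ∑' n, ENNReal.ofReal (‖b n‖ ^ p.toReal) ≠ ∞ := by
      rw [lt_top_iff_ne_top, not_iff_not, ← ENNReal.rpow_eq_top_iff_of_pos hp0,
        eLpNorm_rpow_eq_tsum hEm hEd hE0 hp]
      simp_rw [← hb, ← ofReal_norm, ENNReal.ofReal_rpow_of_nonneg (norm_nonneg _) hp0.le]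
    rw [memℓp_gen_iff hp0, h1]
    constructor
    · exact fun hs => hs.tsum_ofReal_ne_top
    · intro hs
      have h2 := ENNReal.summable_toReal hs
      refine h2.congr fun n => ?_
      rw [ENNReal.toReal_ofReal (by positivity)]

theorem enorm_lp_eq_eLpNorm (hEm : ∀ n, MeasurableSet (E n))
    (hEd : Pairwise fun i j => Disjoint (E i) (E j)) (hE0 : m (⋃ n, E n)ᶜ = 0) {h : X → ℝ}
    (b : lp G p) (hb : ∀ n, ‖b n‖ₑ = eLpNorm h p (m.restrict (E n))) :
    ‖b‖ₑ = eLpNorm h p m := by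
  by_cases hp : p = ∞
  · subst hp
    rw [eLpNorm_top_eq_iSup hEm hE0]
    simp_rw [← hb]
    refine le_antisymm ?_ (iSup_le fun n => ?_)
    · have hlt : ⨆ n, ‖b n‖ₑ < ∞ := by
        have h1 := (memℓp_iff_eLpNorm_lt_top hEm hEd hE0 hb).1 (lp.memℓp b)
        rw [eLpNorm_top_eq_iSup hEm hE0] at h1
        simpa only [← hb] using h1
      rw [← ofReal_norm]
      refine ENNReal.ofReal_le_of_le_toReal ((lp.isLUB_norm b).2 ?_)
      rintro _ ⟨n, rfl⟩
      change ‖b n‖ ≤ _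
      rw [← toReal_enorm]
      exact ENNReal.toReal_mono hlt.ne (le_iSup (fun n => ‖b n‖ₑ) n)
    · rw [← ofReal_norm, ← ofReal_norm]
      exact ENNReal.ofReal_le_ofReal (lp.norm_apply_le_norm ENNReal.top_ne_zero b n)
  · have hp0 : 0 < p.toReal := ENNReal.toReal_pos fact_ne_zero hp
    have h1 : ‖b‖ₑ ^ p.toReal = eLpNorm h p m ^ p.toReal := by
      rw [eLpNorm_rpow_eq_tsum hEm hEd hE0 hp, ← ofReal_norm,
        ENNReal.ofReal_rpow_of_nonneg (norm_nonneg _) hp0.le, lp.norm_rpow_eq_tsum hp0,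
        ENNReal.ofReal_tsum_of_nonneg (fun n => by positivity) ((lp.memℓp b).summable hp0)]
      simp_rw [← hb, ← ofReal_norm, ENNReal.ofReal_rpow_of_nonneg (norm_nonneg _) hp0.le]
    have h2 := congrArg (fun t => t ^ p.toReal⁻¹) h1
    simpa only [ENNReal.rpow_rpow_inv hp0.ne'] using h2

end Partition

/-! ### Global coordinates -/

section Module

variable {X : Type u} [MeasurableSpace X] {p : ℝ≥0∞} [Fact (1 ≤ p)] {m : Measure X}
  {𝓜 : Type w} [NormedAddCommGroup 𝓜] [NormedSpace ℝ 𝓜] [CompleteSpace 𝓜]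

/-- A measurable field of seminorms which is a norm almost everywhere on `E` agrees almost
everywhere on `E` with a measurable field of norms. -/
theorem exists_normField_ae_eq {n : ℕ} {E : Set X} (hE : MeasurableSet E)
    {N : X → Seminorm ℝ (Fin n → ℝ)} (hN : ∀ a, Measurable fun x => N x a)
    (h : ∀ᵐ x ∂m, x ∈ E → ∀ a, N x a = 0 → a = 0) :
    ∃ F : NormField X n, ∀ᵐ x ∂m, x ∈ E → F.normAt x = N x := by
  classical
  obtain ⟨G, hGm, hG, hGN⟩ := h.exists_measurable_mem
  have hEG : MeasurableSet (E ∩ G) := hE.inter hG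
  refine ⟨{
    normAt := fun x => if x ∈ E ∩ G then N x else normSeminorm ℝ (Fin n → ℝ)
    eq_zero := fun x a ha => ?_
    measurable := fun a => ?_ }, ?_⟩
  · by_cases hx : x ∈ E ∩ G
    · rw [if_pos hx] at ha
      exact hGN x hx.2 hx.1 a ha
    · rw [if_neg hx] at ha
      exact norm_eq_zero.1 ha
  · have he : (fun x => (if x ∈ E ∩ G then N x else normSeminorm ℝ (Fin n → ℝ)) a) =
        fun x => if x ∈ E ∩ G then N x a else ‖a‖ := by
      ext x
      split_ifs <;> rfl
    rw [he]
    exact Measurable.ite hEG (hN a) measurable_const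
  · filter_upwards [hGm] with x hx hxE
    exact if_pos ⟨hxE, hx⟩

namespace LpNormedModule

variable {S : LpNormedModule p m 𝓜} {E : ℕ → Set X}

/-- A system of coordinate functions `τ z n : X → ℝⁿ` on the sets `E n`, for all elements `z`,
which is compatible with the module structure and turns the pointwise norm into a field of
norms. -/
structure IsCoordinateSystem (S : LpNormedModule p m 𝓜) (E : ℕ → Set X)
    (F : ∀ n, NormField X n) (τ : 𝓜 → ∀ n, X → Fin n → ℝ) : Prop where
  measurable : ∀ z n, Measurable (τ z n)
  add : ∀ z z' n, ∀ᵐ x ∂m, x ∈ E n → τ (z + z') n x = τ z n x + τ z' n x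
  const_smul : ∀ (r : ℝ) z n, ∀ᵐ x ∂m, x ∈ E n → τ (r • z) n x = r • τ z n x
  smul : ∀ (f : Lp ℝ ∞ m) z n, ∀ᵐ x ∂m, x ∈ E n → τ (S.smul f z) n x = f x • τ z n x
  pnorm : ∀ z n, ∀ᵐ x ∂m, x ∈ E n → S.pnorm z x = (F n).normAt x (τ z n x)

theorem IsDimensionalDecomposition.exists_isCoordinateSystem
    (hE : S.IsDimensionalDecomposition E) :
    ∃ (F : ∀ n, NormField X n) (τ : 𝓜 → ∀ n, X → Fin n → ℝ), IsCoordinateSystem S E F τ ∧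
      ∀ n (c : Fin n → Lp ℝ ∞ m), ∃ z, ∀ᵐ x ∂m, x ∈ E n → τ z n x = fun i => c i x := by
  choose v hv hcoord using hE.exists_basis
  choose τ hτm hτ using hcoord
  have hF : ∀ n, ∃ F : NormField X n,
      ∀ z, ∀ᵐ x ∂m, x ∈ E n → S.pnorm z x = F.normAt x (τ n z x) := by
    intro n
    obtain ⟨N, hN, hNv⟩ := S.exists_seminormField (v n)
    obtain ⟨F, hF⟩ := exists_normField_ae_eq (hE.measurableSet n) hN ((hv n).ae_norm hN hNv)
    refine ⟨F, fun z => ?_⟩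
    filter_upwards [hF, (hτ n z).pnorm_eq hNv] with x h1 h2 hx
    rw [h1 hx, h2 hx]
  choose F hF using hF
  exact ⟨F, fun z n => τ n z,
    { measurable := fun z n => hτm n z
      add := fun z z' n => (hτ n _).ae_eq (hv n) ((hτ n z).add (hτ n z'))
      const_smul := fun r z n => (hτ n _).ae_eq (hv n) ((hτ n z).const_smul r)
      smul := fun f z n => (hτ n _).ae_eq (hv n) ((hτ n z).smul f)
      pnorm := fun z n => hF n z },
    fun n c => ⟨_, (hτ n _).ae_eq (hv n) (isCoordinate_sum (v n) (E n) c)⟩⟩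

end LpNormedModule

end Module

/-! ### The representation as a space of vector fields -/

section VecLpElements

variable {X : Type u} [MeasurableSpace X] {p : ℝ≥0∞} {μ : Measure X} {n : ℕ} {F : NormField X n}

theorem VecLp.ext_ae {a b : VecLp p μ F} (h : ∀ᵐ x ∂μ, a x = b x) : a = b :=
  Subtype.ext (AEEqFun.ext h)

theorem VecLp.coeFn_add (a b : VecLp p μ F) : ∀ᵐ x ∂μ, (a + b) x = a x + b x := by
  filter_upwards [AEEqFun.coeFn_add (VecLp.toAEEqFun a) (VecLp.toAEEqFun b)] with x hx
  rw [map_add, hx]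
  rfl

theorem VecLp.coeFn_smul (c : ℝ) (a : VecLp p μ F) : ∀ᵐ x ∂μ, (c • a) x = c • a x := by
  filter_upwards [AEEqFun.coeFn_smul c (VecLp.toAEEqFun a)] with x hx
  rw [map_smul, hx]
  rfl

theorem VecLp.measurable_coe (a : VecLp p μ F) : Measurable (a : X → Fin n → ℝ) :=
  (AEEqFun.stronglyMeasurable _).measurable

theorem VecLp.enorm_eq [Fact (1 ≤ p)] (a : VecLp p μ F) : ‖a‖ₑ = eLpNorm a.pnorm p μ := by
  rw [← ofReal_norm, VecLp.norm_def, ENNReal.ofReal_toReal a.memLp_pnorm.eLpNorm_ne_top]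

theorem NormField.measurable_apply (F : NormField X n) {a : X → Fin n → ℝ} (ha : Measurable a) :
    Measurable fun x => F.normAt x (a x) :=
  measurable_seminormField_apply F.measurable ha

/-- The element of `L^p(μ, ℝⁿ, |·|)` given by a measurable function. -/
noncomputable def VecLp.mk (a : X → Fin n → ℝ) (ha : Measurable a)
    (h : MemLp (fun x => F.normAt x (a x)) p μ) : VecLp p μ F :=
  ⟨AEEqFun.mk a ha.aestronglyMeasurable, by
    refine (memLp_congr_ae ?_).2 h
    filter_upwards [AEEqFun.coeFn_mk a ha.aestronglyMeasurable] with x hx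
    rw [hx]⟩

theorem VecLp.coeFn_mk (a : X → Fin n → ℝ) (ha : Measurable a)
    (h : MemLp (fun x => F.normAt x (a x)) p μ) : ∀ᵐ x ∂μ, VecLp.mk a ha h x = a x :=
  AEEqFun.coeFn_mk a ha.aestronglyMeasurable

end VecLpElements

section Module

variable {X : Type u} [MeasurableSpace X] {p : ℝ≥0∞} [Fact (1 ≤ p)] {m : Measure X}
  {𝓜 : Type w} [NormedAddCommGroup 𝓜] [NormedSpace ℝ 𝓜] [CompleteSpace 𝓜]

namespace LpNormedModule

variable {S : LpNormedModule p m 𝓜} {E : ℕ → Set X} {F : ∀ n, NormField X n}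
  {τ : 𝓜 → ∀ n, X → Fin n → ℝ}

theorem smul_linfIndicator_empty (v : 𝓜) {A : Set X} (hA : MeasurableSet A) (h : A = ∅) :
    S.smul (linfIndicator m A hA) v = 0 := by
  apply S.eq_zero_of_pnorm
  filter_upwards [S.pnorm_indicator hA v] with x hx
  rw [hx, h, Set.indicator_empty]

/-- Glueing along disjoint sets, in terms of a common majorant in `L^p` of the pointwise norms. -/
theorem exists_glue_disjoint {A : ℕ → Set X} (hA : ∀ j, MeasurableSet (A j))
    (hd : Pairwise fun i j => Disjoint (A i) (A j)) (v : ℕ → 𝓜) {h : X → ℝ}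
    (hh : eLpNorm h p m < ∞) (hv : ∀ j, ∀ᵐ x ∂m, x ∈ A j → S.pnorm (v j) x ≤ h x) :
    ∃ z, ∀ j, S.smul (linfIndicator m (A j) (hA j)) z =
      S.smul (linfIndicator m (A j) (hA j)) (v j) := by
  obtain ⟨z, hz, -⟩ := S.glueing v A hA (fun i j => by
    by_cases hij : i = j
    · subst hij
      rfl
    · rw [smul_linfIndicator_empty _ _ (Set.disjoint_iff_inter_eq_empty.1 (hd hij)),
        smul_linfIndicator_empty _ _ (Set.disjoint_iff_inter_eq_empty.1 (hd hij))]) (by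
    refine lt_of_le_of_lt (limsup_le_of_le (by isBoundedDefault)
      (Eventually.of_forall fun n => ?_)) hh
    rw [S.enorm_eq_eLpNorm]
    refine eLpNorm_mono_ae ?_
    filter_upwards [S.pnorm_sum_le (Finset.range n)
        fun i => S.smul (linfIndicator m (A i) (hA i)) (v i),
      ae_all_iff.2 fun j => S.pnorm_indicator (hA j) (v j), ae_all_iff.2 hv,
      S.pnorm_nonneg (∑ i ∈ Finset.range n, S.smul (linfIndicator m (A i) (hA i)) (v i))]
      with x h1 h2 h3 h4
    rw [Real.norm_of_nonneg h4]
    refine h1.trans ?_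
    calc ∑ j ∈ Finset.range n, S.pnorm (S.smul (linfIndicator m (A j) (hA j)) (v j)) x
        ≤ ∑ j ∈ Finset.range n, (A j).indicator (fun x => ‖h x‖) x := by
          refine Finset.sum_le_sum fun j _ => ?_
          rw [h2]
          by_cases hx : x ∈ A j
          · rw [Set.indicator_of_mem hx, Set.indicator_of_mem hx]
            exact (h3 j hx).trans (Real.le_norm_self _)
          · rw [Set.indicator_of_notMem hx, Set.indicator_of_notMem hx]
      _ = (⋃ j ∈ Finset.range n, A j).indicator (fun x => ‖h x‖) x :=
          (Finset.indicator_biUnion_apply _ _ (fun i _ j _ hij => hd hij) x).symm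
      _ ≤ ‖h x‖ := Set.indicator_le_self' (fun _ _ => norm_nonneg _) x)
  exact ⟨z, hz⟩

namespace IsCoordinateSystem

variable (hτ : IsCoordinateSystem S E F τ) (hEm : ∀ n, MeasurableSet (E n))

include hτ hEm

theorem pnorm_restrict (z : 𝓜) (n : ℕ) :
    S.pnorm z =ᵐ[m.restrict (E n)] fun x => (F n).normAt x (τ z n x) :=
  (ae_restrict_iff' (hEm n)).2 (hτ.pnorm z n)

theorem memLp (z : 𝓜) (n : ℕ) :
    MemLp (fun x => (F n).normAt x (τ z n x)) p (m.restrict (E n)) :=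
  (memLp_congr_ae (hτ.pnorm_restrict hEm z n)).1
    ((Lp.memLp (S.pnorm z)).mono_measure Measure.restrict_le_self)

/-- The component on `E n` of the representation. -/
noncomputable def component (z : 𝓜) (n : ℕ) : VecLp p (m.restrict (E n)) (F n) :=
  VecLp.mk (τ z n) (hτ.measurable z n) (hτ.memLp hEm z n)

theorem coeFn_component (z : 𝓜) (n : ℕ) :
    ∀ᵐ x ∂m.restrict (E n), hτ.component hEm z n x = τ z n x :=
  VecLp.coeFn_mk _ _ _

theorem pnorm_component (z : 𝓜) (n : ℕ) :
    ∀ᵐ x ∂m.restrict (E n), S.pnorm z x = (hτ.component hEm z n).pnorm x := by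
  filter_upwards [hτ.pnorm_restrict hEm z n, hτ.coeFn_component hEm z n] with x h1 h2
  rw [h1, VecLp.pnorm, h2]

theorem enorm_component (z : 𝓜) (n : ℕ) :
    ‖hτ.component hEm z n‖ₑ = eLpNorm (S.pnorm z) p (m.restrict (E n)) := by
  rw [VecLp.enorm_eq]
  exact eLpNorm_congr_ae (EventuallyEq.symm (hτ.pnorm_component hEm z n))

theorem component_add (z z' : 𝓜) (n : ℕ) :
    hτ.component hEm (z + z') n = hτ.component hEm z n + hτ.component hEm z' n := by
  apply VecLp.ext_ae
  filter_upwards [VecLp.coeFn_add (hτ.component hEm z n) (hτ.component hEm z' n),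
    hτ.coeFn_component hEm (z + z') n, hτ.coeFn_component hEm z n, hτ.coeFn_component hEm z' n,
    (ae_restrict_iff' (hEm n)).2 (hτ.add z z' n)] with x h1 h2 h3 h4 h5
  rw [h1, h2, h3, h4, h5]

theorem component_smul (c : ℝ) (z : 𝓜) (n : ℕ) :
    hτ.component hEm (c • z) n = c • hτ.component hEm z n := by
  apply VecLp.ext_ae
  filter_upwards [VecLp.coeFn_smul c (hτ.component hEm z n),
    hτ.coeFn_component hEm (c • z) n, hτ.coeFn_component hEm z n,
    (ae_restrict_iff' (hEm n)).2 (hτ.const_smul c z n)] with x h1 h2 h3 h5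
  rw [h1, h2, h3, h5]

variable (hEd : Pairwise fun i j => Disjoint (E i) (E j)) (hE0 : m (⋃ n, E n)ᶜ = 0)

/-- The representation, as a linear isometry into the `L^p`-product. -/
noncomputable def toProduct : 𝓜 →ₗᵢ[ℝ] VecLpProduct p m E F where
  toFun z := ⟨fun n => hτ.component hEm z n,
    (memℓp_iff_eLpNorm_lt_top hEm hEd hE0 fun n => hτ.enorm_component hEm z n).2
      (Lp.eLpNorm_lt_top _)⟩
  map_add' z z' := by
    apply lp.ext
    funext n
    exact hτ.component_add hEm z z' n
  map_smul' c z := by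
    apply lp.ext
    funext n
    exact hτ.component_smul hEm c z n
  norm_map' z := by
    have h := enorm_lp_eq_eLpNorm hEm hEd hE0 (p := p)
      (⟨fun n => hτ.component hEm z n,
        (memℓp_iff_eLpNorm_lt_top hEm hEd hE0 fun n => hτ.enorm_component hEm z n).2
        (Lp.eLpNorm_lt_top _)⟩ : VecLpProduct p m E F) fun n => hτ.enorm_component hEm z n
    have h' := congrArg ENNReal.toReal (h.trans (S.enorm_eq_eLpNorm z).symm)
    rw [toReal_enorm, toReal_enorm] at h'
    exact h'

theorem toProduct_apply (z : 𝓜) (n : ℕ) :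
    hτ.toProduct hEm hEd hE0 z n = hτ.component hEm z n := rfl

include hEd in
/-- Every measurable field of vectors with pointwise norm in `L^p` is the coordinate function of
an element: where the field takes values of norm in `[k, k + 1)` its coordinates are bounded, and
the elements obtained there are glued. -/
theorem exists_coordinates_eq
    (hex : ∀ n (c : Fin n → Lp ℝ ∞ m), ∃ z, ∀ᵐ x ∂m, x ∈ E n → τ z n x = fun i => c i x)
    {a : ∀ n, X → Fin n → ℝ} (ha : ∀ n, Measurable (a n)) {h : X → ℝ}
    (hh : eLpNorm h p m < ∞)
    (hle : ∀ n, ∀ᵐ x ∂m, x ∈ E n → (F n).normAt x (a n x) ≤ h x) :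
    ∃ z, ∀ n, ∀ᵐ x ∂m, x ∈ E n → τ z n x = a n x := by
  set B : ℕ × ℕ → Set X := fun k => E k.1 ∩ {x | ⌊‖a k.1 x‖⌋₊ = k.2} with hB
  have hBm : ∀ k, MeasurableSet (B k) := fun k =>
    (hEm k.1).inter (measurableSet_eq_fun (ha k.1).norm.nat_floor measurable_const)
  have hBd : ∀ k l, k ≠ l → Disjoint (B k) (B l) := by
    intro k l hkl
    refine Set.disjoint_left.2 fun x hx hx' => hkl ?_
    have h1 : k.1 = l.1 := by
      by_contra hne
      exact Set.disjoint_left.1 (hEd hne) hx.1 hx'.1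
    have h2 : ⌊‖a k.1 x‖⌋₊ = k.2 := hx.2
    have h3 : ⌊‖a l.1 x‖⌋₊ = l.2 := hx'.2
    exact Prod.ext h1 (by rw [← h2, ← h3, h1])
  have hc : ∀ k i, ∃ c : Lp ℝ ∞ m, c =ᵐ[m] (B k).indicator fun x => a k.1 x i := by
    intro k i
    refine exists_linf_ae_eq m (((measurable_pi_apply i).comp (ha k.1)).indicator (hBm k))
      (C := k.2 + 1) fun x => ?_
    by_cases hx : x ∈ B k
    · rw [Set.indicator_of_mem hx]
      have h2 : ⌊‖a k.1 x‖⌋₊ = k.2 := hx.2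
      refine (norm_le_pi_norm (a k.1 x) i).trans ?_
      rw [← h2]
      exact (Nat.lt_floor_add_one _).le
    · rw [Set.indicator_of_notMem hx, abs_zero]
      positivity
  choose c hc using hc
  choose v hv using fun k => hex k.1 (c k)
  have hvB : ∀ k, ∀ᵐ x ∂m, x ∈ B k → τ (v k) k.1 x = a k.1 x := fun k => by
    filter_upwards [hv k, ae_all_iff.2 (hc k)] with x h1 h2 hx
    rw [h1 hx.1]
    ext i
    rw [h2, Set.indicator_of_mem hx]
  obtain ⟨z, hz⟩ := exists_glue_disjoint (S := S) (A := fun j => B j.unpair) (fun j => hBm _)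
    (fun i j hij => hBd _ _ fun h => hij (Nat.pairEquiv.symm.injective h)) (fun j => v j.unpair)
    hh (fun j => by
      filter_upwards [hvB j.unpair, hτ.pnorm (v j.unpair) j.unpair.1, hle j.unpair.1]
        with x h1 h2 h3 hx
      rw [h2 hx.1, h1 hx]
      exact h3 hx.1)
  refine ⟨z, fun n => ?_⟩
  have key : ∀ k : ℕ, ∀ᵐ x ∂m, x ∈ B (n, k) → τ z n x = a n x := by
    intro k
    have hz' := hz (Nat.pair n k)
    simp only [Nat.unpair_pair] at hz'
    have h1 := hτ.smul (linfIndicator m (B (n, k)) (hBm _)) z n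
    rw [hz'] at h1
    filter_upwards [h1, hτ.smul (linfIndicator m (B (n, k)) (hBm _)) (v (n, k)) n,
      coeFn_linfIndicator (m := m) (hBm (n, k)), hvB (n, k)] with x h1 h2 h3 h4 hx
    have h5 := (h1 hx.1).symm.trans (h2 hx.1)
    rw [h3, Set.indicator_of_mem hx, _root_.one_smul, _root_.one_smul] at h5
    rw [h5]
    exact h4 hx
  filter_upwards [ae_all_iff.2 key] with x hx hxE
  exact hx ⌊‖a n x‖⌋₊ ⟨hxE, rfl⟩

theorem surjective_toProduct
    (hex : ∀ n (c : Fin n → Lp ℝ ∞ m), ∃ z, ∀ᵐ x ∂m, x ∈ E n → τ z n x = fun i => c i x) :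
    Function.Surjective (hτ.toProduct hEm hEd hE0) := by
  intro b
  obtain ⟨h, hhm, hh⟩ := exists_measurable_piecewise E hEm
    (fun n x => (F n).normAt x (b n x))
    (fun n => (F n).measurable_apply (VecLp.measurable_coe _)) (fun i j hij => by
      change Set.EqOn _ _ (E i ∩ E j)
      rw [Set.disjoint_iff_inter_eq_empty.1 (hEd hij)]
      exact Set.eqOn_empty _ _)
  have hnorm : ∀ n, ‖b n‖ₑ = eLpNorm h p (m.restrict (E n)) := fun n => by
    rw [VecLp.enorm_eq]
    refine eLpNorm_congr_ae ?_
    filter_upwards [ae_restrict_mem (hEm n)] with x hx using (hh n hx).symm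
  have hlt : eLpNorm h p m < ∞ := (memℓp_iff_eLpNorm_lt_top hEm hEd hE0 hnorm).1 (lp.memℓp b)
  obtain ⟨z, hz⟩ := hτ.exists_coordinates_eq hEm hEd hex (fun n => VecLp.measurable_coe (b n)) hlt
    (fun n => ae_of_all _ fun x hx => (hh n hx).ge)
  refine ⟨z, ?_⟩
  apply lp.ext
  funext n
  apply VecLp.ext_ae
  rw [hτ.toProduct_apply]
  filter_upwards [hτ.coeFn_component hEm z n, (ae_restrict_iff' (hEm n)).2 (hz n)] with x h1 h2
  rw [h1, h2]

end IsCoordinateSystem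

theorem IsDimensionalDecomposition.exists_representation (hE : S.IsDimensionalDecomposition E) :
    ∃ (F : ∀ n, NormField X n) (T : 𝓜 ≃ₗᵢ[ℝ] VecLpProduct p m E F),
      (∀ (f : Lp ℝ ∞ m) (v : 𝓜) (n : ℕ), ∀ᵐ x ∂(m.restrict (E n)),
        T (S.smul f v) n x = f x • T v n x) ∧
      ∀ (v : 𝓜) (n : ℕ), ∀ᵐ x ∂(m.restrict (E n)), S.pnorm v x = (T v n).pnorm x := by
  obtain ⟨F, τ, hτ, hex⟩ := hE.exists_isCoordinateSystem
  refine ⟨F, LinearIsometryEquiv.ofSurjective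
    (hτ.toProduct hE.measurableSet hE.disjoint hE.null_compl)
    (hτ.surjective_toProduct hE.measurableSet hE.disjoint hE.null_compl hex), fun f v n => ?_,
    fun v n => hτ.pnorm_component hE.measurableSet v n⟩
  rw [LinearIsometryEquiv.coe_ofSurjective, hτ.toProduct_apply, hτ.toProduct_apply]
  filter_upwards [hτ.coeFn_component hE.measurableSet (S.smul f v) n,
    hτ.coeFn_component hE.measurableSet v n,
    (ae_restrict_iff' (hE.measurableSet n)).2 (hτ.smul f v n)] with x h1 h2 h3
  rw [h1, h2, h3]

end LpNormedModule

end Module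

/-! ### Equivalent pointwise norms -/

section Module

variable {X : Type u} [MeasurableSpace X] {p : ℝ≥0∞} [Fact (1 ≤ p)] {m : Measure X}
  {𝓜 : Type w} [NormedAddCommGroup 𝓜] [NormedSpace ℝ 𝓜] [CompleteSpace 𝓜]

theorem coeFn_sum_linfIndicator {A : ℕ → Set X} (hA : ∀ i, MeasurableSet (A i)) (n : ℕ) :
    ∀ᵐ x ∂m, (∑ i ∈ Finset.range n, linfIndicator m (A i) (hA i)) x =
      ∑ i ∈ Finset.range n, (A i).indicator (fun _ => (1 : ℝ)) x := by
  induction n with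
  | zero =>
    filter_upwards [Lp.coeFn_zero ℝ ∞ m] with x hx
    simpa using hx
  | succ n ih =>
    simp only [Finset.sum_range_succ]
    filter_upwards [ih, coeFn_linfIndicator (m := m) (hA n),
      Lp.coeFn_add (∑ i ∈ Finset.range n, linfIndicator m (A i) (hA i))
        (linfIndicator m (A n) (hA n))] with x h1 h2 h3
    rw [h3, Pi.add_apply, h1, h2]

theorem linfMul_linfIndicator {A B : Set X} (hA : MeasurableSet A) (hB : MeasurableSet B) :
    linfMul (linfIndicator m A hA) (linfIndicator m B hB) =
      linfIndicator m (A ∩ B) (hA.inter hB) := by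
  apply Lp.ext
  filter_upwards [coeFn_linfMul (linfIndicator m A hA) (linfIndicator m B hB),
    coeFn_linfIndicator (m := m) hA, coeFn_linfIndicator (m := m) hB,
    coeFn_linfIndicator (m := m) (hA.inter hB)] with x h1 h2 h3 h4
  rw [h1, h2, h3, h4]
  by_cases hxA : x ∈ A <;> by_cases hxB : x ∈ B <;> simp [hxA, hxB]

theorem linfIndicator_congr {A B : Set X} (hA : MeasurableSet A) (hB : MeasurableSet B)
    (h : A = B) : linfIndicator m A hA = linfIndicator m B hB := by
  subst h
  rfl

namespace LpNormedModule

variable (S : LpNormedModule p m 𝓜)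

theorem smul_linfIndicator_linfIndicator {A B C : Set X} (hA : MeasurableSet A)
    (hB : MeasurableSet B) (hC : MeasurableSet C) (h : A ∩ B = C) (v : 𝓜) :
    S.smul (linfIndicator m A hA) (S.smul (linfIndicator m B hB) v) =
      S.smul (linfIndicator m C hC) v := by
  rw [← S.mul_smul, linfMul_linfIndicator, linfIndicator_congr _ hC h]

/-- A function `q` on the module with values in `L^p` which has the algebraic properties of a
pointwise norm and is dominated by the given pointwise norm. -/
structure IsPointwiseSeminorm (q : 𝓜 → Lp ℝ p m) : Prop where
  nonneg : ∀ v, ∀ᵐ x ∂m, 0 ≤ q v x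
  add_le : ∀ v w, ∀ᵐ x ∂m, q (v + w) x ≤ q v x + q w x
  smul : ∀ (f : Lp ℝ ∞ m) v, ∀ᵐ x ∂m, q (S.smul f v) x = |f x| * q v x
  le_pnorm : ∀ v, ∀ᵐ x ∂m, q v x ≤ S.pnorm v x

namespace IsPointwiseSeminorm

variable {S} {q : 𝓜 → Lp ℝ p m} (hq : S.IsPointwiseSeminorm q)

include hq

theorem const_smul (c : ℝ) (v : 𝓜) : ∀ᵐ x ∂m, q (c • v) x = |c| * q v x := by
  rw [← S.smul_const]
  filter_upwards [hq.smul (c • linfIndicator m Set.univ MeasurableSet.univ) v,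
    coeFn_linfIndicator (m := m) MeasurableSet.univ,
    Lp.coeFn_smul c (linfIndicator m Set.univ MeasurableSet.univ)] with x h1 h2 h3
  rw [h1, h3, Pi.smul_apply, h2]
  simp

theorem norm_add_le (v w : 𝓜) : ‖q (v + w)‖ ≤ ‖q v‖ + ‖q w‖ := by
  refine le_trans (Lp.norm_le_norm_of_ae_le ?_) (_root_.norm_add_le (q v) (q w))
  filter_upwards [hq.add_le v w, hq.nonneg (v + w), Lp.coeFn_add (q v) (q w)] with x h1 h2 h3
  rw [h3, Pi.add_apply, Real.norm_of_nonneg h2]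
  exact h1.trans (Real.le_norm_self _)

theorem norm_smul (c : ℝ) (v : 𝓜) : ‖q (c • v)‖ = |c| * ‖q v‖ := by
  have h : ‖q (c • v)‖ = ‖c • q v‖ := by
    refine le_antisymm (Lp.norm_le_norm_of_ae_le ?_) (Lp.norm_le_norm_of_ae_le ?_) <;>
    · filter_upwards [hq.const_smul c v, Lp.coeFn_smul c (q v)] with x h1 h2
      rw [h2, h1, Pi.smul_apply, _root_.norm_smul, norm_mul, Real.norm_eq_abs |c|, abs_abs,
        Real.norm_eq_abs c]
  rw [h, _root_.norm_smul, Real.norm_eq_abs]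

theorem norm_le (v : 𝓜) : ‖q v‖ ≤ ‖v‖ := by
  rw [S.norm_eq]
  refine Lp.norm_le_norm_of_ae_le ?_
  filter_upwards [hq.nonneg v, hq.le_pnorm v] with x h1 h2
  rw [Real.norm_of_nonneg h1]
  exact h2.trans (Real.le_norm_self _)

omit hq in
theorem norm_le_mul {C : ℝ} {v : 𝓜} (h : ∀ᵐ x ∂m, S.pnorm v x ≤ C * q v x) :
    ‖v‖ ≤ |C| * ‖q v‖ := by
  rw [S.norm_eq, ← Real.norm_eq_abs, ← _root_.norm_smul]
  refine Lp.norm_le_norm_of_ae_le ?_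
  filter_upwards [h, Lp.coeFn_smul C (q v), S.pnorm_nonneg v] with x h1 h2 h3
  rw [h2, Real.norm_of_nonneg h3]
  exact h1.trans (Real.le_norm_self _)

theorem indicator {A : Set X} (hA : MeasurableSet A) (v : 𝓜) :
    ∀ᵐ x ∂m, q (S.smul (linfIndicator m A hA) v) x = A.indicator (q v) x := by
  filter_upwards [hq.smul (linfIndicator m A hA) v, coeFn_linfIndicator (m := m) hA]
    with x h1 h2
  rw [h1, h2]
  by_cases hx : x ∈ A <;> simp [hx]

/-- The glueing axiom for an equivalent pointwise norm. The element obtained from the original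
glueing axiom is cut off outside the union of the sets; then the inequality of the norms follows
from Fatou's lemma, as the partial sums are multiples `≥ 1` of the glued element. -/
theorem glueing {C : ℝ} (hC : ∀ v, ∀ᵐ x ∂m, S.pnorm v x ≤ C * q v x) (v : ℕ → 𝓜)
    (A : ℕ → Set X) (hA : ∀ n, MeasurableSet (A n))
    (hcompat : ∀ i j, S.smul (linfIndicator m (A i ∩ A j) ((hA i).inter (hA j))) (v i) =
      S.smul (linfIndicator m (A i ∩ A j) ((hA i).inter (hA j))) (v j))
    (hlim : limsup (fun n =>
      ‖q (∑ i ∈ Finset.range n, S.smul (linfIndicator m (A i) (hA i)) (v i))‖ₑ) atTop < ∞) :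
    ∃ z : 𝓜,
      (∀ i, S.smul (linfIndicator m (A i) (hA i)) z = S.smul (linfIndicator m (A i) (hA i)) (v i)) ∧
      ‖q z‖ₑ ≤ liminf (fun n =>
        ‖q (∑ i ∈ Finset.range n, S.smul (linfIndicator m (A i) (hA i)) (v i))‖ₑ) atTop := by
  obtain ⟨b, hb1, hb2⟩ := exists_between hlim
  have hev := eventually_lt_of_limsup_lt hb1
  obtain ⟨z, hz, -⟩ := S.glueing v A hA hcompat (by
    refine lt_of_le_of_lt (limsup_le_of_le (a := ENNReal.ofReal |C| * b) (by isBoundedDefault) ?_)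
      (ENNReal.mul_lt_top ENNReal.ofReal_lt_top hb2)
    filter_upwards [hev] with n hn
    refine le_trans ?_ (mul_le_mul_right hn.le _)
    rw [← ofReal_norm, ← ofReal_norm, ← ENNReal.ofReal_mul (abs_nonneg C)]
    exact ENNReal.ofReal_le_ofReal (norm_le_mul (hC _)))
  have hU : MeasurableSet (⋃ n, A n) := MeasurableSet.iUnion hA
  refine ⟨S.smul (linfIndicator m _ hU) z, fun i => ?_, ?_⟩
  · rw [S.smul_linfIndicator_linfIndicator (hA i) hU (hA i)
      (Set.inter_eq_left.2 (Set.subset_iUnion A i)), hz]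
  have hle : ∀ n, eLpNorm ((⋃ i ∈ Finset.range n, A i).indicator (q z)) p m ≤
      ‖q (∑ i ∈ Finset.range n, S.smul (linfIndicator m (A i) (hA i)) (v i))‖ₑ := by
    intro n
    have e : ∑ i ∈ Finset.range n, S.smul (linfIndicator m (A i) (hA i)) (v i) =
        S.smul (∑ i ∈ Finset.range n, linfIndicator m (A i) (hA i)) z := by
      rw [map_sum, LinearMap.sum_apply]
      exact Finset.sum_congr rfl fun i _ => (hz i).symm
    rw [e, Lp.enorm_def]
    refine eLpNorm_mono_ae ?_
    filter_upwards [hq.smul (∑ i ∈ Finset.range n, linfIndicator m (A i) (hA i)) z,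
      coeFn_sum_linfIndicator (m := m) hA n, hq.nonneg z] with x h1 h2 h3
    rw [h1, h2]
    by_cases hx : x ∈ ⋃ i ∈ Finset.range n, A i
    · rw [Set.indicator_of_mem hx, norm_mul, Real.norm_eq_abs |_|, abs_abs]
      refine le_mul_of_one_le_left (norm_nonneg _) ?_
      obtain ⟨i, hi, hxi⟩ := Set.mem_iUnion₂.1 hx
      refine le_trans ?_ (le_abs_self _)
      have h4 := Finset.single_le_sum (f := fun i => (A i).indicator (fun _ => (1 : ℝ)) x)
        (fun j _ => Set.indicator_nonneg (fun _ _ => zero_le_one) x) hi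
      simpa [hxi] using h4
    · rw [Set.indicator_of_notMem hx, norm_zero]
      exact norm_nonneg _
  have hlimq : eLpNorm ((⋃ n, A n).indicator (q z)) p m ≤
      liminf (fun n => eLpNorm ((⋃ i ∈ Finset.range n, A i).indicator (q z)) p m) atTop := by
    refine Lp.eLpNorm_lim_le_liminf_eLpNorm (fun n => ?_) _ (ae_of_all _ fun x => ?_)
    · exact (Lp.aestronglyMeasurable (q z)).indicator
        (Finset.measurableSet_biUnion _ fun i _ => hA i)
    · refine tendsto_const_nhds.congr' ?_
      by_cases hx : x ∈ ⋃ n, A n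
      · obtain ⟨i, hi⟩ := Set.mem_iUnion.1 hx
        filter_upwards [eventually_gt_atTop i] with n hn
        have hx' : x ∈ ⋃ i ∈ Finset.range n, A i :=
          Set.mem_iUnion₂.2 ⟨i, Finset.mem_range.2 hn, hi⟩
        rw [Set.indicator_of_mem hx, Set.indicator_of_mem hx']
      · refine Eventually.of_forall fun n => ?_
        have hx' : x ∉ ⋃ i ∈ Finset.range n, A i := fun h => by
          obtain ⟨i, -, hi⟩ := Set.mem_iUnion₂.1 h
          exact hx (Set.mem_iUnion.2 ⟨i, hi⟩)
        rw [Set.indicator_of_notMem hx]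
        exact (Set.indicator_of_notMem hx' _).symm
  have h1 : ‖q (S.smul (linfIndicator m _ hU) z)‖ₑ = eLpNorm ((⋃ n, A n).indicator (q z)) p m := by
    rw [Lp.enorm_def]
    exact eLpNorm_congr_ae (hq.indicator hU z)
  rw [h1]
  exact hlimq.trans (liminf_le_liminf (Eventually.of_forall hle))

end IsPointwiseSeminorm

/-- The module with the norm given by an equivalent pointwise norm `q`. -/
def Renormed {S : LpNormedModule p m 𝓜} {q : 𝓜 → Lp ℝ p m} (_ : S.IsPointwiseSeminorm q) {C : ℝ}
    (_ : ∀ v, ∀ᵐ x ∂m, S.pnorm v x ≤ C * q v x) : Type w := 𝓜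

namespace Renormed

variable {S} {q : 𝓜 → Lp ℝ p m} (hq : S.IsPointwiseSeminorm q) {C : ℝ}
  (hC : ∀ v, ∀ᵐ x ∂m, S.pnorm v x ≤ C * q v x)

instance : AddCommGroup (Renormed hq hC) := inferInstanceAs (AddCommGroup 𝓜)

instance : Module ℝ (Renormed hq hC) := inferInstanceAs (Module ℝ 𝓜)

/-- The identity map onto the renormed module. -/
def of : 𝓜 ≃ₗ[ℝ] Renormed hq hC := LinearEquiv.refl ℝ 𝓜

noncomputable instance : NormedAddCommGroup (Renormed hq hC) :=
  AddGroupNorm.toNormedAddCommGroup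
    { toFun := fun v => ‖q ((of hq hC).symm v)‖
      map_zero' := by
        have h := hq.norm_smul 0 0
        rw [zero_smul, abs_zero, zero_mul] at h
        exact h
      add_le' := fun v w => hq.norm_add_le _ _
      neg' := fun v => by
        have h := hq.norm_smul (-1) ((of hq hC).symm v)
        rw [neg_one_smul, abs_neg, abs_one, one_mul] at h
        exact h
      eq_zero_of_map_eq_zero' := fun v hv => by
        have h := IsPointwiseSeminorm.norm_le_mul (hC ((of hq hC).symm v))
        have hv' : ‖q ((of hq hC).symm v)‖ = 0 := hv
        rw [hv', mul_zero] at h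
        exact norm_le_zero_iff.1 h }

theorem norm_of (v : 𝓜) : ‖of hq hC v‖ = ‖q v‖ := rfl

theorem enorm_of (v : 𝓜) : ‖of hq hC v‖ₑ = ‖q v‖ₑ := by
  rw [← ofReal_norm, ← ofReal_norm, norm_of]

noncomputable instance : NormedSpace ℝ (Renormed hq hC) where
  norm_smul_le c v := (hq.norm_smul c ((of hq hC).symm v)).le

/-- The identity map is an isomorphism of normed spaces onto the renormed module. -/
noncomputable def ofL : 𝓜 ≃L[ℝ] Renormed hq hC :=
  (of hq hC).toContinuousLinearEquivOfBounds 1 |C|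
    (fun v => by rw [one_mul]; exact hq.norm_le v)
    (fun v => IsPointwiseSeminorm.norm_le_mul (hC ((of hq hC).symm v)))

instance : CompleteSpace (Renormed hq hC) :=
  (completeSpace_congr (e := (ofL hq hC).toEquiv) (ofL hq hC).isUniformEmbedding).1 inferInstance

/-- The normed module structure given by the equivalent pointwise norm. -/
noncomputable def module : LpNormedModule p m (Renormed hq hC) where
  smul :=
    { toFun := fun f => (of hq hC).toLinearMap ∘ₗ S.smul f ∘ₗ (of hq hC).symm.toLinearMap
      map_add' := fun f g => by
        ext v
        simp
      map_smul' := fun c f => by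
        ext v
        simp }
  pnorm v := q ((of hq hC).symm v)
  mul_smul f g v := S.mul_smul f g ((of hq hC).symm v)
  one_smul v := S.one_smul ((of hq hC).symm v)
  pnorm_nonneg v := hq.nonneg _
  norm_eq v := rfl
  pnorm_smul f v := hq.smul f _
  locality v A hA h := by
    have h' : ∀ n, S.smul (linfIndicator m (A n) (hA n)) ((of hq hC).symm v) = 0 := fun n =>
      h n
    exact S.locality _ A hA h'
  glueing v A hA hcompat hlim := by
    have hsum : ∀ n, ‖∑ i ∈ Finset.range n, (of hq hC)
        (S.smul (linfIndicator m (A i) (hA i)) ((of hq hC).symm (v i)))‖ₑ =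
        ‖q (∑ i ∈ Finset.range n, S.smul (linfIndicator m (A i) (hA i))
          ((of hq hC).symm (v i)))‖ₑ := fun n => by
      rw [← map_sum, enorm_of]
    obtain ⟨z, hz, hz'⟩ := hq.glueing hC (fun i => (of hq hC).symm (v i)) A hA hcompat (by
      simp only [← hsum]
      exact hlim)
    refine ⟨of hq hC z, hz, ?_⟩
    simp only [← hsum] at hz'
    rw [enorm_of]
    exact hz'

end Renormed

/-! ### Change of the field of norms -/

variable {S} {E : ℕ → Set X} {F : ∀ n, NormField X n} {τ : 𝓜 → ∀ n, X → Fin n → ℝ}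

theorem IsCoordinateSystem.exists_isPointwiseSeminorm (hτ : IsCoordinateSystem S E F τ)
    (hEm : ∀ n, MeasurableSet (E n)) (hEd : Pairwise fun i j => Disjoint (E i) (E j))
    (hE0 : m (⋃ n, E n)ᶜ = 0) {F' : ∀ n, NormField X n}
    (hF' : ∀ n x a, (F' n).normAt x a ≤ (F n).normAt x a) :
    ∃ q : 𝓜 → Lp ℝ p m, S.IsPointwiseSeminorm q ∧
      ∀ v n, ∀ᵐ x ∂m, x ∈ E n → q v x = (F' n).normAt x (τ v n x) := by
  have hex : ∀ v, ∃ q : Lp ℝ p m, ∀ n, ∀ᵐ x ∂m, x ∈ E n → q x = (F' n).normAt x (τ v n x) := by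
    intro v
    obtain ⟨h, hhm, hh⟩ := exists_measurable_piecewise E hEm
      (fun n x => (F' n).normAt x (τ v n x))
      (fun n => (F' n).measurable_apply (hτ.measurable v n)) (fun i j hij => by
        change Set.EqOn _ _ (E i ∩ E j)
        rw [Set.disjoint_iff_inter_eq_empty.1 (hEd hij)]
        exact Set.eqOn_empty _ _)
    have hmem : MemLp h p m := by
      refine (Lp.memLp (S.pnorm v)).of_le hhm.aestronglyMeasurable
        (ae_of_forall_ae_mem hE0 fun n => ?_)
      filter_upwards [hτ.pnorm v n] with x hx hxE
      rw [hx hxE, hh n hxE, Real.norm_of_nonneg (apply_nonneg _ _),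
        Real.norm_of_nonneg (apply_nonneg _ _)]
      exact hF' n x _
    refine ⟨hmem.toLp h, fun n => ?_⟩
    filter_upwards [hmem.coeFn_toLp] with x hx hxE
    rw [hx, hh n hxE]
  choose q hq using hex
  refine ⟨q, ⟨fun v => ae_of_forall_ae_mem hE0 fun n => ?_,
    fun v w => ae_of_forall_ae_mem hE0 fun n => ?_,
    fun f v => ae_of_forall_ae_mem hE0 fun n => ?_,
    fun v => ae_of_forall_ae_mem hE0 fun n => ?_⟩, hq⟩
  · filter_upwards [hq v n] with x hx hxE
    rw [hx hxE]
    exact apply_nonneg _ _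
  · filter_upwards [hq (v + w) n, hq v n, hq w n, hτ.add v w n] with x h1 h2 h3 h4 hxE
    rw [h1 hxE, h2 hxE, h3 hxE, h4 hxE]
    exact map_add_le_add _ _ _
  · filter_upwards [hq (S.smul f v) n, hq v n, hτ.smul f v n] with x h1 h2 h3 hxE
    rw [h1 hxE, h2 hxE, h3 hxE, map_smul_eq_mul, Real.norm_eq_abs]
  · filter_upwards [hq v n, hτ.pnorm v n] with x h1 h2 hxE
    rw [h1 hxE, h2 hxE]
    exact hF' n x _

/-- If `v` vanishes where the dimension exceeds `N`, then a field of norms which is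
`√n`-equivalent to the given one controls the pointwise norm of `v` with the constant `√N`. -/
theorem IsCoordinateSystem.pnorm_le_sqrt_mul (hτ : IsCoordinateSystem S E F τ)
    (hE0 : m (⋃ n, E n)ᶜ = 0) {F' : ∀ n, NormField X n}
    (hF' : ∀ n x a, (F n).normAt x a ≤ √(n : ℝ) * (F' n).normAt x a) {q : 𝓜 → Lp ℝ p m}
    (hqs : S.IsPointwiseSeminorm q)
    (hq : ∀ v n, ∀ᵐ x ∂m, x ∈ E n → q v x = (F' n).normAt x (τ v n x)) {N : ℕ} {v : 𝓜}
    (hv : ∀ n, N < n → ∀ᵐ x ∂m, x ∈ E n → S.pnorm v x = 0) :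
    ∀ᵐ x ∂m, S.pnorm v x ≤ √(N : ℝ) * q v x := by
  refine ae_of_forall_ae_mem hE0 fun n => ?_
  rcases lt_or_ge N n with hn | hn
  · filter_upwards [hv n hn, hqs.nonneg v] with x h1 h2 hx
    rw [h1 hx]
    positivity
  · filter_upwards [hq v n, hτ.pnorm v n] with x h1 h2 hx
    rw [h1 hx, h2 hx]
    refine (hF' n x _).trans ?_
    have : √(n : ℝ) ≤ √(N : ℝ) := Real.sqrt_le_sqrt (by exact_mod_cast hn)
    exact mul_le_mul_of_nonneg_right this (apply_nonneg _ _)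

/-- The coordinates given by a representation. -/
theorem isCoordinateSystem_of_representation (hEm : ∀ n, MeasurableSet (E n))
    (T : 𝓜 ≃ₗᵢ[ℝ] VecLpProduct p m E F)
    (hT : ∀ (f : Lp ℝ ∞ m) (v : 𝓜) (n : ℕ), ∀ᵐ x ∂(m.restrict (E n)),
      T (S.smul f v) n x = f x • T v n x)
    (hTn : ∀ (v : 𝓜) (n : ℕ), ∀ᵐ x ∂(m.restrict (E n)), S.pnorm v x = (T v n).pnorm x) :
    IsCoordinateSystem S E F fun v n => T v n where
  measurable z n := VecLp.measurable_coe _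
  add z z' n := by
    rw [← ae_restrict_iff' (hEm n), map_add]
    exact VecLp.coeFn_add (T z n) (T z' n)
  const_smul r z n := by
    rw [← ae_restrict_iff' (hEm n), map_smul]
    exact VecLp.coeFn_smul r (T z n)
  smul f z n := (ae_restrict_iff' (hEm n)).1 (hT f z n)
  pnorm z n := (ae_restrict_iff' (hEm n)).1 (hTn z n)

end LpNormedModule

end Module

/-! ### Uniformly convex renormings and reflexivity -/

section Renorming

/-- `Z` has an equivalent norm `N` which is uniformly convex, in the form
`N(a - b)^r ≤ ε (N(a)^r + N(b)^r) + K_ε ((N(a)^r + N(b)^r)/2 - N((a + b)/2)^r)` for all `ε > 0`.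
This inequality can be integrated and passes to limits. -/
def HasUniformlyConvexRenorming (r : ℝ) (Z : Type*) [NormedAddCommGroup Z] [NormedSpace ℝ Z] :
    Prop :=
  ∃ (N : Seminorm ℝ Z) (C : ℝ), 0 ≤ C ∧ (∀ z, N z ≤ C * ‖z‖) ∧ (∀ z, ‖z‖ ≤ C * N z) ∧
    ∀ ε : ℝ, 0 < ε → ∃ K : ℝ, 0 ≤ K ∧ ∀ a b, N (a - b) ^ r ≤
      ε * (N a ^ r + N b ^ r) + K * ((N a ^ r + N b ^ r) / 2 - N ((1 / 2 : ℝ) • (a + b)) ^ r)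

variable {Z : Type*} [NormedAddCommGroup Z] [NormedSpace ℝ Z]

/-- **Goldstine's theorem**, for finitely many functionals. -/
theorem exists_norm_le_forall_abs_sub_lt (Φ : StrongDual ℝ (StrongDual ℝ Z))
    (t : Finset (StrongDual ℝ Z)) {ε : ℝ} (hε : 0 < ε) :
    ∃ z : Z, ‖z‖ ≤ ‖Φ‖ ∧ ∀ f ∈ t, |f z - Φ f| < ε := by
  classical
  set L : Z →ₗ[ℝ] (t → ℝ) := LinearMap.pi fun f : t => (f.1 : Z →ₗ[ℝ] ℝ) with hL
  set s : Set (t → ℝ) := closure (L '' Metric.closedBall 0 ‖Φ‖) with hs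
  set y : t → ℝ := fun f => Φ f.1 with hy
  have hmem : y ∈ s := by
    by_contra hnot
    have hconv : Convex ℝ s := ((convex_closedBall (0 : Z) ‖Φ‖).linear_image L).closure
    obtain ⟨g, u, hgu, hug⟩ := geometric_hahn_banach_closed_point hconv isClosed_closure hnot
    set φ : StrongDual ℝ Z := ∑ f : t, g (Pi.single f 1) • f.1 with hφ
    have hgsum : ∀ c : t → ℝ, g c = ∑ f : t, g (Pi.single f 1) * c f := by
      intro c
      have h := LinearMap.pi_apply_eq_sum_univ g.toLinearMap c
      simp only [ContinuousLinearMap.coe_coe] at h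
      rw [h]
      refine Finset.sum_congr rfl fun f _ => ?_
      rw [smul_eq_mul, mul_comm]
      congr 2
      ext j
      simp [Pi.single_apply, eq_comm]
    have h1 : ∀ z : Z, ‖z‖ ≤ ‖Φ‖ → φ z < u := by
      intro z hz
      have h2 := hgu (L z) (subset_closure ⟨z, by simpa using hz, rfl⟩)
      rw [hgsum] at h2
      simpa [hφ, sum_apply, hL] using h2
    have h2 : u < Φ φ := by
      rw [hgsum] at hug
      simpa [hφ, map_sum, hy] using hug
    have hu0 : 0 < u := by simpa using h1 0 (by rw [norm_zero]; exact norm_nonneg Φ)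
    have h5 : Φ φ ≤ ‖Φ‖ * ‖φ‖ := (Real.le_norm_self _).trans (Φ.le_opNorm φ)
    rcases (norm_nonneg Φ).eq_or_lt with hΦ | hΦ
    · rw [← hΦ, zero_mul] at h5
      linarith
    · have h4 : ‖φ‖ ≤ u / ‖Φ‖ := by
        refine ContinuousLinearMap.opNorm_le_bound _ (by positivity) fun z => ?_
        rcases eq_or_ne z 0 with rfl | hz
        · simp
        have hz' : 0 < ‖z‖ := norm_pos_iff.2 hz
        have key : ∀ w : Z, ‖w‖ = ‖z‖ → φ w ≤ u / ‖Φ‖ * ‖z‖ := by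
          intro w hw
          have h5 := h1 ((‖Φ‖ / ‖z‖) • w) (by
            rw [norm_smul, Real.norm_of_nonneg (by positivity), hw, div_mul_cancel₀ _ hz'.ne'])
          rw [map_smul, smul_eq_mul, div_mul_eq_mul_div, div_lt_iff₀ hz'] at h5
          rw [div_mul_eq_mul_div, le_div_iff₀ hΦ]
          linarith
        rw [Real.norm_eq_abs]
        refine abs_le'.2 ⟨key z rfl, ?_⟩
        rw [← map_neg]
        exact key _ (norm_neg z)
      have h6 : ‖Φ‖ * ‖φ‖ ≤ ‖Φ‖ * (u / ‖Φ‖) := mul_le_mul_of_nonneg_left h4 hΦ.le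
      rw [mul_div_cancel₀ _ hΦ.ne'] at h6
      linarith
  obtain ⟨_, ⟨z, hz, rfl⟩, hd⟩ := Metric.mem_closure_iff.1 hmem ε hε
  refine ⟨z, by simpa using hz, fun f hf => ?_⟩
  have h1 := (dist_le_pi_dist y (L z) ⟨f, hf⟩).trans_lt hd
  rw [Real.dist_eq, abs_sub_comm] at h1
  exact h1

/-- **Milman–Pettis theorem**, up to an equivalent norm. Let `ℓ` be the supremum of the lower
bounds of `N` on weak* neighbourhoods of `Φ`. Points of small weak* neighbourhoods with `N`
close to `ℓ` have midpoints in the same neighbourhood, hence are close to each other by uniform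
convexity, and they converge to a point representing `Φ`. -/
theorem HasUniformlyConvexRenorming.isReflexiveSpace {Z : Type w} [NormedAddCommGroup Z]
    [NormedSpace ℝ Z] [CompleteSpace Z] {r : ℝ} (hr : 0 < r)
    (h : HasUniformlyConvexRenorming r Z) : IsReflexiveSpace Z := by
  classical
  obtain ⟨N, C, hC0, hNC, hCN, hconv⟩ := h
  intro Φ
  set D : Finset (StrongDual ℝ Z) → ℕ → Set Z := fun t k =>
    {z | ∀ f ∈ t, |f z - Φ f| < 1 / ((k : ℝ) + 1)} with hD
  have hpos : ∀ k : ℕ, (0 : ℝ) < 1 / ((k : ℝ) + 1) := fun k => Nat.one_div_pos_of_nat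
  have hanti : ∀ {k l : ℕ}, k ≤ l → 1 / ((l : ℝ) + 1) ≤ 1 / ((k : ℝ) + 1) := fun hkl =>
    Nat.one_div_le_one_div hkl
  have hDanti : ∀ {t t' : Finset (StrongDual ℝ Z)} {k k' : ℕ}, t ⊆ t' → k ≤ k' →
      D t' k' ⊆ D t k := fun ht hk z hz f hf => (hz f (ht hf)).trans_le (hanti hk)
  set B : Set ℝ := {c | ∃ t k, ∀ z ∈ D t k, c ≤ N z} with hB
  have hB0 : (0 : ℝ) ∈ B := ⟨∅, 0, fun z _ => apply_nonneg N z⟩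
  have hBb : BddAbove B := by
    refine ⟨C * ‖Φ‖, ?_⟩
    rintro c ⟨t, k, hc⟩
    obtain ⟨z, hz, hzt⟩ := exists_norm_le_forall_abs_sub_lt Φ t (hpos k)
    exact (hc z hzt).trans ((hNC z).trans (mul_le_mul_of_nonneg_left hz hC0))
  set ℓ := sSup B with hℓ
  have hℓ0 : 0 ≤ ℓ := le_csSup hBb hB0
  have hlow : ∀ δ : ℝ, 0 < δ → ∃ t k, ∀ z ∈ D t k, ℓ - δ ≤ N z := by
    intro δ hδ
    obtain ⟨c, ⟨t, k, hc⟩, hcl⟩ := exists_lt_of_lt_csSup ⟨0, hB0⟩ (show ℓ - δ < sSup B by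
      rw [← hℓ]; linarith)
    exact ⟨t, k, fun z hz => hcl.le.trans (hc z hz)⟩
  have hup : ∀ i : Finset (StrongDual ℝ Z) × ℕ,
      ∃ z, z ∈ D i.1 i.2 ∧ N z < ℓ + 1 / ((i.2 : ℝ) + 1) := by
    intro i
    by_contra! hcon
    have h1 : ℓ + 1 / ((i.2 : ℝ) + 1) ∈ B := ⟨i.1, i.2, hcon⟩
    have h2 := le_csSup hBb h1
    linarith [hpos i.2]
  choose u hu1 hu2 using hup
  have hcauchy : CauchySeq u := by
    rw [Metric.cauchySeq_iff']
    intro η hη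
    set η' := (η / (C + 1)) ^ r / 2 with hη'
    have hη'0 : 0 < η' := by positivity
    set M := 2 * (ℓ + 1) ^ r with hM
    have hM0 : 0 < M := by positivity
    obtain ⟨K, hK0, hK⟩ := hconv (η' / M) (by positivity)
    -- choose `δ` so small that the error term of the uniform convexity is at most `η'`
    have hlim : Tendsto (fun k : ℕ => K * ((ℓ + 1 / ((k : ℝ) + 1)) ^ r -
        (max (ℓ - 1 / ((k : ℝ) + 1)) 0) ^ r)) atTop (𝓝 (K * ((ℓ + 0) ^ r - (max (ℓ - 0) 0) ^ r))) := by
      have h1 : Tendsto (fun k : ℕ => 1 / ((k : ℝ) + 1)) atTop (𝓝 0) :=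
        tendsto_one_div_add_atTop_nhds_zero_nat
      refine Tendsto.const_mul _ (Tendsto.sub ?_ ?_)
      · exact (tendsto_const_nhds.add h1).rpow_const (Or.inr hr.le)
      · exact ((tendsto_const_nhds.sub h1).max tendsto_const_nhds).rpow_const (Or.inr hr.le)
    rw [add_zero, sub_zero, max_eq_left hℓ0, sub_self, mul_zero] at hlim
    obtain ⟨k, hk⟩ := (hlim.eventually_lt_const hη'0).exists
    obtain ⟨t, k', htk⟩ := hlow _ (hpos k)
    refine ⟨(t, max k k'), fun i hi => ?_⟩
    have hD1 : ∀ j : Finset (StrongDual ℝ Z) × ℕ, (t, max k k') ≤ j → u j ∈ D t k' := fun j hj =>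
      hDanti hj.1 ((le_max_right k k').trans hj.2) (hu1 j)
    have hN1 : ∀ j : Finset (StrongDual ℝ Z) × ℕ, (t, max k k') ≤ j →
        N (u j) ≤ ℓ + 1 / ((k : ℝ) + 1) := fun j hj =>
      (hu2 j).le.trans (add_le_add le_rfl (hanti ((le_max_left k k').trans hj.2)))
    set a := u i
    set b := u (t, max k k')
    have ha := hD1 i hi
    have hb := hD1 _ le_rfl
    have hNa := hN1 i hi
    have hNb := hN1 _ le_rfl
    have hmid : (1 / 2 : ℝ) • (a + b) ∈ D t k' := by
      intro f hf
      have e : f ((1 / 2 : ℝ) • (a + b)) - Φ f = (1 / 2) * (f a - Φ f) + (1 / 2) * (f b - Φ f) := by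
        rw [map_smul, map_add, smul_eq_mul]
        ring
      rw [e]
      refine (abs_add_le _ _).trans_lt ?_
      rw [abs_mul, abs_mul, abs_of_pos (show (0 : ℝ) < 1 / 2 by norm_num)]
      linarith [ha f hf, hb f hf]
    have hNm : max (ℓ - 1 / ((k : ℝ) + 1)) 0 ≤ N ((1 / 2 : ℝ) • (a + b)) :=
      max_le (htk _ hmid) (apply_nonneg _ _)
    have har : N a ^ r ≤ (ℓ + 1 / ((k : ℝ) + 1)) ^ r :=
      Real.rpow_le_rpow (apply_nonneg _ _) hNa hr.le
    have hbr : N b ^ r ≤ (ℓ + 1 / ((k : ℝ) + 1)) ^ r :=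
      Real.rpow_le_rpow (apply_nonneg _ _) hNb hr.le
    have hmr : (max (ℓ - 1 / ((k : ℝ) + 1)) 0) ^ r ≤ N ((1 / 2 : ℝ) • (a + b)) ^ r :=
      Real.rpow_le_rpow (le_max_right _ _) hNm hr.le
    have hMr : (ℓ + 1 / ((k : ℝ) + 1)) ^ r ≤ (ℓ + 1) ^ r := by
      refine Real.rpow_le_rpow (by linarith [hpos k]) ?_ hr.le
      have : 1 / ((k : ℝ) + 1) ≤ 1 := by simpa using hanti (Nat.zero_le k)
      linarith
    have h1 : N (a - b) ^ r < 2 * η' := by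
      have h2 : η' / M * (N a ^ r + N b ^ r) ≤ η' / M * M :=
        mul_le_mul_of_nonneg_left (by rw [hM]; linarith) (by positivity)
      rw [div_mul_cancel₀ _ hM0.ne'] at h2
      have h3 : K * ((N a ^ r + N b ^ r) / 2 - N ((1 / 2 : ℝ) • (a + b)) ^ r) ≤
          K * ((ℓ + 1 / ((k : ℝ) + 1)) ^ r - (max (ℓ - 1 / ((k : ℝ) + 1)) 0) ^ r) :=
        mul_le_mul_of_nonneg_left (by linarith) hK0
      linarith [hK a b]
    have h2 : N (a - b) < η / (C + 1) := by
      rw [hη', mul_div_cancel₀ _ (two_ne_zero)] at h1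
      exact (Real.rpow_lt_rpow_iff (apply_nonneg _ _) (by positivity) hr).1 h1
    rw [dist_eq_norm]
    rw [lt_div_iff₀ (by positivity)] at h2
    have h3 := hCN (a - b)
    have h4 : (0 : ℝ) ≤ N (a - b) := apply_nonneg _ _
    nlinarith
  obtain ⟨z, hz⟩ := cauchySeq_tendsto_of_complete hcauchy
  refine ⟨z, ?_⟩
  ext f
  rw [NormedSpace.dual_def]
  have h1 : Tendsto (fun i => f (u i)) atTop (𝓝 (f z)) := (f.continuous.tendsto z).comp hz
  refine tendsto_nhds_unique h1 ?_
  rw [Metric.tendsto_atTop]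
  intro η hη
  obtain ⟨k, hk⟩ := exists_nat_one_div_lt hη
  refine ⟨({f}, k), fun i hi => ?_⟩
  rw [Real.dist_eq]
  exact (hDanti hi.1 hi.2 (hu1 i) f (Finset.mem_singleton_self f)).trans hk

/-- A uniformly convex renorming passes to finitely representable spaces: the renorming is the
limit along an ultrafilter of the renormings of finite dimensional subspaces. -/
theorem HasUniformlyConvexRenorming.of_isFinitelyRepresentable {Y V : Type w}
    [NormedAddCommGroup Y] [NormedSpace ℝ Y] [NormedAddCommGroup V] [NormedSpace ℝ V] {r : ℝ}
    (hr : 0 < r) (hV : HasUniformlyConvexRenorming r V) (h : IsFinitelyRepresentable Y V) :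
    HasUniformlyConvexRenorming r Y := by
  classical
  obtain ⟨N, C, hC0, hNC, hCN, hconv⟩ := hV
  have hL : ∀ t : Finset Y, ∃ L : Submodule.span ℝ (t : Set Y) →ₗ[ℝ] V,
      ∀ y, ‖y‖ ≤ ‖L y‖ ∧ ‖L y‖ ≤ (1 + 1) * ‖y‖ := fun t =>
    h _ (FiniteDimensional.span_of_finite ℝ t.finite_toSet) 1 one_pos
  choose L hL1 using hL
  set g : Finset Y → Y → ℝ := fun t y =>
    if hy : y ∈ Submodule.span ℝ (t : Set Y) then N (L t ⟨y, hy⟩) else 0 with hg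
  have hgmem : ∀ (t : Finset Y) y (hy : y ∈ Submodule.span ℝ (t : Set Y)), g t y = N (L t ⟨y, hy⟩) :=
    fun t y hy => dif_pos hy
  have hbound : ∀ (t : Finset Y) y, g t y ∈ Set.Icc 0 (2 * C * ‖y‖) := by
    intro t y
    by_cases hy : y ∈ Submodule.span ℝ (t : Set Y)
    · rw [hgmem t y hy]
      refine ⟨apply_nonneg _ _, (hNC _).trans ?_⟩
      have h1 := (hL1 t ⟨y, hy⟩).2
      have h2 : ‖(⟨y, hy⟩ : Submodule.span ℝ (t : Set Y))‖ = ‖y‖ := rfl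
      rw [h2] at h1
      nlinarith
    · simp only [hg, dif_neg hy]
      exact ⟨le_rfl, by positivity⟩
  let U : Ultrafilter (Finset Y) := Ultrafilter.of atTop
  have hU : (U : Filter (Finset Y)) ≤ atTop := Ultrafilter.of_le _
  have hlim : ∀ y, ∃ c ∈ Set.Icc 0 (2 * C * ‖y‖), Tendsto (fun t => g t y) U (𝓝 c) := by
    intro y
    exact isCompact_Icc.ultrafilter_le_nhds (U.map fun t => g t y)
      (le_principal_iff.2 (Ultrafilter.mem_map.2 (Filter.univ_mem' fun t => hbound t y)))
  choose N' hN'b hN' using hlim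
  have hev : ∀ y : Y, ∀ᶠ t : Finset Y in (U : Filter (Finset Y)), y ∈ Submodule.span ℝ (t : Set Y) := by
    intro y
    filter_upwards [hU (eventually_ge_atTop {y})] with t ht
    exact Submodule.subset_span (Finset.singleton_subset_iff.1 ht)
  have hadd : ∀ a b, N' (a + b) ≤ N' a + N' b := by
    intro a b
    refine le_of_tendsto_of_tendsto (hN' (a + b)) ((hN' a).add (hN' b)) ?_
    filter_upwards [hev a, hev b] with t ha hb
    rw [hgmem t a ha, hgmem t b hb, hgmem t (a + b) (add_mem ha hb)]
    have e : L t ⟨a + b, add_mem ha hb⟩ = L t ⟨a, ha⟩ + L t ⟨b, hb⟩ := by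
      rw [← map_add]
      rfl
    rw [e]
    exact map_add_le_add _ _ _
  have hsmul : ∀ (c : ℝ) a, N' (c • a) = ‖c‖ * N' a := by
    intro c a
    refine tendsto_nhds_unique (hN' (c • a)) (((hN' a).const_mul ‖c‖).congr' ?_)
    filter_upwards [hev a] with t ha
    rw [hgmem t a ha, hgmem t (c • a) (Submodule.smul_mem _ c ha)]
    have e : L t ⟨c • a, Submodule.smul_mem _ c ha⟩ = c • L t ⟨a, ha⟩ := by
      rw [← map_smul]
      rfl
    rw [e, map_smul_eq_mul]
  refine ⟨Seminorm.of N' hadd hsmul, max C (2 * C), le_max_of_le_left hC0, fun y => ?_,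
    fun y => ?_, fun ε hε => ?_⟩
  · exact ((hN'b y).2).trans (mul_le_mul_of_nonneg_right (le_max_right _ _) (norm_nonneg _))
  · have h1 : ‖y‖ ≤ C * N' y := by
      refine ge_of_tendsto ((hN' y).const_mul C) ?_
      filter_upwards [hev y] with t hy
      rw [hgmem t y hy]
      exact (hL1 t ⟨y, hy⟩).1.trans (hCN _)
    exact h1.trans (mul_le_mul_of_nonneg_right (le_max_left _ _) (hN'b y).1)
  · obtain ⟨K, hK0, hK⟩ := hconv ε hε
    refine ⟨K, hK0, fun a b => ?_⟩
    change N' (a - b) ^ r ≤ ε * (N' a ^ r + N' b ^ r) +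
      K * ((N' a ^ r + N' b ^ r) / 2 - N' ((1 / 2 : ℝ) • (a + b)) ^ r)
    have hpow : ∀ y, Tendsto (fun t => g t y ^ r) U (𝓝 (N' y ^ r)) := fun y =>
      (hN' y).rpow_const (Or.inr hr.le)
    refine le_of_tendsto_of_tendsto (hpow (a - b))
      ((((hpow a).add (hpow b)).const_mul ε).add
        (((((hpow a).add (hpow b)).div_const 2).sub (hpow ((1 / 2 : ℝ) • (a + b)))).const_mul K)) ?_
    filter_upwards [hev a, hev b] with t ha hb
    have hm := Submodule.smul_mem _ (1 / 2 : ℝ) (add_mem ha hb)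
    rw [hgmem t a ha, hgmem t b hb, hgmem t (a - b) (sub_mem ha hb), hgmem t _ hm]
    have e1 : L t ⟨a - b, sub_mem ha hb⟩ = L t ⟨a, ha⟩ - L t ⟨b, hb⟩ := by
      rw [← map_sub]
      rfl
    have e2 : L t ⟨(1 / 2 : ℝ) • (a + b), hm⟩ = (1 / 2 : ℝ) • (L t ⟨a, ha⟩ + L t ⟨b, hb⟩) := by
      rw [← map_add, ← map_smul]
      rfl
    rw [e1, e2]
    exact hK _ _

theorem HasUniformlyConvexRenorming.isSuperReflexive {V : Type w} [NormedAddCommGroup V]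
    [NormedSpace ℝ V] {r : ℝ} (hr : 0 < r) (hV : HasUniformlyConvexRenorming r V) :
    IsSuperReflexive V := fun _ _ _ _ hY =>
  (hV.of_isFinitelyRepresentable hr hY).isReflexiveSpace hr

/-- Uniform convexity of `‖·‖ ^ r` in finite dimensional strictly convex spaces, by compactness of
the unit sphere of `V × V`. -/
theorem exists_norm_sub_rpow_le {V : Type*} [NormedAddCommGroup V] [NormedSpace ℝ V]
    [FiniteDimensional ℝ V] [StrictConvexSpace ℝ V] {r : ℝ} (hr : 1 < r) :
    (∀ a b : V, ‖(1 / 2 : ℝ) • (a + b)‖ ^ r ≤ (‖a‖ ^ r + ‖b‖ ^ r) / 2) ∧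
    ∀ ε : ℝ, 0 < ε → ∃ K : ℝ, 0 ≤ K ∧ ∀ a b : V, ‖a - b‖ ^ r ≤
      ε * (‖a‖ ^ r + ‖b‖ ^ r) + K * ((‖a‖ ^ r + ‖b‖ ^ r) / 2 - ‖(1 / 2 : ℝ) • (a + b)‖ ^ r) := by
  have hr0 : 0 < r := one_pos.trans hr
  have hmid : ∀ a b : V, ‖(1 / 2 : ℝ) • (a + b)‖ ≤ (1 / 2) * ‖a‖ + (1 / 2) * ‖b‖ := by
    intro a b
    rw [norm_smul, Real.norm_of_nonneg (by norm_num)]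
    linarith [norm_add_le a b]
  have hconvex : ∀ a b : V, ((1 / 2) * ‖a‖ + (1 / 2) * ‖b‖) ^ r ≤ (‖a‖ ^ r + ‖b‖ ^ r) / 2 := by
    intro a b
    have h := (convexOn_rpow hr.le).2 (norm_nonneg a) (norm_nonneg b)
      (show (0 : ℝ) ≤ 1 / 2 by norm_num) (show (0 : ℝ) ≤ 1 / 2 by norm_num) (by norm_num)
    simp only [smul_eq_mul] at h
    linarith
  have hle : ∀ a b : V, ‖(1 / 2 : ℝ) • (a + b)‖ ^ r ≤ (‖a‖ ^ r + ‖b‖ ^ r) / 2 := fun a b =>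
    (Real.rpow_le_rpow (norm_nonneg _) (hmid a b) hr0.le).trans (hconvex a b)
  refine ⟨hle, fun ε hε => ?_⟩
  have heq : ∀ a b : V, (‖a‖ ^ r + ‖b‖ ^ r) / 2 = ‖(1 / 2 : ℝ) • (a + b)‖ ^ r → a = b := by
    intro a b h
    have h1 : ((1 / 2) * ‖a‖ + (1 / 2) * ‖b‖) ^ r = (‖a‖ ^ r + ‖b‖ ^ r) / 2 :=
      le_antisymm (hconvex a b)
        (h.le.trans (Real.rpow_le_rpow (norm_nonneg _) (hmid a b) hr0.le))
    have h2 : ‖a‖ = ‖b‖ := by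
      by_contra hne
      have h3 := (strictConvexOn_rpow hr).2 (norm_nonneg a) (norm_nonneg b) hne
        (show (0 : ℝ) < 1 / 2 by norm_num) (show (0 : ℝ) < 1 / 2 by norm_num) (by norm_num)
      simp only [smul_eq_mul] at h3
      linarith
    have h4 : ‖(1 / 2 : ℝ) • (a + b)‖ = (1 / 2) * ‖a‖ + (1 / 2) * ‖b‖ := by
      refine (Real.rpow_left_inj (norm_nonneg _) (by positivity) hr0.ne').1 ?_
      rw [h1, h]
    rw [norm_smul, Real.norm_of_nonneg (by norm_num)] at h4
    have h5 : ‖a + b‖ = ‖a‖ + ‖b‖ := by linarith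
    exact (sameRay_iff_norm_add.2 h5).eq_of_norm_eq h2
  -- the inequality on the unit sphere of `V × V`
  have hsphere : ∃ K : ℝ, 0 ≤ K ∧ ∀ z : V × V, ‖z‖ = 1 → ‖z.1 - z.2‖ ^ r ≤
      ε + K * ((‖z.1‖ ^ r + ‖z.2‖ ^ r) / 2 - ‖(1 / 2 : ℝ) • (z.1 + z.2)‖ ^ r) := by
    by_contra! hcon
    choose z hz1 hz2 using fun k : ℕ => hcon k k.cast_nonneg
    have hzs : ∀ k, z k ∈ Metric.sphere (0 : V × V) 1 := fun k => by simpa using hz1 k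
    have : ProperSpace (V × V) := FiniteDimensional.proper ℝ _
    obtain ⟨y, -, φ, hφ, hlim⟩ := (isCompact_sphere (0 : V × V) 1).tendsto_subseq hzs
    set G : V × V → ℝ := fun z => ‖z.1 - z.2‖ ^ r with hG
    set D : V × V → ℝ := fun z =>
      (‖z.1‖ ^ r + ‖z.2‖ ^ r) / 2 - ‖(1 / 2 : ℝ) • (z.1 + z.2)‖ ^ r with hD
    have hGc : Continuous G :=
      (continuous_fst.sub continuous_snd).norm.rpow_const fun _ => Or.inr hr0.le
    have hDc : Continuous D := by
      refine Continuous.sub (Continuous.div_const (Continuous.add ?_ ?_) 2) ?_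
      · exact continuous_fst.norm.rpow_const fun _ => Or.inr hr0.le
      · exact continuous_snd.norm.rpow_const fun _ => Or.inr hr0.le
      · exact ((continuous_fst.add continuous_snd).const_smul (1 / 2 : ℝ)).norm.rpow_const
          fun _ => Or.inr hr0.le
    have hD0 : ∀ z, 0 ≤ D z := fun z => sub_nonneg.2 (hle z.1 z.2)
    have hG1 := (hGc.tendsto y).comp hlim
    have hD1 := (hDc.tendsto y).comp hlim
    have hGε : ε ≤ G y := ge_of_tendsto hG1 (Eventually.of_forall fun k => by
      have h1 : ε + (φ k : ℝ) * D (z (φ k)) < G (z (φ k)) := hz2 (φ k)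
      have h2 : 0 ≤ (φ k : ℝ) * D (z (φ k)) := mul_nonneg (Nat.cast_nonneg _) (hD0 _)
      change ε ≤ G (z (φ k))
      linarith)
    have hDy : D y = 0 := by
      refine le_antisymm (not_lt.1 fun hpos => ?_) (hD0 y)
      have h1 : Tendsto (fun k => (φ k : ℝ) * D (z (φ k))) atTop atTop :=
        Tendsto.atTop_mul_pos hpos (tendsto_natCast_atTop_atTop.comp hφ.tendsto_atTop) hD1
      have h2 : Tendsto (fun k => G (z (φ k))) atTop atTop := by
        refine tendsto_atTop_mono (fun k => ?_) h1
        have h1 : ε + (φ k : ℝ) * D (z (φ k)) < G (z (φ k)) := hz2 (φ k)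
        linarith
      exact not_tendsto_nhds_of_tendsto_atTop h2 _ hG1
    have h3 : y.1 = y.2 := heq _ _ (sub_eq_zero.1 hDy)
    have h4 : G y = 0 := by
      simp only [hG, h3, sub_self, norm_zero]
      exact Real.zero_rpow hr0.ne'
    linarith
  obtain ⟨K, hK0, hK⟩ := hsphere
  refine ⟨K, hK0, fun a b => ?_⟩
  rcases eq_or_ne ((a, b) : V × V) 0 with h0 | h0
  · obtain ⟨rfl, rfl⟩ := Prod.mk_eq_zero.1 h0
    simp [Real.zero_rpow hr0.ne']
  set M := ‖((a, b) : V × V)‖ with hM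
  have hM0 : 0 < M := norm_pos_iff.2 h0
  have h1 := hK (M⁻¹ • (a, b)) (by rw [norm_smul, norm_inv, norm_norm, inv_mul_cancel₀ hM0.ne'])
  have hscale : ∀ v : V, ‖M⁻¹ • v‖ ^ r = (M ^ r)⁻¹ * ‖v‖ ^ r := fun v => by
    rw [norm_smul, Real.mul_rpow (norm_nonneg _) (norm_nonneg _),
      Real.norm_of_nonneg (inv_nonneg.2 hM0.le), Real.inv_rpow hM0.le]
  have e3 : (1 / 2 : ℝ) • (M⁻¹ • a + M⁻¹ • b) = M⁻¹ • (1 / 2 : ℝ) • (a + b) := by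
    rw [← smul_add, smul_comm]
  simp only [Prod.smul_mk] at h1
  rw [← smul_sub, e3, hscale, hscale, hscale, hscale] at h1
  have hMr : 0 < M ^ r := Real.rpow_pos_of_pos hM0 r
  have hMab : M ^ r ≤ ‖a‖ ^ r + ‖b‖ ^ r := by
    have ha : 0 ≤ ‖a‖ ^ r := by positivity
    have hb : 0 ≤ ‖b‖ ^ r := by positivity
    rcases max_choice ‖a‖ ‖b‖ with h | h
    · have : M = ‖a‖ := h
      rw [this]
      linarith
    · have : M = ‖b‖ := h
      rw [this]
      linarith
  have h2 := mul_le_mul_of_nonneg_left h1 hMr.le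
  have e4 : M ^ r * ((M ^ r)⁻¹ * ‖a - b‖ ^ r) = ‖a - b‖ ^ r := by
    rw [← mul_assoc, mul_inv_cancel₀ hMr.ne', one_mul]
  have e5 : M ^ r * (ε + K * (((M ^ r)⁻¹ * ‖a‖ ^ r + (M ^ r)⁻¹ * ‖b‖ ^ r) / 2 -
      (M ^ r)⁻¹ * ‖(1 / 2 : ℝ) • (a + b)‖ ^ r)) =
      ε * M ^ r + K * ((‖a‖ ^ r + ‖b‖ ^ r) / 2 - ‖(1 / 2 : ℝ) • (a + b)‖ ^ r) := by
    have := mul_inv_cancel₀ hMr.ne'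
    linear_combination (K * ((‖a‖ ^ r + ‖b‖ ^ r) / 2 - ‖(1 / 2 : ℝ) • (a + b)‖ ^ r)) * this
  rw [e4, e5] at h2
  have h3 := mul_le_mul_of_nonneg_left hMab hε.le
  linarith

end Renorming

/-! ### Increasing projections and reflexivity -/

section Projections

variable {Z : Type w} [NormedAddCommGroup Z] [NormedSpace ℝ Z] {P : ℕ → Z →L[ℝ] Z} {r : ℝ}

/-- If the norm is an `ℓ^r`-sum with `r > 1` over the range and the kernel of each of the
projections `P k`, which converge strongly to the identity, then their adjoints converge strongly
to the identity. Let `u` be a unit vector on which `φ` almost attains its norm. If `φ` were large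
on some unit vector `y` in the kernel of `P k`, for a large `k`, then `φ` would be too large on
`P k u + t y` for small `t`, as the norm of this vector is at most `1 + t ^ r`. -/
theorem tendsto_comp_projection (hr : 1 < r) (hP : ∀ k v, P k (P k v) = P k v)
    (hsplit : ∀ k v, ‖v‖ ^ r = ‖P k v‖ ^ r + ‖v - P k v‖ ^ r)
    (hconv : ∀ v, Tendsto (fun k => P k v) atTop (𝓝 v)) (φ : StrongDual ℝ Z) :
    Tendsto (fun k => φ.comp (P k)) atTop (𝓝 φ) := by
  have hr0 : 0 < r := one_pos.trans hr
  refine Metric.tendsto_nhds.2 fun η' hη' => ?_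
  set η : ℝ := η' / 2 with hηdef
  have hη : 0 < η := half_pos hη'
  set M : ℝ := ‖φ‖ with hM
  have hM0 : 0 ≤ M := norm_nonneg φ
  -- `t` is chosen such that `M * t ^ (r - 1) ≤ η / 2`
  set t : ℝ := (η / (2 * (M + 1))) ^ (r - 1)⁻¹ with ht
  have ht0 : 0 < t := by positivity
  have htr : M * t ^ r ≤ t * (η / 2) := by
    have h1 : t ^ (r - 1) = η / (2 * (M + 1)) :=
      Real.rpow_inv_rpow (by positivity) (sub_pos.2 hr).ne'
    have h2 : t ^ r = t * (η / (2 * (M + 1))) := by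
      rw [← h1, ← Real.rpow_one_add' ht0.le (by linarith)]
      congr 1
      ring
    have h3 : M * (η / (2 * (M + 1))) ≤ η / 2 := by
      rw [← mul_div_assoc, div_le_div_iff₀ (by positivity) (by positivity)]
      nlinarith
    rw [h2]
    calc M * (t * (η / (2 * (M + 1)))) = t * (M * (η / (2 * (M + 1)))) := by ring
      _ ≤ t * (η / 2) := mul_le_mul_of_nonneg_left h3 ht0.le
  obtain ⟨u, hu1, hu⟩ : ∃ u : Z, ‖u‖ ≤ 1 ∧ M - t * (η / 2) < φ u := by
    obtain ⟨u, hu1, hu⟩ := φ.exists_lt_apply_of_lt_opNorm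
      (show M - t * (η / 2) < ‖φ‖ by linarith [mul_pos ht0 (half_pos hη)])
    rcases abs_cases (φ u) with h | h
    · exact ⟨u, hu1.le, by rwa [Real.norm_eq_abs, h.1] at hu⟩
    · exact ⟨-u, by rw [norm_neg]; exact hu1.le, by rwa [Real.norm_eq_abs, h.1, ← map_neg] at hu⟩
  have hev : ∀ᶠ k in atTop, M - t * (η / 2) < φ (P k u) :=
    ((φ.continuous.tendsto u).comp (hconv u)).eventually (lt_mem_nhds hu)
  filter_upwards [hev] with k hk
  have hPu : ‖P k u‖ ^ r ≤ 1 := by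
    have h1 := Real.rpow_le_rpow (norm_nonneg u) hu1 hr0.le
    rw [Real.one_rpow, hsplit k u] at h1
    linarith [Real.rpow_nonneg (norm_nonneg (u - P k u)) r]
  have hmain : ∀ v : Z, ‖v‖ = 1 → φ (v - P k v) ≤ η := by
    intro v hv
    have hy : ‖v - P k v‖ ^ r ≤ 1 := by
      have h1 := hsplit k v
      rw [hv, Real.one_rpow] at h1
      linarith [Real.rpow_nonneg (norm_nonneg (P k v)) r]
    have hPw : P k (P k u + t • (v - P k v)) = P k u := by
      rw [map_add, map_smul, map_sub, hP, hP, sub_self, smul_zero, add_zero]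
    have hw : ‖P k u + t • (v - P k v)‖ ≤ 1 + t ^ r := by
      have h1 := hsplit k (P k u + t • (v - P k v))
      rw [hPw, add_sub_cancel_left, norm_smul, Real.norm_of_nonneg ht0.le,
        Real.mul_rpow ht0.le (norm_nonneg _)] at h1
      have h2 : ‖P k u + t • (v - P k v)‖ ^ r ≤ 1 + t ^ r := by
        have h3 := mul_le_mul_of_nonneg_left hy (Real.rpow_nonneg ht0.le r)
        linarith
      rcases le_total ‖P k u + t • (v - P k v)‖ 1 with h3 | h3
      · exact h3.trans (by linarith [Real.rpow_nonneg ht0.le r])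
      · exact (Real.self_le_rpow_of_one_le h3 hr.le).trans h2
    have h1 : φ (P k u + t • (v - P k v)) ≤ M * (1 + t ^ r) :=
      (Real.le_norm_self _).trans ((φ.le_opNorm _).trans (mul_le_mul_of_nonneg_left hw hM0))
    rw [map_add, map_smul, smul_eq_mul] at h1
    have h2 : t * φ (v - P k v) ≤ t * η := by linarith
    exact le_of_mul_le_mul_left h2 ht0
  have hnorm : ‖φ.comp (P k) - φ‖ ≤ η := by
    refine ContinuousLinearMap.opNorm_le_of_unit_norm hη.le fun v hv => ?_
    have h1 := hmain v hv
    have h2 := hmain (-v) (by rw [norm_neg, hv])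
    have e : φ (-v - P k (-v)) = -φ (v - P k v) := by
      rw [map_neg, ← map_neg φ]
      congr 1
      abel
    rw [e] at h2
    have e2 : (φ.comp (P k) - φ) v = -φ (v - P k v) := by
      simp
    rw [e2, norm_neg, Real.norm_eq_abs]
    exact abs_le.2 ⟨by linarith, h1⟩
  rw [dist_eq_norm]
  linarith

/-- Reflexivity of an increasing union: the ranges of the projections `P k` are reflexive, so that
a functional on the dual is represented on each of them; the representing vectors are glued, and
by `tendsto_comp_projection` the glued vector represents the functional. -/
theorem isReflexiveSpace_of_projections (hr : 1 < r)
    (hP : ∀ j k, j ≤ k → ∀ v, P j (P k v) = P j v)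
    (hsplit : ∀ k v, ‖v‖ ^ r = ‖P k v‖ ^ r + ‖v - P k v‖ ^ r)
    (hconv : ∀ v, Tendsto (fun k => P k v) atTop (𝓝 v))
    (hglue : ∀ (x : ℕ → Z) (C : ℝ), (∀ j k, j ≤ k → P j (x k) = x j) → (∀ k, ‖x k‖ ≤ C) →
      ∃ z, ∀ k, P k z = x k)
    (hrefl : ∀ k, IsReflexiveSpace (ContinuousLinearMap.id ℝ Z - P k).ker) :
    IsReflexiveSpace Z := by
  intro Φ
  have hPn : ∀ k, ‖P k‖ ≤ 1 := fun k =>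
    ContinuousLinearMap.opNorm_le_bound _ zero_le_one fun v => by
      rw [one_mul, ← Real.rpow_le_rpow_iff (norm_nonneg _) (norm_nonneg _) (one_pos.trans hr),
        hsplit k v]
      exact le_add_of_nonneg_right (Real.rpow_nonneg (norm_nonneg _) r)
  have hx : ∀ k, ∃ x : Z, P k x = x ∧ ∀ φ : StrongDual ℝ Z, φ x = Φ (φ.comp (P k)) := by
    intro k
    set K := (ContinuousLinearMap.id ℝ Z - P k).ker with hK
    set P' : Z →L[ℝ] K := (P k).codRestrict K fun v => by
      simp [hK, hP k k le_rfl] with hP'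
    obtain ⟨x, hx⟩ := hrefl k (Φ.comp (ContinuousLinearMap.precomp ℝ P'))
    refine ⟨x, ?_, fun φ => ?_⟩
    · have h2 : (x : Z) - P k x = 0 := LinearMap.mem_ker.1 x.2
      exact (sub_eq_zero.1 h2).symm
    · have h1 := congrArg (fun Ψ : StrongDual ℝ (StrongDual ℝ K) => Ψ (φ.comp K.subtypeL)) hx
      exact h1
  choose x hPx hx using hx
  obtain ⟨z, hz⟩ := hglue x ‖Φ‖ (fun j k hjk => by
      refine (SeparatingDual.eq_iff_forall_dual_eq (R := ℝ)).2 fun φ => ?_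
      have h1 := hx k (φ.comp (P j))
      have h2 : (φ.comp (P j)).comp (P k) = φ.comp (P j) := by
        ext v
        exact congrArg φ (hP j k hjk v)
      rw [h2, ← hx j φ] at h1
      exact h1) (fun k => by
      refine NormedSpace.norm_le_dual_bound ℝ _ (norm_nonneg Φ) fun φ => ?_
      rw [hx k φ]
      refine (Φ.le_opNorm _).trans (mul_le_mul_of_nonneg_left ?_ (norm_nonneg _))
      exact (φ.opNorm_comp_le _).trans (mul_le_of_le_one_right (norm_nonneg _) (hPn k)))
  refine ⟨z, ?_⟩
  ext φ
  have h1 : Tendsto (fun k => Φ (φ.comp (P k))) atTop (𝓝 (Φ φ)) :=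
    (Φ.continuous.tendsto φ).comp
      (tendsto_comp_projection hr (fun k => hP k k le_rfl) hsplit hconv φ)
  have h2 : Tendsto (fun k => Φ (φ.comp (P k))) atTop (𝓝 (φ z)) := by
    have h3 : Tendsto (fun k => φ (P k z)) atTop (𝓝 (φ z)) :=
      (φ.continuous.tendsto z).comp (hconv z)
    refine h3.congr fun k => ?_
    rw [hz k, hx k φ]
  exact tendsto_nhds_unique h2 h1

end Projections

/-! ### Reflexivity and super-reflexivity of normed modules -/

section Module

variable {X : Type u} [MeasurableSpace X] {p : ℝ≥0∞} [Fact (1 ≤ p)] {m : Measure X}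
  {𝓜 : Type w} [NormedAddCommGroup 𝓜] [NormedSpace ℝ 𝓜] [CompleteSpace 𝓜]

theorem integrable_rpow_of_nonneg (hp : p ≠ ∞) {g : Lp ℝ p m} (hg : ∀ᵐ x ∂m, 0 ≤ g x) :
    Integrable (fun x => g x ^ p.toReal) m := by
  refine ((Lp.memLp g).integrable_norm_rpow fact_ne_zero hp).congr ?_
  filter_upwards [hg] with x hx
  rw [Real.norm_of_nonneg hx]

theorem norm_rpow_eq_integral (hp : p ≠ ∞) {g : Lp ℝ p m} (hg : ∀ᵐ x ∂m, 0 ≤ g x) :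
    ‖g‖ ^ p.toReal = ∫ x, g x ^ p.toReal ∂m := by
  have hr : 0 < p.toReal := ENNReal.toReal_pos fact_ne_zero hp
  rw [Lp.norm_def, (Lp.memLp g).eLpNorm_eq_integral_rpow_norm fact_ne_zero hp,
    ENNReal.toReal_ofReal (by positivity), Real.rpow_inv_rpow (by positivity) hr.ne']
  refine integral_congr_ae ?_
  filter_upwards [hg] with x hx
  rw [Real.norm_of_nonneg hx]

namespace LpNormedModule

variable {S : LpNormedModule p m 𝓜} {E : ℕ → Set X}

/-- A space of elements of the module which vanish where the dimension exceeds `N` has a uniformly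
convex renorming: the pointwise norm is replaced by the one given by John's ellipsoids, and the
inequality for the Euclidean spaces `ℝⁿ`, `n ≤ N`, is integrated. -/
theorem IsDimensionalDecomposition.hasUniformlyConvexRenorming
    (hE : S.IsDimensionalDecomposition E) (hp1 : 1 < p) (hp : p ≠ ∞) {Z : Type*}
    [NormedAddCommGroup Z] [NormedSpace ℝ Z] (ι : Z →ₗᵢ[ℝ] 𝓜) {N : ℕ}
    (hι : ∀ z n, N < n → ∀ᵐ x ∂m, x ∈ E n → S.pnorm (ι z) x = 0) :
    HasUniformlyConvexRenorming p.toReal Z := by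
  have hr : 1 < p.toReal := by
    rw [← ENNReal.toReal_one]
    exact (ENNReal.toReal_lt_toReal ENNReal.one_ne_top hp).2 hp1
  have hr0 : 0 < p.toReal := one_pos.trans hr
  obtain ⟨F, τ, hτ, -⟩ := hE.exists_isCoordinateSystem
  choose A F' hA _ hF' using fun n => (F n).exists_john
  obtain ⟨q, hqs, hq⟩ := hτ.exists_isPointwiseSeminorm hE.measurableSet hE.disjoint
    hE.null_compl (fun n x a => (hF' n x a).1)
  -- the field of John's norms is the pull-back of the Euclidean norm
  have hqe : ∀ v n, ∀ᵐ x ∂m, x ∈ E n →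
      q v x = ‖(WithLp.toLp 2 ((A n x).mulVec (τ v n x)) : EuclideanSpace ℝ (Fin n))‖ := by
    intro v n
    filter_upwards [hq v n] with x hx hxE
    rw [hx hxE, hA, ellipsoidNorm_eq_norm]
  have hC : ∀ z, ‖ι z‖ ≤ |√(N : ℝ)| * ‖q (ι z)‖ := fun z =>
    IsPointwiseSeminorm.norm_le_mul
      (hτ.pnorm_le_sqrt_mul hE.null_compl (fun n x a => (hF' n x a).2) hqs hq (hι z))
  refine ⟨(Seminorm.of (fun v => ‖q v‖) hqs.norm_add_le hqs.norm_smul).comp ι.toLinearMap,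
    max 1 |√(N : ℝ)|, by positivity, fun z => ?_, fun z => ?_, fun ε hε => ?_⟩
  · change ‖q (ι z)‖ ≤ _
    rw [← ι.norm_map z]
    exact (hqs.norm_le _).trans (le_mul_of_one_le_left (norm_nonneg _) (le_max_left _ _))
  · change ‖z‖ ≤ _ * ‖q (ι z)‖
    rw [← ι.norm_map z]
    exact (hC z).trans (mul_le_mul_of_nonneg_right (le_max_right _ _) (norm_nonneg _))
  choose hmid hunif using fun n : ℕ =>
    exists_norm_sub_rpow_le (V := EuclideanSpace ℝ (Fin n)) hr
  choose K hK0 hK using fun n => hunif n ε hε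
  refine ⟨∑ n ∈ Finset.range (N + 1), K n, Finset.sum_nonneg fun n _ => hK0 n, fun a b => ?_⟩
  change ‖q (ι (a - b))‖ ^ p.toReal ≤ ε * (‖q (ι a)‖ ^ p.toReal + ‖q (ι b)‖ ^ p.toReal) +
    (∑ n ∈ Finset.range (N + 1), K n) * ((‖q (ι a)‖ ^ p.toReal + ‖q (ι b)‖ ^ p.toReal) / 2 -
      ‖q (ι ((1 / 2 : ℝ) • (a + b)))‖ ^ p.toReal)
  have hint : ∀ v, Integrable (fun x => q v x ^ p.toReal) m := fun v =>
    integrable_rpow_of_nonneg hp (hqs.nonneg v)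
  simp only [norm_rpow_eq_integral hp (hqs.nonneg _)]
  have hi1 : Integrable (fun x => q (ι a) x ^ p.toReal + q (ι b) x ^ p.toReal) m :=
    (hint _).add (hint _)
  have hi2 : Integrable (fun x => (q (ι a) x ^ p.toReal + q (ι b) x ^ p.toReal) / 2 -
      q (ι ((1 / 2 : ℝ) • (a + b))) x ^ p.toReal) m := (hi1.div_const 2).sub (hint _)
  rw [← integral_add (hint _) (hint _), ← integral_const_mul, ← integral_div,
    ← integral_sub (hi1.div_const 2) (hint _), ← integral_const_mul,
    ← integral_add (hi1.const_mul ε) (hi2.const_mul _)]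
  refine integral_mono_ae (hint _) ((hi1.const_mul ε).add (hi2.const_mul _)) ?_
  refine ae_of_forall_ae_mem hE.null_compl fun n => ?_
  rcases lt_or_ge N n with hn | hn
  · have hzero : ∀ z, ∀ᵐ x ∂m, x ∈ E n → q (ι z) x = 0 := by
      intro z
      filter_upwards [hι z n hn, hqs.nonneg (ι z), hqs.le_pnorm (ι z)] with x h1 h2 h3 hx
      exact le_antisymm (h3.trans (h1 hx).le) h2
    filter_upwards [hzero (a - b), hzero a, hzero b, hzero ((1 / 2 : ℝ) • (a + b))]
      with x h1 h2 h3 h4 hx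
    simp only [h1 hx, h2 hx, h3 hx, h4 hx, Real.zero_rpow hr0.ne']
    simp
  · have hsub : ∀ᵐ x ∂m, x ∈ E n → τ (ι (a - b)) n x = τ (ι a) n x - τ (ι b) n x := by
      filter_upwards [hτ.add (ι (a - b)) (ι b) n] with x h1 hx
      rw [← map_add, sub_add_cancel] at h1
      rw [h1 hx, add_sub_cancel_right]
    have hhalf : ∀ᵐ x ∂m, x ∈ E n → τ (ι ((1 / 2 : ℝ) • (a + b))) n x =
        (1 / 2 : ℝ) • (τ (ι a) n x + τ (ι b) n x) := by
      filter_upwards [hτ.const_smul (1 / 2) (ι (a + b)) n, hτ.add (ι a) (ι b) n] with x h1 h2 hx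
      rw [map_smul, h1 hx, map_add, h2 hx]
    filter_upwards [hqe (ι (a - b)) n, hqe (ι a) n, hqe (ι b) n,
      hqe (ι ((1 / 2 : ℝ) • (a + b))) n, hsub, hhalf] with x h1 h2 h3 h4 h5 h6 hx
    rw [h1 hx, h2 hx, h3 hx, h4 hx, h5 hx, h6 hx, Matrix.mulVec_sub, Matrix.mulVec_smul,
      Matrix.mulVec_add, WithLp.toLp_sub, WithLp.toLp_smul, WithLp.toLp_add]
    refine (hK n _ _).trans (add_le_add le_rfl (mul_le_mul_of_nonneg_right ?_ ?_))
    · exact Finset.single_le_sum (fun i _ => hK0 i) (Finset.mem_range.2 (Nat.lt_succ_of_le hn))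
    · exact sub_nonneg.2 (hmid n _ _)

theorem IsDimensionalDecomposition.isSuperReflexive (hE : S.IsDimensionalDecomposition E)
    (hp1 : 1 < p) (hp : p ≠ ∞) {N : ℕ} (hN : ∀ n, N < n → m (E n) = 0) :
    IsSuperReflexive 𝓜 := by
  refine (hE.hasUniformlyConvexRenorming hp1 hp LinearIsometry.id (N := N)
    fun z n hn => ?_).isSuperReflexive (ENNReal.toReal_pos fact_ne_zero hp)
  filter_upwards [measure_eq_zero_iff_ae_notMem.1 (hN n hn)] with x hx hxE using absurd hxE hx

/-! ### Truncation to the sets of bounded dimension -/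

variable (S)

theorem enorm_rpow_eq_lintegral (hp : p ≠ ∞) (v : 𝓜) :
    ‖v‖ₑ ^ p.toReal = ∫⁻ x, ‖S.pnorm v x‖ₑ ^ p.toReal ∂m := by
  rw [S.enorm_eq_eLpNorm, eLpNorm_rpow_eq_lintegral hp]

theorem enorm_indicator_rpow_eq_setLIntegral (hp : p ≠ ∞) {A : Set X} (hA : MeasurableSet A)
    (v : 𝓜) : ‖S.smul (linfIndicator m A hA) v‖ₑ ^ p.toReal =
      ∫⁻ x in A, ‖S.pnorm v x‖ₑ ^ p.toReal ∂m := by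
  rw [S.enorm_rpow_eq_lintegral hp, ← lintegral_indicator hA]
  refine lintegral_congr_ae ?_
  filter_upwards [S.pnorm_indicator hA v] with x hx
  rw [hx]
  by_cases hxA : x ∈ A
  · simp [hxA]
  · simp [hxA, ENNReal.zero_rpow_of_pos (ENNReal.toReal_pos fact_ne_zero hp)]

theorem smul_linfIndicator_compl {A : Set X} (hA : MeasurableSet A) (v : 𝓜) :
    S.smul (linfIndicator m Aᶜ hA.compl) v = v - S.smul (linfIndicator m A hA) v := by
  rw [eq_sub_iff_add_eq, ← LinearMap.add_apply, ← map_add]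
  nth_rw 2 [← S.one_smul v]
  congr 2
  apply Lp.ext
  filter_upwards [Lp.coeFn_add (linfIndicator m Aᶜ hA.compl) (linfIndicator m A hA),
    coeFn_linfIndicator (m := m) hA, coeFn_linfIndicator (m := m) hA.compl,
    coeFn_linfIndicator (m := m) MeasurableSet.univ] with x h1 h2 h3 h4
  rw [h1, Pi.add_apply, h2, h3, h4]
  by_cases hx : x ∈ A <;> simp [hx]

theorem norm_rpow_eq_add (hp : p ≠ ∞) {A : Set X} (hA : MeasurableSet A) (v : 𝓜) :
    ‖v‖ ^ p.toReal = ‖S.smul (linfIndicator m A hA) v‖ ^ p.toReal +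
      ‖v - S.smul (linfIndicator m A hA) v‖ ^ p.toReal := by
  rw [← S.smul_linfIndicator_compl hA]
  have h : ‖v‖ₑ ^ p.toReal = ‖S.smul (linfIndicator m A hA) v‖ₑ ^ p.toReal +
      ‖S.smul (linfIndicator m Aᶜ hA.compl) v‖ₑ ^ p.toReal := by
    rw [S.enorm_indicator_rpow_eq_setLIntegral hp, S.enorm_indicator_rpow_eq_setLIntegral hp,
      lintegral_add_compl _ hA, S.enorm_rpow_eq_lintegral hp]
  have hfin : ∀ w : 𝓜, ‖w‖ₑ ^ p.toReal ≠ ∞ := fun w =>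
    ENNReal.rpow_ne_top_of_nonneg ENNReal.toReal_nonneg enorm_ne_top
  have h2 := congrArg ENNReal.toReal h
  rw [ENNReal.toReal_add (hfin _) (hfin _)] at h2
  simpa only [← ENNReal.toReal_rpow, toReal_enorm] using h2

theorem norm_smul_linfIndicator_le {A : Set X} (hA : MeasurableSet A) (v : 𝓜) :
    ‖S.smul (linfIndicator m A hA) v‖ ≤ ‖v‖ := by
  rw [S.norm_eq, S.norm_eq]
  refine Lp.norm_le_norm_of_ae_le ?_
  filter_upwards [S.pnorm_indicator hA v] with x hx
  rw [hx]
  exact norm_indicator_le_norm_self _ _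

/-- Multiplication by the characteristic function of a set, as a continuous linear map. -/
noncomputable def truncation {A : Set X} (hA : MeasurableSet A) : 𝓜 →L[ℝ] 𝓜 :=
  (S.smul (linfIndicator m A hA)).mkContinuous 1 fun v => by
    rw [one_mul]
    exact S.norm_smul_linfIndicator_le hA v

/-- If the sets `A k` exhaust the space up to a null set, the truncations converge strongly to the
identity, by dominated convergence. -/
theorem tendsto_truncation (hp : p ≠ ∞) {A : ℕ → Set X} (hA : ∀ k, MeasurableSet (A k))
    (h : ∀ᵐ x ∂m, ∀ᶠ k in atTop, x ∈ A k) (v : 𝓜) :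
    Tendsto (fun k => S.truncation (hA k) v) atTop (𝓝 v) := by
  have hr0 : 0 < p.toReal := ENNReal.toReal_pos fact_ne_zero hp
  rw [tendsto_iff_edist_tendsto_0]
  have hlim : Tendsto (fun k => ‖v - S.truncation (hA k) v‖ₑ ^ p.toReal) atTop (𝓝 0) := by
    have h1 : ∀ k, ‖v - S.truncation (hA k) v‖ₑ ^ p.toReal =
        ∫⁻ x, (A k)ᶜ.indicator (fun x => ‖S.pnorm v x‖ₑ ^ p.toReal) x ∂m := by
      intro k
      change ‖v - S.smul (linfIndicator m (A k) (hA k)) v‖ₑ ^ p.toReal = _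
      rw [← S.smul_linfIndicator_compl, S.enorm_indicator_rpow_eq_setLIntegral hp,
        lintegral_indicator (hA k).compl]
    simp only [h1]
    have hm : Measurable fun x => ‖S.pnorm v x‖ₑ ^ p.toReal :=
      (Lp.stronglyMeasurable (S.pnorm v)).measurable.enorm.pow_const _
    rw [← lintegral_zero (μ := m) (α := X)]
    refine tendsto_lintegral_of_dominated_convergence (fun x => ‖S.pnorm v x‖ₑ ^ p.toReal)
      (fun k => hm.indicator (hA k).compl) (fun k => ae_of_all _ fun x =>
        Set.indicator_le_self _ _ x) ?_ ?_
    · rw [← S.enorm_rpow_eq_lintegral hp]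
      exact ENNReal.rpow_ne_top_of_nonneg hr0.le enorm_ne_top
    · filter_upwards [h] with x hx
      refine tendsto_const_nhds.congr' ?_
      filter_upwards [hx] with k hk
      exact (Set.indicator_of_notMem (Set.notMem_compl_iff.2 hk) _).symm
  have h2 := hlim.ennrpow_const p.toReal⁻¹
  simp only [ENNReal.rpow_rpow_inv hr0.ne', ENNReal.zero_rpow_of_pos (inv_pos.2 hr0)] at h2
  refine h2.congr fun k => ?_
  rw [edist_comm, edist_eq_enorm_sub]

variable {S}

theorem IsDimensionalDecomposition.isReflexiveSpace (hE : S.IsDimensionalDecomposition E)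
    (hp1 : 1 < p) (hp : p ≠ ∞) : IsReflexiveSpace 𝓜 := by
  have hr : 1 < p.toReal := by
    rw [← ENNReal.toReal_one]
    exact (ENNReal.toReal_lt_toReal ENNReal.one_ne_top hp).2 hp1
  have hEm := hE.measurableSet
  set D : ℕ → Set X := fun k => ⋃ i ∈ Finset.range k, E i with hD
  have hDm : ∀ k, MeasurableSet (D k) := fun k => Finset.measurableSet_biUnion _ fun i _ => hEm i
  have hmem : ∀ {x k}, x ∈ D k ↔ ∃ i < k, x ∈ E i := by
    intro x k
    simp [hD]
  have hsum : ∀ k v, S.smul (linfIndicator m (D k) (hDm k)) v =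
      ∑ i ∈ Finset.range k, S.smul (linfIndicator m (E i) (hEm i)) v := by
    intro k v
    rw [← LinearMap.sum_apply, ← map_sum]
    congr 2
    apply Lp.ext
    filter_upwards [coeFn_linfIndicator (m := m) (hDm k), coeFn_sum_linfIndicator (m := m) hEm k]
      with x h1 h2
    rw [h1, h2]
    exact congrFun (Finset.indicator_biUnion _ _ fun i _ j _ hij => hE.disjoint hij) x
  have hDD : ∀ j k, j ≤ k → D j ∩ D k = D j := fun j k hjk =>
    Set.inter_eq_left.2 fun x hx => by
      obtain ⟨i, hi, hxi⟩ := hmem.1 hx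
      exact hmem.2 ⟨i, hi.trans_le hjk, hxi⟩
  refine isReflexiveSpace_of_projections (P := fun k => S.truncation (hDm k)) hr
    (fun j k hjk v => S.smul_linfIndicator_linfIndicator _ _ _ (hDD j k hjk) v)
    (fun k v => S.norm_rpow_eq_add hp (hDm k) v)
    (S.tendsto_truncation hp hDm ?_) ?_ fun k => ?_
  · filter_upwards [ae_exists_mem_of_null_compl hE.null_compl] with x ⟨i, hi⟩
    filter_upwards [eventually_gt_atTop i] with k hk using hmem.2 ⟨i, hk, hi⟩
  · intro x C hx hC
    change ∀ j k, j ≤ k → S.smul (linfIndicator m (D j) (hDm j)) (x k) = x j at hx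
    have hcut : ∀ i n, i < n → S.smul (linfIndicator m (E i) (hEm i)) (x (i + 1)) =
        S.smul (linfIndicator m (E i) (hEm i)) (x n) := by
      intro i n hi
      rw [← hx (i + 1) n hi, S.smul_linfIndicator_linfIndicator _ _ (hEm i)]
      exact Set.inter_eq_left.2 fun y hy => hmem.2 ⟨i, Nat.lt_succ_self i, hy⟩
    have hpartial : ∀ n, ∑ i ∈ Finset.range n,
        S.smul (linfIndicator m (E i) (hEm i)) (x (i + 1)) = x n := by
      intro n
      rw [Finset.sum_congr rfl fun i hi => hcut i n (Finset.mem_range.1 hi), ← hsum, hx n n le_rfl]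
    obtain ⟨z, hz, -⟩ := S.glueing (fun i => x (i + 1)) E hEm (fun i j => by
      by_cases hij : i = j
      · subst hij
        rfl
      · rw [smul_linfIndicator_empty _ _ (Set.disjoint_iff_inter_eq_empty.1 (hE.disjoint hij)),
          smul_linfIndicator_empty _ _ (Set.disjoint_iff_inter_eq_empty.1 (hE.disjoint hij))]) (by
      simp only [hpartial]
      refine lt_of_le_of_lt (limsup_le_of_le (by isBoundedDefault)
        (Eventually.of_forall fun n => ?_)) (ENNReal.ofReal_lt_top (r := C))
      rw [← ofReal_norm]
      exact ENNReal.ofReal_le_ofReal (hC n))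
    refine ⟨z, fun k => ?_⟩
    change S.smul (linfIndicator m (D k) (hDm k)) z = x k
    rw [hsum, Finset.sum_congr rfl fun i _ => hz i, hpartial]
  · refine (hE.hasUniformlyConvexRenorming hp1 hp
      (ContinuousLinearMap.id ℝ 𝓜 - S.truncation (hDm k)).ker.subtypeₗᵢ (N := k)
      fun z n hn => ?_).isReflexiveSpace (one_pos.trans hr)
    have hz : S.smul (linfIndicator m (D k) (hDm k)) (z : 𝓜) = z :=
      (sub_eq_zero.1 (LinearMap.mem_ker.1 z.2)).symm
    filter_upwards [S.pnorm_indicator (hDm k) (z : 𝓜)] with x h1 hxE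
    rw [hz] at h1
    change S.pnorm (z : 𝓜) x = 0
    rw [h1]
    refine Set.indicator_of_notMem (fun hxD => ?_) _
    obtain ⟨i, hi, hxi⟩ := hmem.1 hxD
    exact Set.disjoint_left.1 (hE.disjoint (hi.trans hn).ne) hxi hxE

end LpNormedModule

end Module

theorem mainTheorem1 {X : Type u} [MeasurableSpace X] (m : Measure X) (p : ℝ≥0∞) [Fact (1 ≤ p)]
    {𝓜 : Type w} [NormedAddCommGroup 𝓜] [NormedSpace ℝ 𝓜] [CompleteSpace 𝓜]
    (S : LpNormedModule p m 𝓜) (E : ℕ → Set X) (hE : S.IsDimensionalDecomposition E) :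
    -- the representation
    (∃ (F : ∀ n, NormField X n) (T : 𝓜 ≃ₗᵢ[ℝ] VecLpProduct p m E F),
      (∀ (f : Lp ℝ ∞ m) (v : 𝓜) (n : ℕ), ∀ᵐ x ∂(m.restrict (E n)),
        T (S.smul f v) n x = f x • T v n x) ∧
      (∀ (v : 𝓜) (n : ℕ), ∀ᵐ x ∂(m.restrict (E n)), S.pnorm v x = (T v n).pnorm x) ∧
      -- the equivalent norm, if the dimension is bounded by `N`
      (∀ N : ℕ, (∀ n, N < n → m (E n) = 0) →
        ∃ (F' : ∀ n, NormField X n) (𝓜' : Type w) (_ : NormedAddCommGroup 𝓜')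
          (_ : NormedSpace ℝ 𝓜') (_ : CompleteSpace 𝓜') (S' : LpNormedModule p m 𝓜')
          (Φ : 𝓜 ≃ₗ[ℝ] 𝓜'),
          (∀ n x, IsInducedByScalarProduct ((F' n).normAt x)) ∧
          (∀ n x a, (F' n).normAt x a ≤ (F n).normAt x a ∧
            (F n).normAt x a ≤ √(n : ℝ) * (F' n).normAt x a) ∧
          (∀ f v, Φ (S.smul f v) = S'.smul f (Φ v)) ∧
          (∀ v n, ∀ᵐ x ∂(m.restrict (E n)), S'.pnorm (Φ v) x = (F' n).normAt x (T v n x)) ∧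
          (∀ v, ∀ᵐ x ∂m, S'.pnorm (Φ v) x ≤ S.pnorm v x ∧
            S.pnorm v x ≤ √(N : ℝ) * S'.pnorm (Φ v) x))) ∧
    -- reflexivity and super-reflexivity
    (1 < p → p < ∞ →
      IsReflexiveSpace 𝓜 ∧
      ∀ N : ℕ, (∀ n, N < n → m (E n) = 0) → IsSuperReflexive 𝓜) := by
  have hEm := hE.measurableSet
  refine ⟨?_, fun hp1 hp => ⟨hE.isReflexiveSpace hp1 hp.ne, fun N hN =>
    hE.isSuperReflexive hp1 hp.ne hN⟩⟩
  obtain ⟨F, T, hT, hTn⟩ := hE.exists_representation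
  refine ⟨F, T, hT, hTn, fun N hN => ?_⟩
  have hτ := LpNormedModule.isCoordinateSystem_of_representation hEm T hT hTn
  choose A F' _ hscalar hF' using fun n => (F n).exists_john
  obtain ⟨q, hqs, hq⟩ := hτ.exists_isPointwiseSeminorm hEm hE.disjoint hE.null_compl
    (fun n x a => (hF' n x a).1)
  have hC : ∀ v, ∀ᵐ x ∂m, S.pnorm v x ≤ √(N : ℝ) * q v x := fun v =>
    hτ.pnorm_le_sqrt_mul hE.null_compl (fun n x a => (hF' n x a).2) hqs hq fun n hn => by
      filter_upwards [measure_eq_zero_iff_ae_notMem.1 (hN n hn)] with x hx hxE using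
        absurd hxE hx
  refine ⟨F', LpNormedModule.Renormed hqs hC, inferInstance, inferInstance, inferInstance,
    LpNormedModule.Renormed.module hqs hC, LpNormedModule.Renormed.of hqs hC, hscalar, hF',
    fun f v => rfl, fun v n => (ae_restrict_iff' (hEm n)).2 (hq v n), fun v => ?_⟩
  filter_upwards [hqs.le_pnorm v, hC v] with x h1 h2 using ⟨h1, h2⟩
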